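/- Let $M^2$ be a connected smooth surface, $n\ge 6$, and let $f\colon M^2\to\mathbb{R}^n$ be a smooth immersion with second fundamental form $\alpha_f=\alpha_f^2$ and normal connection $\nabla^\perp$. The higher fundamental forms and normal spaces of $f$ are defined inductively by $$N_k^f(p)=\mathrm{span}\{\alpha_f^{k+1}(X_1,\dots,X_{k+1}): X_i\in T_pM\},\qquad \alpha_f^s(X_1,\dots,X_s)=\big(\nabla^\perp_{X_s}\cdots\nabla^\perp_{X_3}\alpha_f(X_2,X_1)\big)^{\perp}\quad(s\ge 3),$$ where $(\ )^\perp$ is the projection onto the orthogonal complement of $N_1^f\oplus\dots\oplus N_{s-2}^f$ in the normal space. The ellipse of curvature of order $s$ of $f$ at $p$ is $\mathcal{E}_s^f(p)=\{\alpha_f^{s+1}(X,\dots,X): X\in T_pM,\ \|X\|=1\}$. A minimal immersion $f$ is $m$-isotropic if $\mathcal{E}_r^f(p)$ is a nondegenerate circle for all $p\in M^2$ and $1\le r\le m$. An immersion $g\colon M^2\to\mathbb{R}^n$ is superconformal if its ellipse of curvature $\{\alpha_g(X,X): X\in T_pM,\ \|X\|=1\}$ is a nondegenerate circle at every $p\in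 M^2$. It is S-Willmore if, around each point, in isothermal coordinates $x,y$ with $\partial=\frac12(\partial_x-i\partial_y)$, the complex normal vectors $\hat\nabla^\perp_{\bar\partial}\,\alpha_g(\partial,\partial)$ and $\alpha_g(\partial,\partial)$ are parallel, where $\hat\nabla^\perp$ is the normal connection of $g$. **Theorem.** Let $f\colon M^2\to\mathbb{R}^n$, $n\ge 6$, be a $1$-isotropic minimal surface that is substantial (its image lies in no proper affine subspace of $\mathbb{R}^n$) and regular (for each $k$ the dimension of $N_k^f(p)$ does not depend on $p\in M^2$). Fix a point $o\in\mathbb{R}^n$, let $g(p)$ be the foot of the perpendicular from $o$ to the affine tangent plane $f(p)+f_*T_pM$, and assume that the pedal surface $g\colon M^2\to\mathbb{R}^n$ is an immersion. Then $g$ is superconformal if and only if $f$ is $2$-isotropic. In that case: (i) $f$ and $g$ are conformal, that is, the metrics they induce on $M^2$ are conformal; (ii) $g$ is not locally conformally equivalent to a minimal surface: there are no nonempty open set $U\subseteq M^2$ and Möbius transformation $T$ of $\mathbb{R}^n\cup\{\infty\}$ such that $T\circ g|_U$ is a minimal surface in $\mathbb{R}^n$; (iii) $g$ is never S-Willmore: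 for no nonempty open set $U\subseteq M^2$ is $g|_U$ S-Willmore. -/

import Mathlib

open scoped Manifold ContDiff InnerProductSpace

noncomputable section

namespace PedalSurface

/-- Euclidean space `ℝⁿ`. -/
abbrev Space (n : ℕ) : Type := EuclideanSpace ℝ (Fin n)

/-- The coordinate plane, on which two-dimensional manifolds are modelled. -/
abbrev Plane : Type := EuclideanSpace ℝ (Fin 2)

/-- A nondegenerate circle in `ℝⁿ`: all points at some fixed distance `r > 0` from a centre `c`,
within some affine plane through `c`. -/
def IsCircle {n : ℕ} (C : Set (Space n)) : Prop :=
  ∃ (c : Space n) (r : ℝ) (P : Submodule ℝ (Space n)),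
    0 < r ∧ Module.finrank ℝ P = 2 ∧ C = {y | y - c ∈ P ∧ ‖y - c‖ = r}

/-! ### Parametrized surfaces

`F : Plane → Space n` is a local parametrization of a surface, and `x` a point of the plane at which
`F` is an immersion.  Vectors `v : Plane` are tangent vectors in coordinates, and at the same time
stand for the coordinate vector field with these constant components. -/

section Local

variable {n : ℕ}

/-- The (linear) tangent plane of `F` at `x`. -/
def tangentPlane (F : Plane → Space n) (x : Plane) : Submodule ℝ (Space n) :=
  (fderiv ℝ F x).range

/-- The component of `u` in the normal space of `F` at `x`. -/
def normalPart (F : Plane → Space n) (x : Plane) (u : Space n) : Space n :=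
  (tangentPlane F x)ᗮ.starProjection u

/-- The normal connection: `∇^⊥_v ξ` at `x`, for a field `ξ` along `F`. -/
def normalDeriv (F : Plane → Space n) (v : Plane) (ξ : Plane → Space n) (x : Plane) : Space n :=
  normalPart F x (fderiv ℝ ξ x v)

/-- The second fundamental form `α(v, w)` at `x`: the normal component of the derivative of
`F_* w` in the direction `v`. -/
def secondFF (F : Plane → Space n) (v w : Plane) (x : Plane) : Space n :=
  normalPart F x (fderiv ℝ (fun y => fderiv ℝ F y w) x v)

/-- The iterated normal derivative `∇^⊥_{X_s} ⋯ ∇^⊥_{X_3} α(X_2, X_1)`, where `s = k + 2` and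
`X_1, …, X_s` are the coordinate fields `X 0, …, X (k + 1)`. -/
def iteratedNormalDeriv (F : Plane → Space n) :
    (k : ℕ) → (Fin (k + 2) → Plane) → Plane → Space n
  | 0, X => secondFF F (X 1) (X 0)
  | k + 1, X => normalDeriv F (X (Fin.last (k + 2))) (iteratedNormalDeriv F k (Fin.init X))

/-- The sum `N_1 + ⋯ + N_k` of the first `k` normal spaces of `F` at `x`; the summand added at step
`k + 1` is `normalSpace F k x` below. -/
def normalSum (F : Plane → Space n) : ℕ → Plane → Submodule ℝ (Space n)
  | 0, _ => ⊥
  | k + 1, x => normalSum F k x ⊔ Submodule.span ℝ (Set.range fun X : Fin (k + 2) → Plane =>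
      (normalSum F k x)ᗮ.starProjection (iteratedNormalDeriv F k X x))

/-- The fundamental form `α^s(X_1, …, X_s)` of order `s = k + 2` at `x`: the component of
`∇^⊥_{X_s} ⋯ ∇^⊥_{X_3} α(X_2, X_1)` orthogonal to `N_1 + ⋯ + N_{s-2}`.  It is tensorial, so that
it is enough to evaluate it on coordinate fields. -/
def fundamentalForm (F : Plane → Space n) (k : ℕ) (X : Fin (k + 2) → Plane) (x : Plane) :
    Space n :=
  (normalSum F k x)ᗮ.starProjection (iteratedNormalDeriv F k X x)

/-- The normal space `N_{k+1}` of `F` at `x`, spanned by the values of `α^{k+2}`. -/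
def normalSpace (F : Plane → Space n) (k : ℕ) (x : Plane) : Submodule ℝ (Space n) :=
  Submodule.span ℝ (Set.range fun X : Fin (k + 2) → Plane => fundamentalForm F k X x)

/-- The ellipse of curvature `{α(v, v) : v a unit tangent vector}` of `F` at `x`. -/
def curvatureEllipse (F : Plane → Space n) (x : Plane) : Set (Space n) :=
  {y | ∃ v : Plane, ‖fderiv ℝ F x v‖ = 1 ∧ y = secondFF F v v x}

/-- The ellipse of curvature of order `k + 1`, namely
`{α^{k+2}(v, …, v) : v a unit tangent vector}`. -/
def higherEllipse (F : Plane → Space n) (k : ℕ) (x : Plane) : Set (Space n) :=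
  {y | ∃ v : Plane, ‖fderiv ℝ F x v‖ = 1 ∧ y = fundamentalForm F k (fun _ => v) x}

/-- The mean curvature vector of `F` vanishes at `x`: `α(v, v) + α(w, w) = 0` for orthonormal
tangent vectors `v`, `w`. -/
def MeanCurvatureVanishes (F : Plane → Space n) (x : Plane) : Prop :=
  ∀ v w : Plane, ‖fderiv ℝ F x v‖ = 1 → ‖fderiv ℝ F x w‖ = 1 →
    ⟪fderiv ℝ F x v, fderiv ℝ F x w⟫_ℝ = 0 → secondFF F v v x + secondFF F w w x = 0

/-- The first coordinate field. -/
def e₁ : Plane := EuclideanSpace.single 0 1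

/-- The second coordinate field. -/
def e₂ : Plane := EuclideanSpace.single 1 1

/-- The coordinates of the plane are isothermal for the metric induced by `F`, at `x`. -/
def IsIsothermalAt (F : Plane → Space n) (x : Plane) : Prop :=
  ‖fderiv ℝ F x e₁‖ = ‖fderiv ℝ F x e₂‖ ∧ ⟪fderiv ℝ F x e₁, fderiv ℝ F x e₂⟫_ℝ = 0

/-- The real part of `α(∂, ∂)`, where `∂ = (∂₁ - i ∂₂) / 2`. -/
def hopfRe (F : Plane → Space n) (x : Plane) : Space n :=
  (1 / 4 : ℝ) • (secondFF F e₁ e₁ x - secondFF F e₂ e₂ x)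

/-- The imaginary part of `α(∂, ∂)`. -/
def hopfIm (F : Plane → Space n) (x : Plane) : Space n :=
  -((1 / 2 : ℝ) • secondFF F e₁ e₂ x)

/-- The real part of `∇^⊥_{∂̄} α(∂, ∂)`, where `∂̄ = (∂₁ + i ∂₂) / 2`. -/
def dbarHopfRe (F : Plane → Space n) (x : Plane) : Space n :=
  (1 / 2 : ℝ) • (normalDeriv F e₁ (hopfRe F) x - normalDeriv F e₂ (hopfIm F) x)

/-- The imaginary part of `∇^⊥_{∂̄} α(∂, ∂)`. -/
def dbarHopfIm (F : Plane → Space n) (x : Plane) : Space n :=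
  (1 / 2 : ℝ) • (normalDeriv F e₁ (hopfIm F) x + normalDeriv F e₂ (hopfRe F) x)

/-- The vector `u + i v` of `ℂⁿ`. -/
def complexVector (u v : Space n) : Fin n → ℂ := fun j => (u j : ℂ) + (v j : ℂ) * Complex.I

/-- `∇^⊥_{∂̄} α(∂, ∂)` and `α(∂, ∂)` are parallel (linearly dependent over `ℂ`) at `x`. -/
def DbarHopfParallel (F : Plane → Space n) (x : Plane) : Prop :=
  ¬ LinearIndependent ℂ
    ![complexVector (dbarHopfRe F x) (dbarHopfIm F x), complexVector (hopfRe F x) (hopfIm F x)]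

end Local

/-! ### Surfaces

`M` is a smooth surface (two-dimensional manifold).  The local notions above are evaluated in all
charts `e` of its maximal smooth atlas, on the local parametrizations `f ∘ e.symm`. -/

section Global

variable {n : ℕ} {M : Type*} [TopologicalSpace M] [ChartedSpace (EuclideanSpace ℝ (Fin 2)) M]

/-- The differential of `f : M → ℝⁿ` at `p`. -/
def differential (f : M → Space n) (p : M) : TangentSpace (𝓡 2) p →L[ℝ] Space n :=
  mfderiv (𝓡 2) 𝓘(ℝ, Space n) f p

/-- `f` is a smooth immersion on the open set `U`. -/
def IsImmersionOn (f : M → Space n) (U : Set M) : Prop :=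
  ContMDiffOn (𝓡 2) 𝓘(ℝ, Space n) ∞ f U ∧ ∀ p ∈ U, Function.Injective (differential f p)

/-- `f` is an immersed minimal surface on the open set `U`. -/
def IsMinimalOn (f : M → Space n) (U : Set M) : Prop :=
  IsImmersionOn f U ∧ ∀ e ∈ IsManifold.maximalAtlas (𝓡 2) ∞ M, ∀ x ∈ e.target,
    e.symm x ∈ U → MeanCurvatureVanishes (f ∘ e.symm) x

/-- The immersion `f` is regular (nicely curved): each normal space `N_{k+1}` has a dimension that
does not depend on the point. -/
def IsRegular (f : M → Space n) : Prop :=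
  ∀ k : ℕ, ∃ d : ℕ, ∀ e ∈ IsManifold.maximalAtlas (𝓡 2) ∞ M, ∀ x ∈ e.target,
    Module.finrank ℝ (normalSpace (f ∘ e.symm) k x) = d

/-- `f` is `m`-isotropic: a minimal surface whose ellipses of curvature of the orders
`1, …, m` are circles everywhere. -/
def IsIsotropic (m : ℕ) (f : M → Space n) : Prop :=
  IsMinimalOn f Set.univ ∧ ∀ k < m, ∀ e ∈ IsManifold.maximalAtlas (𝓡 2) ∞ M, ∀ x ∈ e.target,
    IsCircle (higherEllipse (f ∘ e.symm) k x)

/-- `f` is substantial: its image lies in no proper affine subspace. -/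
def IsSubstantial (f : M → Space n) : Prop :=
  affineSpan ℝ (Set.range f) = ⊤

/-- The pedal map of `f` with respect to the point `o`: the foot of the perpendicular from `o` to
the affine tangent plane of `f` at `p`. -/
def pedal (f : M → Space n) (o : Space n) (p : M) : Space n :=
  f p + (differential f p).range.starProjection (o - f p)

/-- `g` is superconformal: an immersion whose ellipse of curvature is a nondegenerate circle at
every point. -/
def IsSuperconformal (g : M → Space n) : Prop :=
  IsImmersionOn g Set.univ ∧ ∀ e ∈ IsManifold.maximalAtlas (𝓡 2) ∞ M, ∀ x ∈ e.target,
    IsCircle (curvatureEllipse (g ∘ e.symm) x)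

/-- The metrics that `f` and `g` induce on `M` are conformal. -/
def AreConformal (f g : M → Space n) : Prop :=
  ∃ μ : M → ℝ, (∀ p, 0 < μ p) ∧ ∀ (p : M) (X Y : TangentSpace (𝓡 2) p),
    ⟪differential g p X, differential g p Y⟫_ℝ
      = μ p * ⟪differential f p X, differential f p Y⟫_ℝ

/-- `g` is an S-Willmore surface on the open set `U`: around each point of `U` there are isothermal
coordinates in which `∇^⊥_{∂̄} α_g(∂, ∂)` is parallel to `α_g(∂, ∂)`. -/
def IsSWillmoreOn (g : M → Space n) (U : Set M) : Prop :=
  ∀ p ∈ U, ∃ e ∈ IsManifold.maximalAtlas (𝓡 2) ∞ M, p ∈ e.source ∧ e.source ⊆ U ∧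
    ∀ x ∈ e.target, IsIsothermalAt (g ∘ e.symm) x ∧ DbarHopfParallel (g ∘ e.symm) x

open Classical in
/-- The inversion of `ℝⁿ ∪ {∞}` in the sphere with centre `c` and radius `R`. -/
def sphereInversion (c : Space n) (R : ℝ) (z : OnePoint (Space n)) : OnePoint (Space n) :=
  z.elim (c : OnePoint (Space n)) fun x =>
    if x = c then OnePoint.infty else (EuclideanGeometry.inversion c R x : Space n)

/-- The group of Möbius transformations of `ℝⁿ ∪ {∞}`, generated by the inversions in spheres and
the isometries of `ℝⁿ`. -/
def moebiusGroup (n : ℕ) : Subgroup (Equiv.Perm (OnePoint (Space n))) :=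
  Subgroup.closure {σ |
    (∃ (c : Space n) (R : ℝ), 0 < R ∧ ∀ z, σ z = sphereInversion c R z) ∨
    (∃ φ : Space n ≃ᵢ Space n, ∀ z, σ z = OnePoint.map φ z)}

/-- On the open set `U`, the surface `g` is congruent by a Möbius transformation to a minimal
surface `h` of `ℝⁿ`. -/
def IsMoebiusMinimalOn (g : M → Space n) (U : Set M) : Prop :=
  ∃ T ∈ moebiusGroup n, ∃ h : M → Space n,
    (∀ p ∈ U, T (g p : OnePoint (Space n)) = (h p : OnePoint (Space n))) ∧ IsMinimalOn h U

end Global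

end PedalSurface

end

/-! Work in isothermal coordinates and complexify, using the bilinear (not Hermitian) product on ℂⁿ.
Put φ = ∂F, ψ = α(∂,∂) (`hopf`), χ = α³(∂,∂,∂) (`cubic`), ρ = φ·φ̄ and σ = ψ·ψ̄. Minimality says ∂̄φ
= 0. The ellipse of order 1 is a nondegenerate circle exactly when ψ is isotropic (ψ·ψ = 0) and
nonzero, and likewise order 2 with χ. A 1-isotropic minimal surface then has the frame equations ∂φ
= κφ + ψ, ∂ψ = μψ + χ, ∂̄ψ = -(σ/ρ)φ, with χ orthogonal to φ, ψ and their conjugates.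

Let a = (F-o)·φ̄/ρ and b = (F-o)·ψ/ρ. The pedal surface is G = F - aφ - āφ̄, and since ∂a = 1 - κa
and ∂̄a = b̄, almost everything cancels: ∂G = -(aψ + bφ̄) (`hasWirt_pedal`). The vectors ψ and φ̄
are isotropic and mutually orthogonal, so ∂G·∂G = 0 and G is conformal to F. One more derivative
gives ∂∂G = -aχ plus a combination of ψ and φ̄, whence α_G(∂,∂)·α_G(∂,∂) = a² χ·χ. If χ is
isotropic, so is α_G(∂,∂). Conversely a vanishes on no open set, because ∂a = 1 there would
contradict a = 0, so continuity forces χ·χ = 0 everywhere (`cubic_isotropic_of_pedal`).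

Nondegeneracy rests on χ ≠ 0 (`cubic_ne_zero`). If χ vanished at one point, regularity would make it
vanish everywhere; the span of φ, ψ and their conjugates would be parallel, and the surface would
lie in an affine 4-space.

For (iii), suppose s(∂̄α_G(∂,∂))^⊥ + tα_G(∂,∂) = 0. Pairing with χ̄ and with one further normal
vector gives two linear equations in s and t whose only solution is zero
(`not_dbarHopfParallel_pedal`). For (ii), minimal surfaces satisfy this dependence with t = 0, and
the dependence is invariant under inversions and isometries (`exists_of_moebius`), so the same
computation excludes them.

Two bridges lead back to manifolds: isothermal coordinates on a minimal surface are built from a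
harmonic coordinate function and its conjugate (`exists_isothermal`), and the ellipses in an
arbitrary chart are computed from ψ and χ in an isothermal one (`IsReparam`). -/

noncomputable section

namespace PedalSurface

open scoped Topology ComplexConjugate Matrix

set_option linter.unusedSectionVars false

/-! ### Wirtinger calculus on the coordinate plane -/

/-- The complex number `v₁ + i v₂` of a vector of the plane. -/
def zeta (v : Plane) : ℂ := ⟨v 0, v 1⟩

section Wirtinger

variable {E : Type*} [NormedAddCommGroup E] [NormedSpace ℝ E] [NormedSpace ℂ E] [IsScalarTower ℝ ℂ E]

/-- The real-linear map `a dz + b dz̄`. -/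
def wirt (a b : E) : Plane →L[ℝ] E :=
  (EuclideanSpace.proj (0 : Fin 2) : Plane →L[ℝ] ℝ).smulRight (a + b) +
    (EuclideanSpace.proj (1 : Fin 2) : Plane →L[ℝ] ℝ).smulRight (Complex.I • (a - b))

theorem wirt_apply (a b : E) (v : Plane) :
    wirt a b v = zeta v • a + conj (zeta v) • b := by
  have h (r : ℝ) (w : E) : r • w = (r : ℂ) • w := by
    rw [← Complex.coe_algebraMap, algebraMap_smul]
  have hz : zeta v = (v 0 : ℂ) + (v 1 : ℂ) * Complex.I := by
    apply Complex.ext <;> simp [zeta]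
  simp only [wirt, add_apply, ContinuousLinearMap.smulRight_apply,
    h, hz, map_add, map_mul, Complex.conj_ofReal, Complex.conj_I]
  change ((v 0 : ℂ)) • (a + b) + ((v 1 : ℂ)) • Complex.I • (a - b) = _
  module

/-- `h` is differentiable at `x`, with `∂h = a` and `∂̄h = b`. -/
def HasWirt (h : Plane → E) (a b : E) (x : Plane) : Prop := HasFDerivAt h (wirt a b) x

/-- The operator `∂ = (∂₁ - i ∂₂) / 2`. -/
def dz (h : Plane → E) (x : Plane) : E :=
  (1 / 2 : ℂ) • (fderiv ℝ h x e₁ - Complex.I • fderiv ℝ h x e₂)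

/-- The operator `∂̄ = (∂₁ + i ∂₂) / 2`. -/
def dzbar (h : Plane → E) (x : Plane) : E :=
  (1 / 2 : ℂ) • (fderiv ℝ h x e₁ + Complex.I • fderiv ℝ h x e₂)

theorem plane_eq (v : Plane) : v = v 0 • e₁ + v 1 • e₂ := by
  ext i; fin_cases i <;> simp [e₁, e₂]

@[simp] theorem zeta_e₁ : zeta e₁ = 1 := by apply Complex.ext <;> simp [zeta, e₁]

@[simp] theorem zeta_e₂ : zeta e₂ = Complex.I := by apply Complex.ext <;> simp [zeta, e₂]

theorem ext_plane {L L' : Plane →L[ℝ] E} (h₁ : L e₁ = L' e₁) (h₂ : L e₂ = L' e₂) : L = L' := by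
  ext v
  rw [plane_eq v]
  simp [h₁, h₂]

theorem eq_wirt (L : Plane →L[ℝ] E) :
    L = wirt ((1 / 2 : ℂ) • (L e₁ - Complex.I • L e₂)) ((1 / 2 : ℂ) • (L e₁ + Complex.I • L e₂)) := by
  apply ext_plane
  · rw [wirt_apply, zeta_e₁, map_one]; module
  · rw [wirt_apply, zeta_e₂, Complex.conj_I]
    match_scalars
    · linear_combination Complex.I_sq
    · ring

theorem hasWirt_of_differentiableAt {h : Plane → E} {x : Plane} (hd : DifferentiableAt ℝ h x) :
    HasWirt h (dz h x) (dzbar h x) x := by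
  have := hd.hasFDerivAt
  rw [eq_wirt (fderiv ℝ h x)] at this
  exact this

theorem wirt_e₁ (a b : E) : wirt a b e₁ = a + b := by simp [wirt_apply]

theorem wirt_e₂ (a b : E) : wirt a b e₂ = Complex.I • (a - b) := by
  simp only [wirt_apply, zeta_e₂, Complex.conj_I]; module

theorem wirt_left (a b : E) :
    (1 / 2 : ℂ) • (wirt a b e₁ - Complex.I • wirt a b e₂) = a := by
  rw [wirt_e₁, wirt_e₂, smul_smul, Complex.I_mul_I]; module

theorem wirt_right (a b : E) :
    (1 / 2 : ℂ) • (wirt a b e₁ + Complex.I • wirt a b e₂) = b := by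
  rw [wirt_e₁, wirt_e₂, smul_smul, Complex.I_mul_I]; module

namespace HasWirt

variable {h k : Plane → E} {a b a' b' : E} {x : Plane}

theorem differentiableAt (H : HasWirt h a b x) : DifferentiableAt ℝ h x :=
  HasFDerivAt.differentiableAt H

theorem fderiv (H : HasWirt h a b x) : fderiv ℝ h x = wirt a b := HasFDerivAt.fderiv H

theorem dz_eq (H : HasWirt h a b x) : dz h x = a := by
  rw [dz, H.fderiv, wirt_left]

theorem dzbar_eq (H : HasWirt h a b x) : dzbar h x = b := by
  rw [dzbar, H.fderiv, wirt_right]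

theorem unique_left (H : HasWirt h a b x) (H' : HasWirt h a' b' x) : a = a' := by
  rw [← H.dz_eq, H'.dz_eq]

theorem unique_right (H : HasWirt h a b x) (H' : HasWirt h a' b' x) : b = b' := by
  rw [← H.dzbar_eq, H'.dzbar_eq]

theorem congr_of_eventuallyEq (H : HasWirt h a b x) (e : k =ᶠ[𝓝 x] h) : HasWirt k a b x :=
  HasFDerivAt.congr_of_eventuallyEq H e

theorem congr_left (H : HasWirt h a b x) (e : a = a') : HasWirt h a' b x := e ▸ H

theorem congr_right (H : HasWirt h a b x) (e : b = b') : HasWirt h a b' x := e ▸ H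

theorem const (c : E) : HasWirt (fun _ => c) 0 0 x := by
  have : wirt (0 : E) 0 = 0 := by ext v; simp [wirt_apply]
  rw [HasWirt, this]; exact hasFDerivAt_const c x

theorem add (H : HasWirt h a b x) (K : HasWirt k a' b' x) :
    HasWirt (fun y => h y + k y) (a + a') (b + b') x := by
  have := HasFDerivAt.add H K
  refine this.congr_fderiv ?_
  ext v; simp only [add_apply, wirt_apply]; module

theorem neg (H : HasWirt h a b x) : HasWirt (fun y => - h y) (-a) (-b) x := by
  have := HasFDerivAt.neg H
  refine this.congr_fderiv ?_
  ext v; simp only [neg_apply, wirt_apply]; module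

theorem sub (H : HasWirt h a b x) (K : HasWirt k a' b' x) :
    HasWirt (fun y => h y - k y) (a - a') (b - b') x := by
  simpa only [sub_eq_add_neg] using H.add K.neg

theorem smul {s : Plane → ℂ} {p q : ℂ} (S : HasWirt s p q x) (H : HasWirt h a b x) :
    HasWirt (fun y => s y • h y) (p • h x + s x • a) (q • h x + s x • b) x := by
  have := HasFDerivAt.smul S H
  refine this.congr_fderiv ?_
  ext v
  simp only [add_apply, wirt_apply, smul_apply,
    ContinuousLinearMap.smulRight_apply, smul_eq_mul]
  module

theorem const_smul (c : ℂ) (H : HasWirt h a b x) :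
    HasWirt (fun y => c • h y) (c • a) (c • b) x := by
  simpa using (HasWirt.const c).smul H

theorem comp_clm {E' : Type*} [NormedAddCommGroup E'] [NormedSpace ℝ E'] [NormedSpace ℂ E']
    [IsScalarTower ℝ ℂ E'] (L : E →L[ℂ] E') (H : HasWirt h a b x) :
    HasWirt (fun y => L (h y)) (L a) (L b) x := by
  have := ((L.restrictScalars ℝ).hasFDerivAt (x := h x)).comp x H
  refine HasFDerivAt.congr_fderiv this ?_
  ext v
  simp [wirt_apply]

end HasWirt

end Wirtinger

namespace HasWirt

variable {s t : Plane → ℂ} {p q p' q' : ℂ} {x : Plane}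

theorem mul (S : HasWirt s p q x) (T : HasWirt t p' q' x) :
    HasWirt (fun y => s y * t y) (p * t x + s x * p') (q * t x + s x * q') x := by
  simpa using S.smul T

theorem star (S : HasWirt s p q x) : HasWirt (fun y => star (s y)) (star q) (star p) x := by
  have := (Complex.conjCLE.toContinuousLinearMap.hasFDerivAt (x := s x)).comp x S
  refine HasFDerivAt.congr_fderiv this ?_
  ext v
  simp [wirt_apply, add_comm]

theorem inv (S : HasWirt s p q x) (hs : s x ≠ 0) :
    HasWirt (fun y => (s y)⁻¹) (-p / s x ^ 2) (-q / s x ^ 2) x := by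
  have h1 := (hasDerivAt_inv hs).hasFDerivAt.restrictScalars ℝ
  have := HasFDerivAt.comp x h1 S
  refine HasFDerivAt.congr_fderiv this ?_
  ext v
  simp [wirt_apply]
  field_simp
  ring

theorem div (S : HasWirt s p q x) (T : HasWirt t p' q' x) (ht : t x ≠ 0) :
    HasWirt (fun y => s y / t y) ((p - s x / t x * p') / t x) ((q - s x / t x * q') / t x) x := by
  have := S.mul (T.inv ht)
  simp only [← div_eq_mul_inv] at this
  refine (this.congr_left ?_).congr_right ?_ <;> field_simp <;> ring

end HasWirt

/-- Complex vectors. -/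
abbrev CSpace (n : ℕ) : Type := Fin n → ℂ

/-! ### Wirtinger derivatives of complex vectors and of their bilinear products. -/

section Vector

variable {n : ℕ} {h k : Plane → CSpace n} {a b a' b' : CSpace n} {x : Plane}

theorem hasWirt_pi : HasWirt h a b x ↔ ∀ j, HasWirt (fun y => h y j) (a j) (b j) x := by
  unfold HasWirt
  rw [hasFDerivAt_pi']
  refine forall_congr' fun j => ?_
  have : (ContinuousLinearMap.proj (R := ℝ) j).comp (wirt a b) = wirt (a j) (b j) := by
    ext v; simp [wirt_apply]
  rw [this]

theorem HasWirt.sum {ι : Type*} (u : Finset ι) {s : ι → Plane → ℂ} {p q : ι → ℂ}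
    (H : ∀ i ∈ u, HasWirt (s i) (p i) (q i) x) :
    HasWirt (fun y => ∑ i ∈ u, s i y) (∑ i ∈ u, p i) (∑ i ∈ u, q i) x := by
  have := HasFDerivAt.fun_sum H
  refine HasFDerivAt.congr_fderiv this ?_
  ext v
  simp [wirt_apply, Finset.sum_add_distrib, Finset.mul_sum]

theorem HasWirt.dot (H : HasWirt h a b x) (K : HasWirt k a' b' x) :
    HasWirt (fun y => h y ⬝ᵥ k y) (a ⬝ᵥ k x + h x ⬝ᵥ a') (b ⬝ᵥ k x + h x ⬝ᵥ b') x := by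
  rw [hasWirt_pi] at H K
  have := HasWirt.sum Finset.univ fun j _ => (H j).mul (K j)
  simpa [dotProduct, Finset.sum_add_distrib] using this

theorem HasWirt.vstar (H : HasWirt h a b x) :
    HasWirt (fun y => Star.star (h y)) (Star.star b) (Star.star a) x := by
  rw [hasWirt_pi] at H ⊢
  exact fun j => (H j).star

end Vector

/-! ### Smoothness and commutation of ∂ and ∂̄. -/

section Smooth

variable {E : Type*} [NormedAddCommGroup E] [NormedSpace ℝ E] [NormedSpace ℂ E] [IsScalarTower ℝ ℂ E]
  {D : Set Plane} {h : Plane → E} {x : Plane}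

theorem hasWirt_of_contDiffOn (hD : IsOpen D) (hh : ContDiffOn ℝ ∞ h D) (hx : x ∈ D) :
    HasWirt h (dz h x) (dzbar h x) x :=
  hasWirt_of_differentiableAt ((hh.contDiffAt (hD.mem_nhds hx)).differentiableAt (by simp))

theorem contDiffOn_fderiv_apply {E' : Type*} [NormedAddCommGroup E'] [NormedSpace ℝ E']
    {h : Plane → E'} (hD : IsOpen D) (hh : ContDiffOn ℝ ∞ h D) (v : Plane) :
    ContDiffOn ℝ ∞ (fun y => fderiv ℝ h y v) D :=
  (hh.fderiv_of_isOpen hD (by simp)).clm_apply contDiffOn_const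

theorem contDiffOn_dz (hD : IsOpen D) (hh : ContDiffOn ℝ ∞ h D) : ContDiffOn ℝ ∞ (dz h) D :=
  ((contDiffOn_fderiv_apply hD hh e₁).sub
    ((contDiffOn_fderiv_apply hD hh e₂).const_smul Complex.I)).const_smul (1 / 2 : ℂ)

theorem fderiv_fderiv_apply {E' : Type*} [NormedAddCommGroup E'] [NormedSpace ℝ E']
    {h : Plane → E'} (hD : IsOpen D) (hh : ContDiffOn ℝ ∞ h D) (hx : x ∈ D) (v w : Plane) :
    fderiv ℝ (fun y => fderiv ℝ h y v) x w = fderiv ℝ (fderiv ℝ h) x w v := by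
  have : DifferentiableAt ℝ (fderiv ℝ h) x :=
    ((hh.fderiv_of_isOpen (m := ∞) hD (by simp)).contDiffAt (hD.mem_nhds hx)).differentiableAt (by simp)
  rw [fderiv_clm_apply this (by fun_prop)]
  simp

theorem fderiv_fderiv_comm {E' : Type*} [NormedAddCommGroup E'] [NormedSpace ℝ E']
    {h : Plane → E'} (hD : IsOpen D) (hh : ContDiffOn ℝ ∞ h D) (hx : x ∈ D) (v w : Plane) :
    fderiv ℝ (fun y => fderiv ℝ h y v) x w = fderiv ℝ (fun y => fderiv ℝ h y w) x v := by
  rw [fderiv_fderiv_apply hD hh hx, fderiv_fderiv_apply hD hh hx]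
  exact (hh.contDiffAt (hD.mem_nhds hx)).isSymmSndFDerivAt (by simp; exact WithTop.coe_le_coe.2 le_top) w v

theorem fderiv_dz (hD : IsOpen D) (hh : ContDiffOn ℝ ∞ h D) (hx : x ∈ D) (v : Plane) :
    fderiv ℝ (dz h) x v = (1 / 2 : ℂ) • (fderiv ℝ (fun y => fderiv ℝ h y e₁) x v -
      Complex.I • fderiv ℝ (fun y => fderiv ℝ h y e₂) x v) := by
  have h1 := ((contDiffOn_fderiv_apply hD hh e₁).contDiffAt (hD.mem_nhds hx)).differentiableAt
    (by simp)
  have h2 := ((contDiffOn_fderiv_apply hD hh e₂).contDiffAt (hD.mem_nhds hx)).differentiableAt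
    (by simp)
  have := (h1.hasFDerivAt.sub (h2.hasFDerivAt.const_smul Complex.I)).const_smul (1 / 2 : ℂ)
  have h3 : fderiv ℝ (dz h) x = _ := this.fderiv
  rw [h3]; simp

theorem fderiv_dzbar (hD : IsOpen D) (hh : ContDiffOn ℝ ∞ h D) (hx : x ∈ D) (v : Plane) :
    fderiv ℝ (dzbar h) x v = (1 / 2 : ℂ) • (fderiv ℝ (fun y => fderiv ℝ h y e₁) x v +
      Complex.I • fderiv ℝ (fun y => fderiv ℝ h y e₂) x v) := by
  have h1 := ((contDiffOn_fderiv_apply hD hh e₁).contDiffAt (hD.mem_nhds hx)).differentiableAt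
    (by simp)
  have h2 := ((contDiffOn_fderiv_apply hD hh e₂).contDiffAt (hD.mem_nhds hx)).differentiableAt
    (by simp)
  have := (h1.hasFDerivAt.add (h2.hasFDerivAt.const_smul Complex.I)).const_smul (1 / 2 : ℂ)
  have h3 : fderiv ℝ (dzbar h) x = _ := this.fderiv
  rw [h3]; simp

theorem dz_dzbar_comm (hD : IsOpen D) (hh : ContDiffOn ℝ ∞ h D) (hx : x ∈ D) :
    dz (dzbar h) x = dzbar (dz h) x := by
  rw [dz, dzbar, fderiv_dz hD hh hx, fderiv_dz hD hh hx, fderiv_dzbar hD hh hx,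
    fderiv_dzbar hD hh hx, fderiv_fderiv_comm hD hh hx e₂ e₁]
  module

end Smooth

/-! ### Complexified Euclidean space -/

section Complexification

variable {n : ℕ}

/-- The inclusion `ℝⁿ → ℂⁿ`. -/
def cx : Space n →L[ℝ] CSpace n :=
  ContinuousLinearMap.pi fun j => Complex.ofRealCLM.comp (EuclideanSpace.proj j)

@[simp] theorem cx_apply (u : Space n) (j : Fin n) : cx u j = (u j : ℂ) := rfl

/-- Twice the real part of a complex vector. -/
def twoRe (w : CSpace n) : Space n := WithLp.toLp 2 fun j => 2 * (w j).re

theorem cx_twoRe (w : CSpace n) : cx (twoRe w) = w + star w := by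
  ext j
  simp [twoRe, Complex.add_conj]

theorem cx_injective : Function.Injective (cx : Space n → CSpace n) := by
  intro u v h
  ext j
  have := congrFun h j
  simpa using this

@[simp] theorem star_cx (u : Space n) : star (cx u) = cx u := by
  ext j; simp

theorem cx_smul (r : ℝ) (u : Space n) : cx (r • u) = (r : ℂ) • cx u := by
  ext j; simp

theorem cx_dot (u v : Space n) : cx u ⬝ᵥ cx v = ((⟪u, v⟫_ℝ : ℝ) : ℂ) := by
  simp [dotProduct, PiLp.inner_apply, mul_comm]

theorem complexVector_eq (u v : Space n) : complexVector u v = cx u + Complex.I • cx v := by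
  ext j; simp [complexVector, mul_comm]

theorem star_dot (u v : CSpace n) : star (u ⬝ᵥ v) = star u ⬝ᵥ star v := by
  simp [dotProduct]

theorem dot_star_self (w : CSpace n) : w ⬝ᵥ star w = ((∑ j, ‖w j‖ ^ 2 : ℝ) : ℂ) := by
  simp [dotProduct, Complex.mul_conj, Complex.normSq_eq_norm_sq]

theorem dot_star_self_eq_zero {w : CSpace n} : w ⬝ᵥ star w = 0 ↔ w = 0 := by
  rw [dot_star_self]
  norm_cast
  rw [Finset.sum_eq_zero_iff_of_nonneg (fun _ _ => by positivity)]
  simp [funext_iff]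

theorem star_dot_star_self (w : CSpace n) : star (w ⬝ᵥ star w) = w ⬝ᵥ star w := by
  rw [star_dot, star_star, dotProduct_comm]

theorem dot_star_self_nonneg (w : CSpace n) : 0 ≤ (w ⬝ᵥ star w).re := by
  rw [dot_star_self, Complex.ofReal_re]; positivity

theorem dot_star_self_eq_re (w : CSpace n) : w ⬝ᵥ star w = ((w ⬝ᵥ star w).re : ℂ) := by
  rw [dot_star_self, Complex.ofReal_re]

theorem twoRe_add (w w' : CSpace n) : twoRe (w + w') = twoRe w + twoRe w' := by
  apply cx_injective
  simp only [map_add, cx_twoRe, star_add]; abel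

theorem inner_twoRe (w w' : CSpace n) :
    ((⟪twoRe w, twoRe w'⟫_ℝ : ℝ) : ℂ) = (w + star w) ⬝ᵥ (w' + star w') := by
  rw [← cx_dot, cx_twoRe, cx_twoRe]

theorem norm_sq_twoRe_smul {w : CSpace n} (hw : w ⬝ᵥ w = 0) (z : ℂ) :
    ‖twoRe (z • w)‖ ^ 2 = 2 * ‖z‖ ^ 2 * (w ⬝ᵥ star w).re := by
  have h : star w ⬝ᵥ star w = 0 := by rw [← star_dot, hw, star_zero]
  have h' : star w ⬝ᵥ w = w ⬝ᵥ star w := dotProduct_comm _ _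
  have : ((‖twoRe (z • w)‖ ^ 2 : ℝ) : ℂ) = ((2 * ‖z‖ ^ 2 * (w ⬝ᵥ star w).re : ℝ) : ℂ) := by
    rw [← real_inner_self_eq_norm_sq, inner_twoRe]
    push_cast
    rw [← dot_star_self_eq_re, ← Complex.mul_conj' z]
    simp only [star_smul, add_dotProduct, dotProduct_add, smul_dotProduct, dotProduct_smul,
      smul_eq_mul, hw, h, h', RCLike.star_def]
    ring
  exact_mod_cast this

/-- A linear combination of `w` and its conjugate, scaled by `z`, traces out a circle. -/
theorem isCircle_iff {c : Space n} {w : CSpace n} {R : ℝ} (hR : 0 < R) :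
    IsCircle {y | ∃ z : ℂ, ‖z‖ = R ∧ y = c + twoRe (z • w)} ↔ w ⬝ᵥ w = 0 ∧ w ≠ 0 := by
  constructor
  · rintro ⟨c', r, P, hr, hP, hE⟩
    have key : ∀ z : ℂ, ‖z‖ = R → ‖c - c' + twoRe (z • w)‖ = r := by
      intro z hz
      have : c + twoRe (z • w) ∈ {y | y - c' ∈ P ∧ ‖y - c'‖ = r} := by
        rw [← hE]; exact ⟨z, hz, rfl⟩
      rw [← this.2]; congr 1; abel
    -- The curve is symmetric about `c`, while the centre `c'` is not known to be `c`. Applying the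
    -- parallelogram identity to `z` and `-z` shows that the distance to `c` is constant as well.
    have neg : ∀ z : ℂ, twoRe ((-z) • w) = - twoRe (z • w) := by
      intro z; ext j; simp [twoRe]; ring
    have sq : ∀ z : ℂ, ‖z‖ = R → ‖twoRe (z • w)‖ ^ 2 = r ^ 2 - ‖c - c'‖ ^ 2 := by
      intro z hz
      have h1 := key z hz
      have h2 := key (-z) (by rwa [norm_neg])
      rw [neg, ← sub_eq_add_neg] at h2
      have h3 := norm_add_sq_real (c - c') (twoRe (z • w))
      have h4 := norm_sub_sq_real (c - c') (twoRe (z • w))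
      rw [h1] at h3; rw [h2] at h4
      linarith
    have expand : ∀ z : ℂ, ((‖twoRe (z • w)‖ ^ 2 : ℝ) : ℂ) =
        z ^ 2 * (w ⬝ᵥ w) + star (z ^ 2 * (w ⬝ᵥ w)) + 2 * (z * star z) * (w ⬝ᵥ star w) := by
      intro z
      rw [← real_inner_self_eq_norm_sq, inner_twoRe]
      simp only [star_smul, add_dotProduct, dotProduct_add, smul_dotProduct, dotProduct_smul,
        smul_eq_mul, star_mul, star_dot, dotProduct_comm (star w) w, star_pow]
      ring
    -- Constant length means that Re(z² w·w) does not depend on `z` on the circle of radius `R`.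
    have hz : ∀ z z' : ℂ, ‖z‖ = R → ‖z'‖ = R → z ^ 2 * (w ⬝ᵥ w) + star (z ^ 2 * (w ⬝ᵥ w)) =
        z' ^ 2 * (w ⬝ᵥ w) + star (z' ^ 2 * (w ⬝ᵥ w)) := by
      intro z z' h h'
      have h1 := expand z
      have h2 := expand z'
      rw [sq z h] at h1; rw [sq z' h'] at h2
      have e1 : z * star z = (R : ℂ) ^ 2 := by rw [RCLike.star_def, Complex.mul_conj', h]
      have e2 : z' * star z' = (R : ℂ) ^ 2 := by rw [RCLike.star_def, Complex.mul_conj', h']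
      rw [e1] at h1; rw [e2] at h2
      linear_combination h2 - h1
    have hRC : (R : ℂ) ≠ 0 := by exact_mod_cast hR.ne'
    have n1 : ‖(R : ℂ)‖ = R := by simp [abs_of_pos hR]
    have n2 : ‖(R : ℂ) * Complex.I‖ = R := by simp [abs_of_pos hR]
    -- Comparing `R` with `R * I` kills the real part of w·w. A unit number with non-real square
    -- then kills the imaginary part; this one is rational.
    set ε : ℂ := ⟨3 / 5, 4 / 5⟩ with hε
    have nε : ‖ε‖ = 1 := by
      rw [Complex.norm_def, Complex.normSq_mk]; norm_num
    have n3 : ‖(R : ℂ) * ε‖ = R := by rw [norm_mul, n1, nε, mul_one]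
    have hq : w ⬝ᵥ w = 0 := by
      have h1 := hz _ _ n1 n2
      have h2 := hz _ _ n1 n3
      generalize w ⬝ᵥ w = q at *
      have hRr : (R : ℝ) ^ 2 ≠ 0 := by positivity
      simp only [← Complex.ofReal_pow, mul_pow, Complex.I_sq] at h1 h2
      have e2 : ε ^ 2 = ⟨-7 / 25, 24 / 25⟩ := by
        apply Complex.ext <;> simp [hε, pow_two] <;> norm_num
      rw [e2] at h2
      generalize R ^ 2 = S at h1 h2 hRr
      have r1 := congrArg Complex.re h1
      have r2 := congrArg Complex.re h2
      simp at r1 r2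
      have a1 : S * q.re = 0 := by linarith
      have a1' : q.re = 0 := by
        rcases mul_eq_zero.1 a1 with h | h
        · exact absurd h hRr
        · exact h
      rw [a1'] at r2
      have a2 : S * q.im = 0 := by linarith
      have a2' : q.im = 0 := by
        rcases mul_eq_zero.1 a2 with h | h
        · exact absurd h hRr
        · exact h
      exact Complex.ext a1' a2'
    refine ⟨hq, ?_⟩
    -- For `w = 0` the curve is a single point, whereas a circle of positive radius contains two
    -- antipodal points.
    rintro rfl
    have hs : ∀ y, y - c' ∈ P ∧ ‖y - c'‖ = r → y = c := by
      intro y hy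
      have : y ∈ {y | ∃ z : ℂ, ‖z‖ = R ∧ y = c + twoRe (z • (0 : CSpace n))} := by rw [hE]; exact hy
      obtain ⟨z, -, rfl⟩ := this
      ext j; simp [twoRe]
    have : Nontrivial P := Module.nontrivial_of_finrank_pos (R := ℝ) (by omega)
    obtain ⟨v, hv⟩ := exists_ne (0 : P)
    have hv' : ‖(v : Space n)‖ ≠ 0 := by simpa using hv
    set u : Space n := (r / ‖(v : Space n)‖) • (v : Space n) with hu
    have huP : u ∈ P := P.smul_mem _ v.2
    have hun : ‖u‖ = r := by
      rw [hu, norm_smul, Real.norm_of_nonneg (by positivity)]; field_simp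
    have e1 := hs (c' + u) ⟨by simpa using huP, by simpa using hun⟩
    have e2 := hs (c' - u) ⟨by simpa using huP, by simpa using hun⟩
    have : u = 0 := by
      have h := e1.trans e2.symm
      have h2 : (2 : ℝ) • u = 0 := by
        rw [two_smul]
        have : u + u = (c' + u) - (c' - u) := by abel
        rw [this, h, sub_self]
      simpa using h2
    rw [this, norm_zero] at hun
    exact hr.ne hun
  · rintro ⟨hq, hw⟩
    have hpos : 0 < (w ⬝ᵥ star w).re := by
      refine lt_of_le_of_ne (dot_star_self_nonneg w) fun h => hw (dot_star_self_eq_zero.1 ?_)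
      rw [dot_star_self_eq_re, ← h, Complex.ofReal_zero]
    -- For isotropic nonzero `w` this map multiplies lengths by a fixed positive factor, so its
    -- range is the plane of the circle.
    let T : ℂ →ₗ[ℝ] Space n :=
      { toFun := fun z => twoRe (z • w)
        map_add' := fun z z' => by rw [add_smul, twoRe_add]
        map_smul' := fun s z => by ext j; simp [twoRe]; ring }
    have hT : ∀ z, ‖T z‖ ^ 2 = 2 * ‖z‖ ^ 2 * (w ⬝ᵥ star w).re := fun z => norm_sq_twoRe_smul hq z
    have hinj : Function.Injective T := by
      rw [injective_iff_map_eq_zero]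
      intro z hz
      have := hT z
      rw [hz, norm_zero] at this
      have : ‖z‖ ^ 2 = 0 := by
        by_contra h
        have : 0 < ‖z‖ ^ 2 := lt_of_le_of_ne (by positivity) (Ne.symm h)
        have : 0 < 2 * ‖z‖ ^ 2 * (w ⬝ᵥ star w).re := by positivity
        linarith
      simpa using this
    refine ⟨c, R * √(2 * (w ⬝ᵥ star w).re), LinearMap.range T, by positivity, ?_, ?_⟩
    · rw [LinearMap.finrank_range_of_inj hinj, Complex.finrank_real_complex]
    · have hn : ∀ z, ‖T z‖ = ‖z‖ * √(2 * (w ⬝ᵥ star w).re) := by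
        intro z
        rw [← sq_eq_sq₀ (by positivity) (by positivity), hT, mul_pow, Real.sq_sqrt (by positivity)]
        ring
      ext y
      constructor
      · rintro ⟨z, hz, rfl⟩
        refine ⟨⟨z, by simp [T]⟩, ?_⟩
        rw [add_sub_cancel_left, ← hz]; exact hn z
      · rintro ⟨⟨z, hz⟩, hy⟩
        refine ⟨z, ?_, ?_⟩
        · rw [← hz, hn] at hy
          exact mul_right_cancel₀ (by positivity) hy
        · have : twoRe (z • w) = y - c := hz
          rw [this]; abel

theorem exists_pow_eq_norm {k : ℕ} (hk : k ≠ 0) {R : ℝ} (hR : 0 ≤ R) {z : ℂ} (hz : ‖z‖ = R ^ k) :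
    ∃ y : ℂ, ‖y‖ = R ∧ y ^ k = z := by
  obtain ⟨y, hy⟩ := IsAlgClosed.exists_pow_nat_eq z (Nat.pos_of_ne_zero hk)
  refine ⟨y, ?_, hy⟩
  rw [← hy, norm_pow] at hz
  exact (pow_left_inj₀ (norm_nonneg _) hR hk).1 hz

/-- A curve `c + 2 Re (z ^ k w)`, with `z` on a circle about `0`, is a circle if and only if `w` is
isotropic and nonzero. -/
theorem isCircle_pow_iff {k : ℕ} (hk : k ≠ 0) {c : Space n} {w : CSpace n} {R : ℝ} (hR : 0 < R) :
    IsCircle {y | ∃ z : ℂ, ‖z‖ = R ∧ y = c + twoRe (z ^ k • w)} ↔ w ⬝ᵥ w = 0 ∧ w ≠ 0 := by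
  rw [← isCircle_iff (c := c) (pow_pos hR k)]
  suffices h : {y | ∃ z : ℂ, ‖z‖ = R ∧ y = c + twoRe (z ^ k • w)} =
      {y | ∃ z : ℂ, ‖z‖ = R ^ k ∧ y = c + twoRe (z • w)} by rw [h]
  ext y
  constructor
  · rintro ⟨z, hz, rfl⟩
    exact ⟨z ^ k, by rw [norm_pow, hz], rfl⟩
  · rintro ⟨z, hz, rfl⟩
    obtain ⟨y, hy, rfl⟩ := exists_pow_eq_norm hk hR.le hz
    exact ⟨y, hy, rfl⟩

end Complexification

/-! ### Surfaces in isothermal coordinates -/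

section Isothermal

variable {n : ℕ}

/-- The complexification of a parametrization. -/
def cxF (F : Plane → Space n) (x : Plane) : CSpace n := cx (F x)

/-- `F` is an immersion on the open set `D`, with isothermal coordinates. -/
structure IsothermalOn (F : Plane → Space n) (D : Set Plane) : Prop where
  isOpen : IsOpen D
  smooth : ContDiffOn ℝ ∞ F D
  injective : ∀ x ∈ D, Function.Injective (fderiv ℝ F x)
  isothermal : ∀ x ∈ D, IsIsothermalAt F x

theorem contDiffOn_cxF {F : Plane → Space n} {D : Set Plane} (h : ContDiffOn ℝ ∞ F D) :
    ContDiffOn ℝ ∞ (cxF F) D := cx.contDiff.comp_contDiffOn h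

theorem fderiv_cxF {F : Plane → Space n} {x : Plane} (h : DifferentiableAt ℝ F x) (v : Plane) :
    fderiv ℝ (cxF F) x v = cx (fderiv ℝ F x v) := by
  have : HasFDerivAt (cxF F) (cx.comp (fderiv ℝ F x)) x := cx.hasFDerivAt.comp x h.hasFDerivAt
  rw [this.fderiv]; rfl

theorem hasWirt_cxF {F : Plane → Space n} {x : Plane} (h : DifferentiableAt ℝ F x) :
    HasWirt (cxF F) (dz (cxF F) x) (star (dz (cxF F) x)) x := by
  have h1 : DifferentiableAt ℝ (cxF F) x := cx.differentiableAt.comp x h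
  refine (hasWirt_of_differentiableAt h1).congr_right ?_
  rw [dz, dzbar, star_smul, star_sub, star_smul, fderiv_cxF h, fderiv_cxF h, star_cx, star_cx]
  simp

theorem cx_fderiv {F : Plane → Space n} {x : Plane} (h : DifferentiableAt ℝ F x) (v : Plane) :
    cx (fderiv ℝ F x v) =
      zeta v • dz (cxF F) x + star (zeta v • dz (cxF F) x) := by
  rw [← fderiv_cxF h, (hasWirt_cxF h).fderiv, wirt_apply, star_smul]; rfl

theorem fderiv_eq_twoRe {F : Plane → Space n} {x : Plane} (h : DifferentiableAt ℝ F x) (v : Plane) :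
    fderiv ℝ F x v = twoRe (zeta v • dz (cxF F) x) := by
  apply cx_injective
  rw [cx_fderiv h, cx_twoRe]

theorem dz_cxF_eq {F : Plane → Space n} {x : Plane} (h : DifferentiableAt ℝ F x) :
    dz (cxF F) x = (1 / 2 : ℂ) • (cx (fderiv ℝ F x e₁) - Complex.I • cx (fderiv ℝ F x e₂)) := by
  rw [dz, fderiv_cxF h, fderiv_cxF h]

theorem isIsothermalAt_iff {F : Plane → Space n} {x : Plane} (h : DifferentiableAt ℝ F x) :
    IsIsothermalAt F x ↔ dz (cxF F) x ⬝ᵥ dz (cxF F) x = 0 := by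
  have key : dz (cxF F) x ⬝ᵥ dz (cxF F) x =
      ((1 / 4 * (‖fderiv ℝ F x e₁‖ ^ 2 - ‖fderiv ℝ F x e₂‖ ^ 2) : ℝ) : ℂ) +
        ((-1 / 2 * ⟪fderiv ℝ F x e₁, fderiv ℝ F x e₂⟫_ℝ : ℝ) : ℂ) * Complex.I := by
    rw [dz_cxF_eq h]
    simp only [smul_dotProduct, dotProduct_smul, sub_dotProduct, dotProduct_sub, cx_dot,
      real_inner_self_eq_norm_sq, smul_eq_mul, real_inner_comm (fderiv ℝ F x e₁) (fderiv ℝ F x e₂)]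
    push_cast
    linear_combination (1 / 4 * ((‖fderiv ℝ F x e₂‖ : ℂ) ^ 2)) * Complex.I_sq
  rw [key, Complex.ext_iff]
  have : ‖fderiv ℝ F x e₁‖ = ‖fderiv ℝ F x e₂‖ ↔
      ‖fderiv ℝ F x e₁‖ ^ 2 - ‖fderiv ℝ F x e₂‖ ^ 2 = 0 := by
    rw [sub_eq_zero, sq_eq_sq₀ (norm_nonneg _) (norm_nonneg _)]
  rw [IsIsothermalAt, this]
  simp [-Complex.ofReal_mul, -Complex.ofReal_sub, -Complex.ofReal_pow, -Complex.ofReal_div]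

theorem zeta_injective : Function.Injective zeta := by
  intro v w h
  have h1 := congrArg Complex.re h
  have h2 := congrArg Complex.im h
  ext i; fin_cases i
  · exact h1
  · exact h2

theorem zeta_surjective : Function.Surjective zeta := fun z =>
  ⟨!₂[z.re, z.im], by apply Complex.ext <;> simp [zeta]⟩

theorem zeta_smul (r : ℝ) (v : Plane) : zeta (r • v) = r * zeta v := by
  apply Complex.ext <;> simp [zeta]

/-- The component of a complex vector normal to `φ` and its conjugate, where `φ` is isotropic. -/
def nproj (φ w : CSpace n) : CSpace n :=
  w - (w ⬝ᵥ star φ / φ ⬝ᵥ star φ) • φ - (w ⬝ᵥ φ / φ ⬝ᵥ star φ) • star φ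

theorem nproj_add (φ w w' : CSpace n) : nproj φ (w + w') = nproj φ w + nproj φ w' := by
  simp only [nproj, add_dotProduct, add_div, add_smul]; abel

theorem nproj_smul (φ : CSpace n) (c : ℂ) (w : CSpace n) : nproj φ (c • w) = c • nproj φ w := by
  simp only [nproj, smul_dotProduct, smul_eq_mul, mul_div_assoc, smul_sub, smul_smul]

theorem nproj_star (φ w : CSpace n) : nproj φ (star w) = star (nproj φ w) := by
  simp only [nproj, star_sub, star_smul, star_div₀, star_dot, star_star]
  rw [dotProduct_comm (star φ) φ]; abel

theorem nproj_self {φ : CSpace n} (h : φ ⬝ᵥ φ = 0) (h' : φ ≠ 0) : nproj φ φ = 0 := by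
  rw [nproj, h, div_self (fun e => h' (dot_star_self_eq_zero.1 e))]; simp

theorem nproj_star_self {φ : CSpace n} (h : φ ⬝ᵥ φ = 0) (h' : φ ≠ 0) : nproj φ (star φ) = 0 := by
  rw [nproj_star, nproj_self h h', star_zero]

namespace IsothermalOn

variable {F : Plane → Space n} {D : Set Plane} {x : Plane}

theorem differentiableAt (H : IsothermalOn F D) (hx : x ∈ D) : DifferentiableAt ℝ F x :=
  (H.smooth.contDiffAt (H.isOpen.mem_nhds hx)).differentiableAt (by simp)

theorem mem_nhds (H : IsothermalOn F D) (hx : x ∈ D) : D ∈ 𝓝 x := H.isOpen.mem_nhds hx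

theorem mono (H : IsothermalOn F D) {D' : Set Plane} (hD' : IsOpen D') (h : D' ⊆ D) :
    IsothermalOn F D' :=
  ⟨hD', H.smooth.mono h, fun x hx => H.injective x (h hx), fun x hx => H.isothermal x (h hx)⟩

theorem dot_self (H : IsothermalOn F D) (hx : x ∈ D) : dz (cxF F) x ⬝ᵥ dz (cxF F) x = 0 :=
  (isIsothermalAt_iff (H.differentiableAt hx)).1 (H.isothermal x hx)

theorem star_dot_star (H : IsothermalOn F D) (hx : x ∈ D) :
    star (dz (cxF F) x) ⬝ᵥ star (dz (cxF F) x) = 0 := by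
  rw [← star_dot, H.dot_self hx, star_zero]

theorem dz_ne_zero (H : IsothermalOn F D) (hx : x ∈ D) : dz (cxF F) x ≠ 0 := by
  intro h
  have := fderiv_eq_twoRe (H.differentiableAt hx) e₁
  rw [h] at this
  have h0 : fderiv ℝ F x e₁ = fderiv ℝ F x 0 := by
    rw [this, map_zero]; ext j; simp [twoRe]
  have := congrArg (fun v : Plane => v 0) (H.injective x hx h0)
  simp [e₁] at this

theorem dot_star_ne_zero (H : IsothermalOn F D) (hx : x ∈ D) :
    dz (cxF F) x ⬝ᵥ star (dz (cxF F) x) ≠ 0 :=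
  fun h => H.dz_ne_zero hx (dot_star_self_eq_zero.1 h)

theorem smooth_dz (H : IsothermalOn F D) : ContDiffOn ℝ ∞ (dz (cxF F)) D :=
  contDiffOn_dz H.isOpen (contDiffOn_cxF H.smooth)

theorem hasWirt (H : IsothermalOn F D) (hx : x ∈ D) :
    HasWirt (cxF F) (dz (cxF F) x) (star (dz (cxF F) x)) x := hasWirt_cxF (H.differentiableAt hx)

theorem hasWirt_dz (H : IsothermalOn F D) (hx : x ∈ D) :
    HasWirt (dz (cxF F)) (dz (dz (cxF F)) x) (dzbar (dz (cxF F)) x) x :=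
  hasWirt_of_contDiffOn H.isOpen H.smooth_dz hx

/-- ∂̄∂F is a quarter of the Laplacian of the real map F; the proof combines ∂̄∂ = ∂∂̄ with
conjugation. -/
theorem star_dzbar_dz (H : IsothermalOn F D) (hx : x ∈ D) :
    star (dzbar (dz (cxF F)) x) = dzbar (dz (cxF F)) x := by
  rw [← dz_dzbar_comm H.isOpen (contDiffOn_cxF H.smooth) hx]
  have h1 := (H.hasWirt_dz hx).vstar
  have h2 : HasWirt (dzbar (cxF F)) _ _ x := h1.congr_of_eventuallyEq
    (Filter.eventuallyEq_of_mem (H.mem_nhds hx) fun y hy => (H.hasWirt hy).dzbar_eq)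
  have h3 := h2.dz_eq
  rw [dz_dzbar_comm H.isOpen (contDiffOn_cxF H.smooth) hx] at h3
  rw [h2.dz_eq, star_star]
  exact h3

theorem dot_self_deriv (H : IsothermalOn F D) (hx : x ∈ D) :
    dz (dz (cxF F)) x ⬝ᵥ dz (cxF F) x = 0 ∧ dzbar (dz (cxF F)) x ⬝ᵥ dz (cxF F) x = 0 := by
  have h1 := (H.hasWirt_dz hx).dot (H.hasWirt_dz hx)
  have h2 := (HasWirt.const (0 : ℂ) (x := x)).congr_of_eventuallyEq
    (Filter.eventuallyEq_of_mem (H.mem_nhds hx) fun y hy => H.dot_self hy)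
  have e1 := h1.unique_left h2
  have e2 := h1.unique_right h2
  rw [dotProduct_comm (dz (cxF F) x)] at e1 e2
  constructor
  · linear_combination e1 / 2
  · linear_combination e2 / 2

theorem dzbar_dz_dot_star (H : IsothermalOn F D) (hx : x ∈ D) :
    dzbar (dz (cxF F)) x ⬝ᵥ star (dz (cxF F) x) = 0 := by
  rw [← H.star_dzbar_dz hx, ← star_dot, (H.dot_self_deriv hx).2, star_zero]

theorem nproj_dzbar_dz (H : IsothermalOn F D) (hx : x ∈ D) :
    nproj (dz (cxF F) x) (dzbar (dz (cxF F)) x) = dzbar (dz (cxF F)) x := by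
  rw [nproj, H.dzbar_dz_dot_star hx, (H.dot_self_deriv hx).2]; simp

end IsothermalOn

theorem dot_star_comm (u v : CSpace n) : u ⬝ᵥ star v = star (v ⬝ᵥ star u) := by
  rw [star_dot, star_star, dotProduct_comm]

/-- Since ∂F is isotropic, ∂F and its conjugate form a Hermitian-orthogonal basis of the
complexified tangent plane, and the real orthogonal projection becomes the explicit formula `nproj`.
-/
theorem cx_normalPart {F : Plane → Space n} {x : Plane} (h : DifferentiableAt ℝ F x)
    (hi : dz (cxF F) x ⬝ᵥ dz (cxF F) x = 0) (h0 : dz (cxF F) x ≠ 0) (u : Space n) :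
    cx (normalPart F x u) = nproj (dz (cxF F) x) (cx u) := by
  set φ := dz (cxF F) x with hφ
  have hρ : φ ⬝ᵥ star φ ≠ 0 := fun e => h0 (dot_star_self_eq_zero.1 e)
  -- The coefficients of ∂F and its conjugate are conjugate to each other for real `u`, so the
  -- tangential part is dF(v) for a real `v`.
  obtain ⟨v, hv⟩ := zeta_surjective (cx u ⬝ᵥ star φ / φ ⬝ᵥ star φ)
  have hsub : cx (u - fderiv ℝ F x v) = nproj φ (cx u) := by
    have es : star (cx u ⬝ᵥ star φ) = cx u ⬝ᵥ φ := by rw [star_dot, star_star, star_cx]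
    rw [map_sub, cx_fderiv h, ← hφ, hv, nproj, star_smul, star_div₀, star_dot_star_self, es]
    abel
  have hmem : u - fderiv ℝ F x v ∈ (tangentPlane F x)ᗮ := by
    rw [Submodule.mem_orthogonal]
    rintro _ ⟨w, rfl⟩
    have hi' : star φ ⬝ᵥ star φ = 0 := by rw [← star_dot, hi, star_zero]
    have : ((⟪fderiv ℝ F x w, u - fderiv ℝ F x v⟫_ℝ : ℝ) : ℂ) = 0 := by
      rw [← cx_dot, hsub, cx_fderiv h, ← hφ, nproj]
      simp only [add_dotProduct, star_smul, smul_dotProduct, dotProduct_sub, dotProduct_smul, hi,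
        hi', smul_eq_mul, dotProduct_comm φ (cx u), dotProduct_comm (star φ) (cx u),
        dotProduct_comm (star φ) φ]
      field_simp
      ring
    exact_mod_cast this
  have : normalPart F x u = u - fderiv ℝ F x v := by
    rw [normalPart]
    refine Submodule.eq_starProjection_of_mem_orthogonal hmem ?_
    rw [sub_sub_cancel]
    exact Submodule.le_orthogonal_orthogonal _ ⟨v, rfl⟩
  rw [this, hsub]

/-- The complexified Hopf differential `α(∂, ∂)`. -/
def hopf (F : Plane → Space n) (x : Plane) : CSpace n :=
  nproj (dz (cxF F) x) (dz (dz (cxF F)) x)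

/-- The coefficient of the tangential part of `∂∂F`. -/
def coef (F : Plane → Space n) (x : Plane) : ℂ :=
  (dz (dz (cxF F)) x ⬝ᵥ star (dz (cxF F) x)) / (dz (cxF F) x ⬝ᵥ star (dz (cxF F) x))

/-- The length of `zeta v` for the unit tangent vectors `v`. -/
def unitRadius (F : Plane → Space n) (x : Plane) : ℝ :=
  √(1 / (2 * (dz (cxF F) x ⬝ᵥ star (dz (cxF F) x)).re))

namespace IsothermalOn

variable {F : Plane → Space n} {D : Set Plane} {x : Plane}

theorem cx_normalPart (H : IsothermalOn F D) (hx : x ∈ D) (u : Space n) :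
    cx (normalPart F x u) = nproj (dz (cxF F) x) (cx u) :=
  PedalSurface.cx_normalPart (H.differentiableAt hx) (H.dot_self hx) (H.dz_ne_zero hx) u

theorem cx_secondFF (H : IsothermalOn F D) (hx : x ∈ D) (v w : Plane) :
    cx (secondFF F v w x) = (zeta v * zeta w) • hopf F x + star ((zeta v * zeta w) • hopf F x) +
      (conj (zeta v) * zeta w + zeta v * conj (zeta w)) • dzbar (dz (cxF F)) x := by
  have hd : DifferentiableAt ℝ (fun y => fderiv ℝ F y w) x :=
    ((contDiffOn_fderiv_apply H.isOpen H.smooth w).contDiffAt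
      (H.isOpen.mem_nhds hx)).differentiableAt (by simp)
  have h1 : cx (fderiv ℝ (fun y => fderiv ℝ F y w) x v) =
      fderiv ℝ (cxF (fun y => fderiv ℝ F y w)) x v := (fderiv_cxF hd v).symm
  have h2 := ((H.hasWirt_dz hx).const_smul (zeta w)).add
    ((H.hasWirt_dz hx).vstar.const_smul (conj (zeta w)))
  have h3 : HasWirt (cxF (fun y => fderiv ℝ F y w)) _ _ x := h2.congr_of_eventuallyEq
    (Filter.eventuallyEq_of_mem (H.mem_nhds hx) fun y hy => by
      rw [cxF, cx_fderiv (H.differentiableAt hy), star_smul]; rfl)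
  rw [secondFF, H.cx_normalPart hx, h1, h3.fderiv, wirt_apply]
  simp only [nproj_add, nproj_smul, nproj_star, H.nproj_dzbar_dz hx, hopf, H.star_dzbar_dz hx,
    star_smul, star_mul, RCLike.star_def]
  module

theorem star_hopf_add (H : IsothermalOn F D) (hx : x ∈ D) :
    cx (hopfRe F x) = (1 / 2 : ℂ) • (hopf F x + star (hopf F x)) ∧
    cx (hopfIm F x) = (-Complex.I / 2 : ℂ) • (hopf F x - star (hopf F x)) := by
  constructor
  · rw [hopfRe, cx_smul, map_sub, H.cx_secondFF hx, H.cx_secondFF hx]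
    simp only [zeta_e₁, zeta_e₂, map_one, Complex.conj_I, Complex.I_mul_I, neg_mul, mul_neg, star_smul,
      star_neg, star_one, mul_one]
    push_cast
    module
  · rw [hopfIm, map_neg, cx_smul, H.cx_secondFF hx]
    simp only [zeta_e₁, zeta_e₂, map_one, Complex.conj_I, one_mul, star_smul, RCLike.star_def]
    push_cast
    module

theorem complexVector_hopf (H : IsothermalOn F D) (hx : x ∈ D) :
    complexVector (hopfRe F x) (hopfIm F x) = hopf F x := by
  rw [complexVector_eq, (H.star_hopf_add hx).1, (H.star_hopf_add hx).2, smul_smul]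
  have : Complex.I * (-Complex.I / 2) = 1 / 2 := by linear_combination (-1 / 2) * Complex.I_sq
  rw [this]; module

theorem dot_hopf (H : IsothermalOn F D) (hx : x ∈ D) :
    hopf F x = dz (dz (cxF F)) x - ((dz (dz (cxF F)) x ⬝ᵥ star (dz (cxF F) x)) /
      (dz (cxF F) x ⬝ᵥ star (dz (cxF F) x))) • dz (cxF F) x := by
  rw [hopf, nproj, (H.dot_self_deriv hx).1]; simp

theorem hopf_dot (H : IsothermalOn F D) (hx : x ∈ D) : hopf F x ⬝ᵥ dz (cxF F) x = 0 := by
  rw [H.dot_hopf hx, sub_dotProduct, smul_dotProduct, H.dot_self hx, (H.dot_self_deriv hx).1]; simp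

theorem hopf_dot_star (H : IsothermalOn F D) (hx : x ∈ D) :
    hopf F x ⬝ᵥ star (dz (cxF F) x) = 0 := by
  rw [H.dot_hopf hx, sub_dotProduct, smul_dotProduct, smul_eq_mul,
    div_mul_cancel₀ _ (H.dot_star_ne_zero hx), sub_self]

/-- The two vectors differ by a multiple of ∂F, which is isotropic and orthogonal to ∂∂F. This lets
isotropy of the Hopf differential be tested without projecting. -/
theorem hopf_dot_hopf (H : IsothermalOn F D) (hx : x ∈ D) :
    hopf F x ⬝ᵥ hopf F x = dz (dz (cxF F)) x ⬝ᵥ dz (dz (cxF F)) x := by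
  have h := (H.dot_self_deriv hx).1
  rw [H.dot_hopf hx]
  simp only [sub_dotProduct, dotProduct_sub, smul_dotProduct, dotProduct_smul, H.dot_self hx, h,
    dotProduct_comm (dz (cxF F) x) (dz (dz (cxF F)) x)]
  simp

theorem smooth_dz_dz (H : IsothermalOn F D) : ContDiffOn ℝ ∞ (dz (dz (cxF F))) D :=
  contDiffOn_dz H.isOpen H.smooth_dz

theorem hasWirt_coef (H : IsothermalOn F D) (hx : x ∈ D) :
    HasWirt (coef F) (dz (coef F) x) (dzbar (coef F) x) x := by
  have := ((hasWirt_of_contDiffOn H.isOpen H.smooth_dz_dz hx).dot (H.hasWirt_dz hx).vstar).div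
    ((H.hasWirt_dz hx).dot (H.hasWirt_dz hx).vstar) (H.dot_star_ne_zero hx)
  exact hasWirt_of_differentiableAt this.differentiableAt

theorem hasWirt_hopf (H : IsothermalOn F D) (hx : x ∈ D) :
    HasWirt (hopf F) (dz (hopf F) x) (dzbar (dz (dz (cxF F))) x -
      coef F x • dzbar (dz (cxF F)) x - dzbar (coef F) x • dz (cxF F) x) x := by
  have := (hasWirt_of_contDiffOn H.isOpen H.smooth_dz_dz hx).sub
    ((H.hasWirt_coef hx).smul (H.hasWirt_dz hx))
  have h2 : HasWirt (hopf F) _ _ x := this.congr_of_eventuallyEq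
    (Filter.eventuallyEq_of_mem (H.mem_nhds hx) fun y hy => H.dot_hopf hy)
  refine (h2.congr_left h2.dz_eq.symm).congr_right ?_
  abel

theorem complexVector_dbarHopf (H : IsothermalOn F D) (hx : x ∈ D) :
    complexVector (dbarHopfRe F x) (dbarHopfIm F x) =
      nproj (dz (cxF F) x) (dzbar (hopf F) x) := by
  have hQ := hasWirt_of_differentiableAt (H.hasWirt_hopf hx).differentiableAt
  set A := dz (hopf F) x
  set B := dzbar (hopf F) x
  have h1 : HasWirt (cxF (hopfRe F)) _ _ x := ((hQ.add hQ.vstar).const_smul (1 / 2 : ℂ)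
    ).congr_of_eventuallyEq (Filter.eventuallyEq_of_mem (H.mem_nhds hx) fun y hy =>
      (H.star_hopf_add hy).1)
  have h2 : HasWirt (cxF (hopfIm F)) _ _ x := ((hQ.sub hQ.vstar).const_smul (-Complex.I / 2 : ℂ)
    ).congr_of_eventuallyEq (Filter.eventuallyEq_of_mem (H.mem_nhds hx) fun y hy =>
      (H.star_hopf_add hy).2)
  have d {f : Plane → Space n} {a b} (h : HasWirt (cxF f) a b x) : DifferentiableAt ℝ f x := by
    have e : f = fun y => WithLp.toLp 2 fun j => (cxF f y j).re := by ext y j; simp [cxF]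
    rw [e]
    have := h.differentiableAt
    have : DifferentiableAt ℝ (fun y => fun j => (cxF f y j).re) x := by
      rw [differentiableAt_pi] at this ⊢
      exact fun j => Complex.reCLM.differentiableAt.comp x (this j)
    exact ((PiLp.continuousLinearEquiv 2 ℝ fun _ : Fin n => ℝ).symm.differentiableAt).comp x this
  have c {f : Plane → Space n} {a b} (h : HasWirt (cxF f) a b x) (v : Plane) :
      cx (normalDeriv F v f x) = zeta v • nproj (dz (cxF F) x) a +
        conj (zeta v) • nproj (dz (cxF F) x) b := by
    rw [normalDeriv, H.cx_normalPart hx, ← fderiv_cxF (d h), h.fderiv, wirt_apply, nproj_add,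
      nproj_smul, nproj_smul]
  rw [complexVector_eq, dbarHopfRe, dbarHopfIm, cx_smul, cx_smul, map_sub, map_add, c h1, c h2, c h1,
    c h2]
  simp only [zeta_e₁, zeta_e₂, map_one, Complex.conj_I, sub_eq_add_neg, ← neg_one_smul ℂ (star _),
    nproj_smul, nproj_add]
  push_cast
  match_scalars <;> ring_nf <;> simp <;> norm_num

theorem dzbar_dz_eq_zero (H : IsothermalOn F D) (hx : x ∈ D) (hm : MeanCurvatureVanishes F x) :
    dzbar (dz (cxF F)) x = 0 := by
  obtain ⟨hn, ho⟩ := H.isothermal x hx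
  have h0 : ‖fderiv ℝ F x e₁‖ ≠ 0 := by
    rw [norm_ne_zero_iff]
    intro h
    have := congrArg (fun v : Plane => v 0) (H.injective x hx (h.trans (map_zero _).symm))
    simp [e₁] at this
  -- In isothermal coordinates the rescaled coordinate vectors are orthonormal. In the sum of their
  -- second fundamental forms the Hopf terms cancel, leaving a multiple of ∂̄∂F.
  set r := ‖fderiv ℝ F x e₁‖⁻¹ with hr
  have hr0 : r ≠ 0 := inv_ne_zero h0
  have nr : ‖r‖ = r := by rw [hr]; simp
  have := hm (r • e₁) (r • e₂) (by rw [map_smul, norm_smul, nr, hr, inv_mul_cancel₀ h0])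
    (by rw [map_smul, norm_smul, nr, ← hn, hr, inv_mul_cancel₀ h0])
    (by rw [map_smul, map_smul, inner_smul_left, inner_smul_right, ho]; simp)
  have h2 := congrArg cx this
  rw [map_add, map_zero, H.cx_secondFF hx, H.cx_secondFF hx] at h2
  simp only [zeta_smul, zeta_e₁, zeta_e₂, mul_one, map_mul, Complex.conj_ofReal, Complex.conj_I] at h2
  have e : ((r : ℂ) * Complex.I * (r * Complex.I)) = -(r * r) := by
    linear_combination (r : ℂ) ^ 2 * Complex.I_sq
  have e' : (r : ℂ) * -Complex.I * (r * Complex.I) + r * Complex.I * (r * -Complex.I) = 2 * (r * r) := by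
    linear_combination -2 * (r : ℂ) ^ 2 * Complex.I_sq
  rw [e, e', neg_smul, star_neg] at h2
  have h3 : (4 * (r * r) : ℂ) • dzbar (dz (cxF F)) x = 0 := by
    rw [← h2]; module
  refine (smul_eq_zero.1 h3).resolve_left ?_
  have : (r : ℂ) ≠ 0 := by exact_mod_cast hr0
  simp [this]

theorem norm_fderiv (H : IsothermalOn F D) (hx : x ∈ D) (v : Plane) :
    ‖fderiv ℝ F x v‖ ^ 2 = 2 * ‖zeta v‖ ^ 2 * (dz (cxF F) x ⬝ᵥ star (dz (cxF F) x)).re := by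
  rw [fderiv_eq_twoRe (H.differentiableAt hx), norm_sq_twoRe_smul (H.dot_self hx)]

theorem re_dot_star_pos (H : IsothermalOn F D) (hx : x ∈ D) :
    0 < (dz (cxF F) x ⬝ᵥ star (dz (cxF F) x)).re := by
  refine lt_of_le_of_ne (dot_star_self_nonneg _) fun h => H.dot_star_ne_zero hx ?_
  rw [dot_star_self_eq_re, ← h, Complex.ofReal_zero]

theorem unitRadius_pos (H : IsothermalOn F D) (hx : x ∈ D) : 0 < unitRadius F x := by
  have := H.re_dot_star_pos hx
  exact Real.sqrt_pos.2 (by positivity)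

theorem norm_fderiv_eq_one (H : IsothermalOn F D) (hx : x ∈ D) (v : Plane) :
    ‖fderiv ℝ F x v‖ = 1 ↔ ‖zeta v‖ = unitRadius F x := by
  have hp := H.re_dot_star_pos hx
  have h := H.norm_fderiv hx v
  have h1 : ‖fderiv ℝ F x v‖ = 1 ↔ ‖fderiv ℝ F x v‖ ^ 2 = 1 := by
    rw [← sq_eq_sq₀ (norm_nonneg _) zero_le_one, one_pow]
  rw [h1, h, unitRadius, ← sq_eq_sq₀ (norm_nonneg _) (Real.sqrt_nonneg _),
    Real.sq_sqrt (by positivity), eq_div_iff (by positivity)]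
  constructor <;> intro h <;> linarith

end IsothermalOn

end Isothermal

/-! ### Minimal surfaces with circular first ellipse of curvature, and their pedal surfaces -/

section Isotropic

variable {n : ℕ}

/-- `|∂F|²`. -/
def confFactor (F : Plane → Space n) (x : Plane) : ℂ := dz (cxF F) x ⬝ᵥ star (dz (cxF F) x)

/-- `|α(∂, ∂)|²`. -/
def hopfNormSq (F : Plane → Space n) (x : Plane) : ℂ := hopf F x ⬝ᵥ star (hopf F x)

/-- The coefficient of `α(∂, ∂)` in its normal derivative. -/
def hopfCoef (F : Plane → Space n) (x : Plane) : ℂ :=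
  (dz (hopf F) x ⬝ᵥ star (hopf F x)) / hopfNormSq F x

/-- The third fundamental form `α³(∂, ∂, ∂)`. -/
def cubic (F : Plane → Space n) (x : Plane) : CSpace n := dz (hopf F) x - hopfCoef F x • hopf F x

/-- `F` is a minimal surface in isothermal coordinates on `D`, and its first ellipse of curvature is
a nondegenerate circle. -/
structure IsotropicOn (F : Plane → Space n) (D : Set Plane) : Prop extends IsothermalOn F D where
  harmonic : ∀ x ∈ D, dzbar (dz (cxF F)) x = 0
  hopf_isotropic : ∀ x ∈ D, hopf F x ⬝ᵥ hopf F x = 0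
  hopf_ne_zero : ∀ x ∈ D, hopf F x ≠ 0

namespace IsotropicOn

variable {F : Plane → Space n} {D : Set Plane} {x : Plane}

theorem confFactor_ne_zero (H : IsotropicOn F D) (hx : x ∈ D) : confFactor F x ≠ 0 :=
  H.dot_star_ne_zero hx

theorem hopfNormSq_ne_zero (H : IsotropicOn F D) (hx : x ∈ D) : hopfNormSq F x ≠ 0 :=
  fun h => H.hopf_ne_zero x hx (dot_star_self_eq_zero.1 h)

theorem smooth_hopf (H : IsotropicOn F D) : ContDiffOn ℝ ∞ (hopf F) D := by
  have hs : ∀ {h : Plane → CSpace n}, ContDiffOn ℝ ∞ h D → ContDiffOn ℝ ∞ (fun y => star (h y)) D := by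
    intro h hh
    rw [contDiffOn_pi] at hh ⊢
    exact fun j => Complex.conjCLE.contDiff.comp_contDiffOn (hh j)
  have hdot : ∀ {h k : Plane → CSpace n}, ContDiffOn ℝ ∞ h D → ContDiffOn ℝ ∞ k D →
      ContDiffOn ℝ ∞ (fun y => h y ⬝ᵥ k y) D := by
    intro h k hh hk
    rw [contDiffOn_pi] at hh hk
    exact ContDiffOn.sum fun j _ => (hh j).mul (hk j)
  have hc : ContDiffOn ℝ ∞ (coef F) D :=
    ((hdot H.smooth_dz_dz (hs H.smooth_dz)).mul ((hdot H.smooth_dz (hs H.smooth_dz)).inv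
      fun y hy => H.dot_star_ne_zero hy)).congr fun y _ => div_eq_mul_inv _ _
  exact (H.smooth_dz_dz.sub (hc.smul H.smooth_dz)).congr fun y hy => H.dot_hopf hy

theorem continuousOn_cubic (H : IsotropicOn F D) : ContinuousOn (cubic F) D := by
  have h1 := (contDiffOn_dz H.isOpen H.smooth_hopf).continuousOn
  have h2 := H.smooth_hopf.continuousOn
  have hdot : ∀ {h k : Plane → CSpace n}, ContinuousOn h D → ContinuousOn k D →
      ContinuousOn (fun y => h y ⬝ᵥ k y) D := by
    intro h k hh hk
    rw [continuousOn_pi] at hh hk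
    exact continuousOn_finsetSum _ fun j _ => (hh j).mul (hk j)
  exact h1.sub (((hdot h1 h2.star).div (hdot h2 h2.star) fun y hy => H.hopfNormSq_ne_zero hy).smul h2)

theorem hasWirt_phi (H : IsotropicOn F D) (hx : x ∈ D) :
    HasWirt (dz (cxF F)) (hopf F x + coef F x • dz (cxF F) x) 0 x := by
  refine ((H.hasWirt_dz hx).congr_left ?_).congr_right (H.harmonic x hx)
  rw [H.dot_hopf hx, coef]; abel

theorem star_hopf_dot (H : IsotropicOn F D) (hx : x ∈ D) :
    dz (cxF F) x ⬝ᵥ star (hopf F x) = 0 := by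
  rw [dot_star_comm, H.hopf_dot_star hx, star_zero]

theorem hasWirt_confFactor (H : IsotropicOn F D) (hx : x ∈ D) :
    HasWirt (confFactor F) (coef F x * confFactor F x) (star (coef F x) * confFactor F x) x := by
  have := (H.hasWirt_phi hx).dot (H.hasWirt_phi hx).vstar
  refine HasWirt.congr_left (HasWirt.congr_right this ?_) ?_
  · rw [zero_dotProduct, zero_add, star_add, dotProduct_add, star_smul, dotProduct_smul,
      H.star_hopf_dot hx, zero_add, smul_eq_mul, confFactor]
  · rw [star_zero, dotProduct_zero, add_zero, add_dotProduct, H.hopf_dot_star hx, zero_add,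
      smul_dotProduct, smul_eq_mul, confFactor]

theorem hasWirt_psi_aux (H : IsotropicOn F D) (hx : x ∈ D) :
    HasWirt (hopf F) (dz (hopf F) x) (dzbar (hopf F) x) x :=
  hasWirt_of_contDiffOn H.isOpen H.smooth_hopf hx

/-- Harmonicity leaves only a multiple of ∂F in ∂̄ψ. Differentiating ψ·φ̄ = 0 with respect to ∂̄
identifies the factor. -/
theorem dzbar_hopf (H : IsotropicOn F D) (hx : x ∈ D) :
    dzbar (hopf F) x = -(hopfNormSq F x / confFactor F x) • dz (cxF F) x := by
  have h1 := (H.hasWirt_hopf hx).dzbar_eq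
  have hz : dzbar (dz (dz (cxF F))) x = 0 := by
    rw [← dz_dzbar_comm H.isOpen H.smooth_dz hx]
    exact ((HasWirt.const (0 : CSpace n) (x := x)).congr_of_eventuallyEq
      (Filter.eventuallyEq_of_mem (H.mem_nhds hx) fun y hy => H.harmonic y hy)).dz_eq
  rw [H.harmonic x hx, hz, smul_zero, sub_zero, zero_sub, ← neg_smul] at h1
  have h2 := (H.hasWirt_psi_aux hx).dot (H.hasWirt_phi hx).vstar
  have h3 := (HasWirt.const (0 : ℂ) (x := x)).congr_of_eventuallyEq
    (Filter.eventuallyEq_of_mem (H.mem_nhds hx) fun y hy => H.hopf_dot_star hy)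
  have h4 := h2.unique_right h3
  rw [h1, smul_dotProduct, star_add, dotProduct_add, star_smul, dotProduct_smul,
    H.hopf_dot_star hx, smul_zero, add_zero] at h4
  rw [h1]
  congr 1
  have hρ := H.confFactor_ne_zero hx
  rw [smul_eq_mul] at h4
  change _ * confFactor F x + hopfNormSq F x = 0 at h4
  field_simp
  linear_combination h4

theorem hasWirt_psi (H : IsotropicOn F D) (hx : x ∈ D) :
    HasWirt (hopf F) (cubic F x + hopfCoef F x • hopf F x)
      (-(hopfNormSq F x / confFactor F x) • dz (cxF F) x) x := by
  refine ((H.hasWirt_psi_aux hx).congr_left ?_).congr_right (H.dzbar_hopf hx)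
  rw [cubic]; abel

/-- Obtained by applying ∂ to ψ·φ = 0, ψ·φ̄ = 0 and ψ·ψ = 0. Hence subtracting the ψ-component is
enough to make `cubic` orthogonal to φ, ψ and their conjugates. -/
theorem dz_hopf_dot (H : IsotropicOn F D) (hx : x ∈ D) :
    dz (hopf F) x ⬝ᵥ dz (cxF F) x = 0 ∧ dz (hopf F) x ⬝ᵥ star (dz (cxF F) x) = 0 ∧
      dz (hopf F) x ⬝ᵥ hopf F x = 0 := by
  have h0 {g : Plane → ℂ} (h : ∀ y ∈ D, g y = 0) : HasWirt g 0 0 x :=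
    (HasWirt.const (0 : ℂ)).congr_of_eventuallyEq (Filter.eventuallyEq_of_mem (H.mem_nhds hx) h)
  refine ⟨?_, ?_, ?_⟩
  · have := ((H.hasWirt_psi_aux hx).dot (H.hasWirt_phi hx)).unique_left
      (h0 fun y hy => H.hopf_dot hy)
    rwa [dotProduct_add, dotProduct_smul, H.hopf_dot hx, H.hopf_isotropic x hx, smul_zero, add_zero,
      add_zero] at this
  · have := ((H.hasWirt_psi_aux hx).dot (H.hasWirt_phi hx).vstar).unique_left
      (h0 fun y hy => H.hopf_dot_star hy)
    rwa [star_zero, dotProduct_zero, add_zero] at this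
  · have := ((H.hasWirt_psi_aux hx).dot (H.hasWirt_psi_aux hx)).unique_left
      (h0 fun y hy => H.hopf_isotropic y hy)
    rw [dotProduct_comm (hopf F x)] at this
    linear_combination this / 2

theorem cubic_dot (H : IsotropicOn F D) (hx : x ∈ D) : cubic F x ⬝ᵥ dz (cxF F) x = 0 := by
  rw [cubic, sub_dotProduct, smul_dotProduct, (H.dz_hopf_dot hx).1, H.hopf_dot hx]; simp

theorem cubic_dot_star (H : IsotropicOn F D) (hx : x ∈ D) :
    cubic F x ⬝ᵥ star (dz (cxF F) x) = 0 := by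
  rw [cubic, sub_dotProduct, smul_dotProduct, (H.dz_hopf_dot hx).2.1, H.hopf_dot_star hx]; simp

theorem cubic_dot_hopf (H : IsotropicOn F D) (hx : x ∈ D) : cubic F x ⬝ᵥ hopf F x = 0 := by
  rw [cubic, sub_dotProduct, smul_dotProduct, (H.dz_hopf_dot hx).2.2, H.hopf_isotropic x hx]; simp

theorem cubic_dot_star_hopf (H : IsotropicOn F D) (hx : x ∈ D) :
    cubic F x ⬝ᵥ star (hopf F x) = 0 := by
  rw [cubic, sub_dotProduct, smul_dotProduct, hopfCoef, smul_eq_mul]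
  change _ - _ * hopfNormSq F x = 0
  rw [div_mul_cancel₀ _ (H.hopfNormSq_ne_zero hx), sub_self]

theorem hasWirt_hopfNormSq (H : IsotropicOn F D) (hx : x ∈ D) :
    HasWirt (hopfNormSq F) (hopfCoef F x * hopfNormSq F x) (star (hopfCoef F x) * hopfNormSq F x)
      x := by
  have := (H.hasWirt_psi hx).dot (H.hasWirt_psi hx).vstar
  have hc : hopf F x ⬝ᵥ star (cubic F x) = 0 := by
    rw [dot_star_comm, H.cubic_dot_star_hopf hx, star_zero]
  refine HasWirt.congr_left (HasWirt.congr_right this ?_) ?_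
  · rw [star_add, dotProduct_add, smul_dotProduct, H.star_hopf_dot hx, hc, star_smul,
      dotProduct_smul, smul_zero, zero_add, zero_add, smul_eq_mul, hopfNormSq]
  · rw [star_smul, dotProduct_smul, H.hopf_dot_star hx, add_dotProduct, smul_dotProduct,
      H.cubic_dot_star_hopf hx, smul_zero, add_zero, zero_add, smul_eq_mul, hopfNormSq]

/-- All products of the vectors `∂F`, `α(∂, ∂)`, `α³(∂, ∂, ∂)` and their conjugates that are
determined. -/
theorem dot_table (H : IsotropicOn F D) (hx : x ∈ D) :
    let φ := dz (cxF F) x; let ψ := hopf F x; let χ := cubic F x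
    let ρ := confFactor F x; let σ := hopfNormSq F x
    (φ ⬝ᵥ φ = 0 ∧ star φ ⬝ᵥ star φ = 0 ∧ φ ⬝ᵥ star φ = ρ ∧ star φ ⬝ᵥ φ = ρ) ∧
    (ψ ⬝ᵥ ψ = 0 ∧ star ψ ⬝ᵥ star ψ = 0 ∧ ψ ⬝ᵥ star ψ = σ ∧ star ψ ⬝ᵥ ψ = σ) ∧
    (φ ⬝ᵥ ψ = 0 ∧ star φ ⬝ᵥ star ψ = 0 ∧ φ ⬝ᵥ star ψ = 0 ∧ star φ ⬝ᵥ ψ = 0) ∧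
    (ψ ⬝ᵥ φ = 0 ∧ star ψ ⬝ᵥ star φ = 0 ∧ ψ ⬝ᵥ star φ = 0 ∧ star ψ ⬝ᵥ φ = 0) ∧
    (χ ⬝ᵥ φ = 0 ∧ star χ ⬝ᵥ star φ = 0 ∧ χ ⬝ᵥ star φ = 0 ∧ star χ ⬝ᵥ φ = 0) ∧
    (φ ⬝ᵥ χ = 0 ∧ star φ ⬝ᵥ star χ = 0 ∧ φ ⬝ᵥ star χ = 0 ∧ star φ ⬝ᵥ χ = 0) ∧
    (χ ⬝ᵥ ψ = 0 ∧ star χ ⬝ᵥ star ψ = 0 ∧ χ ⬝ᵥ star ψ = 0 ∧ star χ ⬝ᵥ ψ = 0) ∧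
    (ψ ⬝ᵥ χ = 0 ∧ star ψ ⬝ᵥ star χ = 0 ∧ ψ ⬝ᵥ star χ = 0 ∧ star ψ ⬝ᵥ χ = 0) := by
  intro φ ψ χ ρ σ
  have s0 {u v : CSpace n} (h : u ⬝ᵥ v = 0) : u ⬝ᵥ v = 0 ∧ star u ⬝ᵥ star v = 0 ∧
      v ⬝ᵥ u = 0 ∧ star v ⬝ᵥ star u = 0 := by
    refine ⟨h, ?_, ?_, ?_⟩
    · rw [← star_dot, h, star_zero]
    · rw [dotProduct_comm, h]
    · rw [dotProduct_comm, ← star_dot, h, star_zero]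
  have s1 {u v : CSpace n} (h : u ⬝ᵥ star v = 0) : u ⬝ᵥ star v = 0 ∧ star u ⬝ᵥ v = 0 ∧
      star v ⬝ᵥ u = 0 ∧ v ⬝ᵥ star u = 0 := by
    simpa using s0 h
  obtain ⟨a1, a2, -, -⟩ := s0 (H.dot_self hx)
  obtain ⟨b1, b2, -, -⟩ := s0 (H.hopf_isotropic x hx)
  obtain ⟨c1, c2, c3, c4⟩ := s0 (H.hopf_dot hx)
  obtain ⟨d1, d2, d3, d4⟩ := s1 (H.hopf_dot_star hx)
  obtain ⟨e1, e2, e3, e4⟩ := s0 (H.cubic_dot hx)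
  obtain ⟨f1, f2, f3, f4⟩ := s1 (H.cubic_dot_star hx)
  obtain ⟨g1, g2, g3, g4⟩ := s0 (H.cubic_dot_hopf hx)
  obtain ⟨h1, h2, h3, h4⟩ := s1 (H.cubic_dot_star_hopf hx)
  refine ⟨⟨a1, a2, rfl, ?_⟩, ⟨b1, b2, rfl, ?_⟩, ⟨c3, c4, d4, d3⟩, ⟨c1, c2, d1, d2⟩,
    ⟨e1, e2, f1, f2⟩, ⟨e3, e4, f4, f3⟩, ⟨g1, g2, h1, h2⟩, ⟨g3, g4, h4, h3⟩⟩
  · exact dotProduct_comm _ _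
  · exact dotProduct_comm _ _

theorem star_confFactor (F : Plane → Space n) (x : Plane) : star (confFactor F x) = confFactor F x :=
  star_dot_star_self _

theorem star_hopfNormSq (F : Plane → Space n) (x : Plane) : star (hopfNormSq F x) = hopfNormSq F x :=
  star_dot_star_self _

end IsotropicOn

/-! ### The pedal surface and its derivatives up to order three. -/

/-- The pedal surface of a parametrized surface. -/
def localPedal (F : Plane → Space n) (o : Space n) (x : Plane) : Space n :=
  F x + (tangentPlane F x).starProjection (o - F x)

/-- The `∂`-component of the position vector. -/
def posTangent (F : Plane → Space n) (o : Space n) (x : Plane) : ℂ :=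
  (cxF F x - cx o) ⬝ᵥ star (dz (cxF F) x) / confFactor F x

/-- The conjugate of the `∂̄`-derivative of `posTangent`. -/
def posNormal (F : Plane → Space n) (o : Space n) (x : Plane) : ℂ :=
  (cxF F x - cx o) ⬝ᵥ hopf F x / confFactor F x

theorem localPedal_eq (F : Plane → Space n) (o : Space n) (x : Plane) :
    localPedal F o x = o + normalPart F x (F x - o) := by
  rw [normalPart, localPedal]
  have := Submodule.starProjection_add_starProjection_orthogonal (K := tangentPlane F x) (F x - o)
  have h2 : (tangentPlane F x).starProjection (o - F x) =
      - (tangentPlane F x).starProjection (F x - o) := by rw [← map_neg, neg_sub]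
  rw [h2, eq_sub_of_add_eq' this]
  abel

namespace IsotropicOn

variable {F : Plane → Space n} {D : Set Plane} {x : Plane}

theorem cx_localPedal (H : IsotropicOn F D) (hx : x ∈ D) (o : Space n) :
    cxF (localPedal F o) x = cxF F x - posTangent F o x • dz (cxF F) x -
      star (posTangent F o x) • star (dz (cxF F) x) := by
  have hr : star (cxF F x - cx o) = cxF F x - cx o := by rw [star_sub, cxF, star_cx, star_cx]
  rw [cxF, localPedal_eq, map_add, H.cx_normalPart hx, nproj, map_sub, posTangent, star_div₀,
    star_confFactor, star_dot, star_star, hr]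
  change cx o + (cxF F x - cx o - _ - _) = _
  rw [confFactor]
  abel

theorem hasWirt_pos (H : IsotropicOn F D) (hx : x ∈ D) (o : Space n) :
    HasWirt (fun y => cxF F y - cx o) (dz (cxF F) x) (star (dz (cxF F) x)) x := by
  simpa using (H.hasWirt hx).sub (HasWirt.const (cx o))

theorem hasWirt_posTangent (H : IsotropicOn F D) (hx : x ∈ D) (o : Space n) :
    HasWirt (posTangent F o) (1 - posTangent F o x * coef F x) (star (posNormal F o x)) x := by
  have h := ((H.hasWirt_pos hx o).dot (H.hasWirt_phi hx).vstar).div (H.hasWirt_confFactor hx)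
    (H.confFactor_ne_zero hx)
  have hρ := H.confFactor_ne_zero hx
  have hr : star (cxF F x - cx o) = cxF F x - cx o := by rw [star_sub, cxF, star_cx, star_cx]
  obtain ⟨⟨a1, a2, a3, a4⟩, -⟩ := H.dot_table hx
  refine HasWirt.congr_left (HasWirt.congr_right h ?_) ?_
  · rw [posNormal, star_div₀, star_confFactor, star_dot, hr, a2, star_add, dotProduct_add, star_smul,
      dotProduct_smul, smul_eq_mul]
    field_simp
    ring
  · rw [a3, star_zero, dotProduct_zero, posTangent]
    field_simp
    ring

theorem hasWirt_posNormal (H : IsotropicOn F D) (hx : x ∈ D) (o : Space n) :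
    HasWirt (posNormal F o)
      ((cxF F x - cx o) ⬝ᵥ cubic F x / confFactor F x +
        (hopfCoef F x - coef F x) * posNormal F o x)
      (-(hopfNormSq F x / confFactor F x) * star (posTangent F o x) -
        posNormal F o x * star (coef F x)) x := by
  have h := ((H.hasWirt_pos hx o).dot (H.hasWirt_psi hx)).div (H.hasWirt_confFactor hx)
    (H.confFactor_ne_zero hx)
  have hρ := H.confFactor_ne_zero hx
  have hr : star (cxF F x - cx o) = cxF F x - cx o := by rw [star_sub, cxF, star_cx, star_cx]
  obtain ⟨-, -, ⟨a1, a2, a3, a4⟩, -⟩ := H.dot_table hx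
  refine HasWirt.congr_left (HasWirt.congr_right h ?_) ?_
  · rw [posTangent, star_div₀, star_confFactor, star_dot, star_star, hr, posNormal, a4,
      dotProduct_smul, smul_eq_mul]
    field_simp
    ring
  · rw [a1, dotProduct_add, dotProduct_smul, smul_eq_mul, posNormal]
    field_simp
    ring

/-- The central cancellation: in ∂(F - aφ - āφ̄) the terms in φ cancel because ∂a = 1 - κa, and the
φ̄ term has coefficient -b because ∂ā is the conjugate of ∂̄a = b̄. -/
theorem hasWirt_pedal (H : IsotropicOn F D) (hx : x ∈ D) (o : Space n) :
    HasWirt (cxF (localPedal F o))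
      (-(posTangent F o x • hopf F x + posNormal F o x • star (dz (cxF F) x)))
      (-(star (posTangent F o x) • star (hopf F x) + star (posNormal F o x) • dz (cxF F) x)) x := by
  have h1 := (H.hasWirt_posTangent hx o).smul (H.hasWirt_phi hx)
  have h2 := ((H.hasWirt hx).sub h1).sub h1.vstar
  have h3 : HasWirt (cxF (localPedal F o)) _ _ x := h2.congr_of_eventuallyEq
    (Filter.eventuallyEq_of_mem (H.mem_nhds hx) fun y hy => by
      rw [H.cx_localPedal hy, star_smul])
  refine HasWirt.congr_left (HasWirt.congr_right h3 ?_) ?_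
  · simp only [star_add, star_smul, star_sub, star_one, star_mul]
    match_scalars <;> ring
  · simp only [star_add, star_smul, star_star, star_zero]
    match_scalars <;> ring

theorem hasWirt_dz_pedal (H : IsotropicOn F D) (hx : x ∈ D) (o : Space n) :
    HasWirt (dz (cxF (localPedal F o)))
      (-(posTangent F o x • cubic F x +
        (1 - posTangent F o x * coef F x + posTangent F o x * hopfCoef F x) • hopf F x +
        ((cxF F x - cx o) ⬝ᵥ cubic F x / confFactor F x +
          (hopfCoef F x - coef F x) * posNormal F o x) • star (dz (cxF F) x)))
      (-(star (posNormal F o x) • hopf F x + posNormal F o x • star (hopf F x)) +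
        (hopfNormSq F x / confFactor F x) • (posTangent F o x • dz (cxF F) x +
          star (posTangent F o x) • star (dz (cxF F) x))) x := by
  have h1 := (((H.hasWirt_posTangent hx o).smul (H.hasWirt_psi hx)).add
    ((H.hasWirt_posNormal hx o).smul (H.hasWirt_phi hx).vstar)).neg
  have h3 : HasWirt (dz (cxF (localPedal F o))) _ _ x := h1.congr_of_eventuallyEq
    (Filter.eventuallyEq_of_mem (H.mem_nhds hx) fun y hy => (H.hasWirt_pedal hy o).dz_eq)
  refine HasWirt.congr_left (HasWirt.congr_right h3 ?_) ?_
  · simp only [star_add, star_smul]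
    match_scalars <;> ring
  · simp only [star_zero]
    match_scalars <;> ring

/-- Only the ∂-derivative matters: as ∂̄∂∂G = ∂∂̄∂G, it supplies the third derivative occurring in
∂̄ of the Hopf differential of the pedal surface. -/
theorem hasWirt_dzbar_dz_pedal (H : IsotropicOn F D) (hx : x ∈ D) (o : Space n) :
    ∃ w, HasWirt (dzbar (dz (cxF (localPedal F o))))
      (-(star (posNormal F o x) • cubic F x) +
        (2 * posTangent F o x * (hopfNormSq F x / confFactor F x) +
          star (posNormal F o x) * (coef F x - hopfCoef F x)) • hopf F x +
        (-((cxF F x - cx o) ⬝ᵥ cubic F x / confFactor F x +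
          (hopfCoef F x - coef F x) * posNormal F o x)) • star (hopf F x) +
        (hopfNormSq F x / confFactor F x * (1 + posTangent F o x * (hopfCoef F x - coef F x))) •
          dz (cxF F) x +
        (hopfNormSq F x / confFactor F x * (2 * posNormal F o x +
          star (posTangent F o x) * (hopfCoef F x - coef F x))) • star (dz (cxF F) x)) w x := by
  have hρ := H.confFactor_ne_zero hx
  have ha := H.hasWirt_posTangent hx o
  have hb := H.hasWirt_posNormal hx o
  have hψ := H.hasWirt_psi hx
  have hφ := H.hasWirt_phi hx
  have h1 := ((hb.star.smul hψ).add (hb.smul hψ.vstar)).neg.add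
    (((H.hasWirt_hopfNormSq hx).div (H.hasWirt_confFactor hx) hρ).smul
      ((ha.smul hφ).add (ha.star.smul hφ.vstar)))
  have h3 : HasWirt (dzbar (dz (cxF (localPedal F o)))) _ _ x := h1.congr_of_eventuallyEq
    (Filter.eventuallyEq_of_mem (H.mem_nhds hx) fun y hy => (H.hasWirt_dz_pedal hy o).dzbar_eq)
  refine ⟨_, HasWirt.congr_left h3 ?_⟩
  simp only [star_zero, star_smul, star_neg, star_div₀, star_confFactor, star_hopfNormSq, star_sub,
    star_mul, star_star]
  match_scalars <;> field_simp <;> ring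

end IsotropicOn

end Isotropic

/-! ### The pedal surface in isothermal coordinates -/

section Pedal

variable {n : ℕ}

theorem nproj_dot {φ w t : CSpace n} (h : φ ⬝ᵥ t = 0) (h' : star φ ⬝ᵥ t = 0) :
    nproj φ w ⬝ᵥ t = w ⬝ᵥ t := by
  rw [nproj, sub_dotProduct, sub_dotProduct, smul_dotProduct, smul_dotProduct, h, h']; simp

namespace IsotropicOn

variable {F : Plane → Space n} {D : Set Plane} {x : Plane} {o : Space n}

/-- ∂G lies in the span of ψ and φ̄, on which the bilinear product vanishes identically. -/
theorem dz_pedal_dot_self (H : IsotropicOn F D) (hx : x ∈ D) :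
    dz (cxF (localPedal F o)) x ⬝ᵥ dz (cxF (localPedal F o)) x = 0 := by
  obtain ⟨⟨a1, a2, a3, a4⟩, ⟨b1, b2, b3, b4⟩, ⟨c1, c2, c3, c4⟩, ⟨d1, d2, d3, d4⟩, -⟩ := H.dot_table hx
  rw [(H.hasWirt_pedal hx o).dz_eq]
  simp only [neg_dotProduct, dotProduct_neg, add_dotProduct, dotProduct_add, smul_dotProduct,
    dotProduct_smul, b1, d3, c4, a2]
  simp

theorem isothermalOn_pedal (H : IsotropicOn F D) (hs : ContDiffOn ℝ ∞ (localPedal F o) D)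
    (hi : ∀ x ∈ D, Function.Injective (fderiv ℝ (localPedal F o) x)) :
    IsothermalOn (localPedal F o) D where
  isOpen := H.isOpen
  smooth := hs
  injective := hi
  isothermal x hx := by
    rw [isIsothermalAt_iff ((hs.contDiffAt (H.mem_nhds hx)).differentiableAt (by simp))]
    exact H.dz_pedal_dot_self hx

theorem confFactor_pedal (H : IsotropicOn F D) (hx : x ∈ D) :
    confFactor (localPedal F o) x =
      posTangent F o x * star (posTangent F o x) * hopfNormSq F x +
        posNormal F o x * star (posNormal F o x) * confFactor F x := by
  obtain ⟨⟨a1, a2, a3, a4⟩, ⟨b1, b2, b3, b4⟩, ⟨c1, c2, c3, c4⟩, ⟨d1, d2, d3, d4⟩, -⟩ := H.dot_table hx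
  rw [confFactor, (H.hasWirt_pedal hx o).dz_eq]
  simp only [star_neg, star_add, star_smul, star_star, neg_dotProduct, dotProduct_neg,
    add_dotProduct, dotProduct_add, smul_dotProduct, dotProduct_smul, b3, d1, c2, a4, smul_eq_mul]
  ring

/-- Modulo the totally isotropic span of ψ and φ̄, to which χ is orthogonal, ∂∂G equals -aχ. -/
theorem dz_dz_pedal_dot_self (H : IsotropicOn F D) (hx : x ∈ D) :
    dz (dz (cxF (localPedal F o))) x ⬝ᵥ dz (dz (cxF (localPedal F o))) x =
      posTangent F o x ^ 2 * (cubic F x ⬝ᵥ cubic F x) := by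
  obtain ⟨⟨a1, a2, a3, a4⟩, ⟨b1, b2, b3, b4⟩, ⟨c1, c2, c3, c4⟩, ⟨d1, d2, d3, d4⟩,
    ⟨e1, e2, e3, e4⟩, ⟨f1, f2, f3, f4⟩, ⟨g1, g2, g3, g4⟩, ⟨h1, h2, h3, h4⟩⟩ := H.dot_table hx
  rw [(H.hasWirt_dz_pedal hx o).dz_eq]
  simp only [neg_dotProduct, dotProduct_neg, add_dotProduct, dotProduct_add, smul_dotProduct,
    dotProduct_smul, smul_eq_mul, a2, b1, c4, d3, e3, f4, g1, h1]
  ring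

theorem cubic_isotropic_of_pedal (H : IsotropicOn F D)
    (h : ∀ x ∈ D, dz (dz (cxF (localPedal F o))) x ⬝ᵥ dz (dz (cxF (localPedal F o))) x = 0)
    (hx : x ∈ D) : cubic F x ⬝ᵥ cubic F x = 0 := by
  by_contra hne
  have hc : ContinuousAt (fun y => cubic F y ⬝ᵥ cubic F y) x := by
    have := H.continuousOn_cubic.continuousAt (H.mem_nhds hx)
    rw [continuousAt_pi] at this
    simp only [dotProduct]
    exact tendsto_finsetSum _ fun j _ => (this j).mul (this j)
  -- If χ·χ ≠ 0 at `x`, it is nonzero nearby, so a vanishes on a neighbourhood; then ∂a = 1 - κa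
  -- would read 0 = 1.
  have h0 : posTangent F o =ᶠ[𝓝 x] fun _ => 0 := by
    filter_upwards [hc.eventually_ne hne, H.mem_nhds hx] with y hy hyD
    have := h y hyD
    rw [H.dz_dz_pedal_dot_self hyD] at this
    simpa [hy] using this
  have := (H.hasWirt_posTangent hx o).unique_left ((HasWirt.const 0).congr_of_eventuallyEq h0)
  rw [h0.self_of_nhds] at this
  simp at this

theorem cubic_dot_star_ne_zero (hc : cubic F x ≠ 0) : cubic F x ⬝ᵥ star (cubic F x) ≠ 0 :=
  fun h => hc (dot_star_self_eq_zero.1 h)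

/-- Pairing with χ̄ isolates the χ-coefficient -a. If a = 0, the ψ-coefficient is -1, which pairing
with ψ̄ detects. -/
theorem hopf_pedal_ne_zero (H : IsotropicOn F D) (HG : IsothermalOn (localPedal F o) D) (hx : x ∈ D)
    (hc : cubic F x ≠ 0) : hopf (localPedal F o) x ≠ 0 := by
  intro h0
  obtain ⟨⟨a1, a2, a3, a4⟩, ⟨b1, b2, b3, b4⟩, ⟨c1, c2, c3, c4⟩, ⟨d1, d2, d3, d4⟩,
    ⟨e1, e2, e3, e4⟩, ⟨f1, f2, f3, f4⟩, ⟨g1, g2, g3, g4⟩, ⟨h1, h2, h3, h4⟩⟩ := H.dot_table hx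
  rw [HG.dot_hopf hx, ← coef, (H.hasWirt_dz_pedal hx o).dz_eq, (H.hasWirt_pedal hx o).dz_eq] at h0
  have k1 := congrArg (fun u => u ⬝ᵥ star (cubic F x)) h0
  simp only [sub_dotProduct, smul_dotProduct, neg_dotProduct, add_dotProduct, smul_eq_mul, h3, f2,
    zero_dotProduct] at k1
  have ha : posTangent F o x = 0 := by
    simpa [cubic_dot_star_ne_zero hc] using k1
  have k2 := congrArg (fun u => u ⬝ᵥ star (hopf F x)) h0
  simp only [sub_dotProduct, smul_dotProduct, neg_dotProduct, add_dotProduct, smul_eq_mul, b3, c2,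
    zero_dotProduct, ha] at k2
  simp at k2
  exact H.hopfNormSq_ne_zero hx k2

/-- A relation with coefficients s, t is tested against two complex vectors normal to the pedal
surface. This gives s b̄ + t a = 0 and s ā σ/ρ - t b = 0, a system whose determinant is, up to sign
and the factor ρ, the nonzero quantity |∂G|² = |a|²σ + |b|²ρ. -/
theorem not_dbarHopfParallel_pedal (H : IsotropicOn F D) (HG : IsothermalOn (localPedal F o) D)
    (hx : x ∈ D) (hc : cubic F x ≠ 0) : ¬ DbarHopfParallel (localPedal F o) x := by
  rw [DbarHopfParallel, not_not, HG.complexVector_dbarHopf hx, HG.complexVector_hopf hx,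
    LinearIndependent.pair_iff]
  intro s t hst
  obtain ⟨⟨a1, a2, a3, a4⟩, ⟨b1, b2, b3, b4⟩, ⟨c1, c2, c3, c4⟩, ⟨d1, d2, d3, d4⟩,
    ⟨q1, q2, q3, q4⟩, ⟨f1, f2, f3, f4⟩, ⟨g1, g2, g3, g4⟩, ⟨h1, h2, h3, h4⟩⟩ := H.dot_table hx
  have hρ := H.confFactor_ne_zero hx
  have hσ := H.hopfNormSq_ne_zero hx
  have hτ := cubic_dot_star_ne_zero hc
  have hG := HG.dot_star_ne_zero hx
  change confFactor _ x ≠ 0 at hG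
  have eG := H.confFactor_pedal (o := o) hx
  have ecoef : coef (localPedal F o) x * confFactor (localPedal F o) x =
    dz (dz (cxF (localPedal F o))) x ⬝ᵥ star (dz (cxF (localPedal F o)) x) :=
    div_mul_cancel₀ _ hG
  obtain ⟨w, hw⟩ := H.hasWirt_dzbar_dz_pedal hx o
  have e1 := (H.hasWirt_pedal hx o).dz_eq
  have e2 := (H.hasWirt_dz_pedal hx o).dz_eq
  have e3 := (H.hasWirt_dz_pedal hx o).dzbar_eq
  have e4 := hw.dz_eq
  have e5 := (HG.hasWirt_hopf hx).dzbar_eq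
  rw [← dz_dzbar_comm HG.isOpen HG.smooth_dz hx, e4, e3, e1] at e5
  have e6 : hopf (localPedal F o) x = _ := HG.dot_hopf hx
  change _ = _ - coef (localPedal F o) x • dz (cxF (localPedal F o)) x at e6
  rw [e2, e1] at e6
  rw [e2, e1] at ecoef
  rw [e1, e5, e6] at hst
  generalize hA : posTangent F o x = a at *
  generalize hB : posNormal F o x = b at *
  generalize hv : (cxF F x - cx o) ⬝ᵥ cubic F x = v at *
  generalize coef (localPedal F o) x = c at *
  generalize dzbar (coef (localPedal F o)) x = c' at *
  generalize confFactor (localPedal F o) x = g at *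
  have sr : star (confFactor F x) = confFactor F x := star_confFactor F x
  have ss : star (hopfNormSq F x) = hopfNormSq F x := star_hopfNormSq F x
  generalize confFactor F x = ρ at *
  generalize hopfNormSq F x = σ at *
  generalize cubic F x = χ at *
  generalize dz (cxF F) x = φ at *
  generalize hopf F x = ψ at *
  generalize hopfCoef F x = μ at *
  generalize coef F x = κ at *
  simp only [star_neg, star_add, star_smul, star_star, neg_dotProduct, dotProduct_neg,
    add_dotProduct, dotProduct_add, smul_dotProduct, dotProduct_smul, smul_eq_mul, q1, b3, d1, a4,
    c2, g3] at ecoef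
  have k1 := congrArg (fun u => u ⬝ᵥ star χ) hst
  -- The test vector is the combination of ψ̄ and φ orthogonal to ∂G = -(aψ + bφ̄). It is orthogonal
  -- to the conjugate of ∂G too, since ψ̄ and φ span a totally isotropic space, so `nproj` can be
  -- dropped.
  have k2 := congrArg (fun u => u ⬝ᵥ (b • ρ • star ψ - a • σ • φ)) hst
  simp only [add_dotProduct, smul_dotProduct, zero_dotProduct] at k1 k2
  rw [nproj_dot (by simp [neg_dotProduct, add_dotProduct, smul_dotProduct, h3, f2])
    (by simp [neg_dotProduct, add_dotProduct, smul_dotProduct, h2, f3])] at k1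
  rw [nproj_dot (by
      simp only [neg_dotProduct, add_dotProduct, smul_dotProduct, dotProduct_sub, dotProduct_smul,
        smul_eq_mul, b3, d1, c2, a4]
      ring) (by
      simp only [star_neg, star_add, star_smul, star_star, neg_dotProduct, add_dotProduct,
        smul_dotProduct, dotProduct_sub, dotProduct_smul, smul_eq_mul, b2, d4, c3, a1]
      ring)] at k2
  simp only [sub_dotProduct, neg_dotProduct, add_dotProduct, smul_dotProduct, smul_eq_mul, h3, f2,
    h2, f3] at k1
  simp only [sub_dotProduct, neg_dotProduct, add_dotProduct, smul_dotProduct, dotProduct_sub,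
    dotProduct_smul, smul_eq_mul, a1, a4, b2, b3, c2, c3, d1, d4, g3, q1] at k2
  -- Writing v and σ as multiples of ρ clears the denominators and makes the rest polynomial.
  obtain ⟨V, rfl⟩ : ∃ V, v = V * ρ := ⟨v / ρ, by field_simp⟩
  obtain ⟨S, rfl⟩ : ∃ S, σ = S * ρ := ⟨σ / ρ, by field_simp⟩
  simp only [mul_div_cancel_right₀ _ hρ] at k1 k2 ecoef
  have K1 : s * star b + t * a = 0 := by
    have : (s * star b + t * a) * (χ ⬝ᵥ star χ) = 0 := by linear_combination -k1
    exact (mul_eq_zero.1 this).resolve_right hτ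
  have K2 : s * (star a * S) - t * b = 0 := by
    have : (s * (star a * S) - t * b) * (ρ * (S * ρ)) = 0 := by
      linear_combination k2 + s * (S * ρ) * c * eG - s * (S * ρ) * ecoef - V * ρ * (S * ρ) * K1
    exact (mul_eq_zero.1 this).resolve_right (mul_ne_zero hρ hσ)
  -- The combination aρ·K2 + bρ·K1 eliminates t and leaves s|∂G|².
  have hs : s = 0 := by
    have : s * g = 0 := by linear_combination s * eG + a * ρ * K2 + b * ρ * K1
    exact (mul_eq_zero.1 this).resolve_right hG
  subst hs
  refine ⟨rfl, ?_⟩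
  by_contra ht
  have ha : a = 0 := by simpa [ht] using K1
  have hb : b = 0 := by simpa [ht] using K2
  exact hG (by rw [eG, ha, hb]; simp)

end IsotropicOn

end Pedal

/-! ### Invariance of the S-Willmore condition under Möbius transformations -/

section Moebius

variable {n : ℕ}

/-- `∂̄ α(∂, ∂)` and `α(∂, ∂)` are linearly dependent modulo the tangent plane. -/
def HopfDependent (F : Plane → Space n) (x : Plane) : Prop :=
  ∃ s t : ℂ, (s ≠ 0 ∨ t ≠ 0) ∧ ∃ c d : ℂ, s • dzbar (hopf F) x + t • hopf F x =
    c • dz (cxF F) x + d • star (dz (cxF F) x)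

theorem nproj_of_dot_eq_zero {φ w : CSpace n} (h : w ⬝ᵥ φ = 0) (h' : w ⬝ᵥ star φ = 0) :
    nproj φ w = w := by rw [nproj, h, h']; simp

namespace IsothermalOn

variable {F G : Plane → Space n} {D : Set Plane} {x : Plane}

theorem dbarHopfParallel_of_hopfDependent (H : IsothermalOn F D) (hx : x ∈ D)
    (h : HopfDependent F x) : DbarHopfParallel F x := by
  obtain ⟨s, t, hst, c, d, h⟩ := h
  rw [DbarHopfParallel, H.complexVector_dbarHopf hx, H.complexVector_hopf hx,
    LinearIndependent.pair_iff]
  intro hl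
  have h2 := congrArg (nproj (dz (cxF F) x)) h
  rw [nproj_add, nproj_add, nproj_smul, nproj_smul, nproj_smul, nproj_smul,
    nproj_self (H.dot_self hx) (H.dz_ne_zero hx), nproj_star_self (H.dot_self hx) (H.dz_ne_zero hx),
    nproj_of_dot_eq_zero (H.hopf_dot hx) (H.hopf_dot_star hx), smul_zero, smul_zero, add_zero] at h2
  obtain ⟨rfl, rfl⟩ := hl s t h2
  simp at hst

/-- For a harmonic map ∂̄∂∂F = 0, so ∂̄ of the Hopf differential is tangent. This is the Codazzi
equation: the Hopf differential of a minimal surface is holomorphic in the normal bundle. -/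
theorem hopfDependent_of_minimal (H : IsothermalOn F D) (hx : x ∈ D)
    (hm : ∀ y ∈ D, MeanCurvatureVanishes F y) : HopfDependent F x := by
  have h0 : ∀ y ∈ D, dzbar (dz (cxF F)) y = 0 := fun y hy => H.dzbar_dz_eq_zero hy (hm y hy)
  have hz : dzbar (dz (dz (cxF F))) x = 0 := by
    rw [← dz_dzbar_comm H.isOpen H.smooth_dz hx]
    exact ((HasWirt.const (0 : CSpace n) (x := x)).congr_of_eventuallyEq
      (Filter.eventuallyEq_of_mem (H.mem_nhds hx) h0)).dz_eq
  refine ⟨1, 0, Or.inl one_ne_zero, -dzbar (coef F) x, 0, ?_⟩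
  rw [(H.hasWirt_hopf hx).dzbar_eq, hz, h0 x hx]
  module

theorem of_dz (hD : IsOpen D) (hs : ContDiffOn ℝ ∞ F D)
    (h : ∀ x ∈ D, dz (cxF F) x ⬝ᵥ dz (cxF F) x = 0 ∧ dz (cxF F) x ≠ 0) : IsothermalOn F D := by
  have hd : ∀ x ∈ D, DifferentiableAt ℝ F x := fun x hx =>
    (hs.contDiffAt (hD.mem_nhds hx)).differentiableAt (by simp)
  refine ⟨hD, hs, fun x hx => ?_, fun x hx => (isIsothermalAt_iff (hd x hx)).2 (h x hx).1⟩
  rw [injective_iff_map_eq_zero]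
  intro v hv
  have h1 := norm_sq_twoRe_smul (h x hx).1 (zeta v)
  rw [← fderiv_eq_twoRe (hd x hx), hv, norm_zero] at h1
  have h2 : (dz (cxF F) x ⬝ᵥ star (dz (cxF F) x)).re ≠ 0 := by
    intro e
    apply (h x hx).2
    rw [← dot_star_self_eq_zero, dot_star_self_eq_re, e, Complex.ofReal_zero]
  have h3 : zeta v = 0 := by simpa [h2] using h1
  apply zeta_injective
  rw [h3]; apply Complex.ext <;> simp [zeta]

end IsothermalOn

theorem eventuallyEq_dz {E : Type*} [NormedAddCommGroup E] [NormedSpace ℝ E] [NormedSpace ℂ E]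
    [IsScalarTower ℝ ℂ E] {h k : Plane → E} {x : Plane} (e : h =ᶠ[𝓝 x] k) : dz h =ᶠ[𝓝 x] dz k := by
  filter_upwards [e.fderiv (𝕜 := ℝ)] with y hy
  rw [dz, dz, hy]

theorem eventuallyEq_dzbar {E : Type*} [NormedAddCommGroup E] [NormedSpace ℝ E] [NormedSpace ℂ E]
    [IsScalarTower ℝ ℂ E] {h k : Plane → E} {x : Plane} (e : h =ᶠ[𝓝 x] k) :
    dzbar h =ᶠ[𝓝 x] dzbar k := by
  filter_upwards [e.fderiv (𝕜 := ℝ)] with y hy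
  rw [dzbar, dzbar, hy]

theorem HopfDependent.congr {F G : Plane → Space n} {x : Plane} (e : F =ᶠ[𝓝 x] G)
    (h : HopfDependent F x) : HopfDependent G x := by
  have e1 : cxF F =ᶠ[𝓝 x] cxF G := by
    filter_upwards [e] with y hy
    rw [cxF, cxF, hy]
  have e2 := eventuallyEq_dz e1
  have e3 := eventuallyEq_dz e2
  have e4 : hopf F =ᶠ[𝓝 x] hopf G := by
    filter_upwards [e2, e3] with y h1 h2
    rw [hopf, hopf, h1, h2]
  have e5 := eventuallyEq_dzbar e4
  rwa [HopfDependent, e5.self_of_nhds, e4.self_of_nhds, e2.self_of_nhds] at h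

theorem IsothermalOn.congr {F G : Plane → Space n} {D : Set Plane} (H : IsothermalOn F D)
    (e : Set.EqOn F G D) : IsothermalOn G D := by
  have h : ∀ x ∈ D, fderiv ℝ F x = fderiv ℝ G x := fun x hx =>
    (Filter.eventuallyEq_of_mem (H.mem_nhds hx) e).fderiv_eq
  refine ⟨H.isOpen, H.smooth.congr fun x hx => (e hx).symm, fun x hx => ?_, fun x hx => ?_⟩
  · rw [← h x hx]; exact H.injective x hx
  · rw [IsIsothermalAt, ← h x hx]; exact H.isothermal x hx

/-! #### Inversions -/

section Inversion

variable {F : Plane → Space n} {D : Set Plane} {x : Plane} {c : Space n} {R : ℝ}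

/-- The square of the distance to `c`. -/
def distSq (F : Plane → Space n) (c : Space n) (x : Plane) : ℂ :=
  (cxF F x - cx c) ⬝ᵥ (cxF F x - cx c)

/-- The reflection in the hyperplane orthogonal to `F x - c`. -/
def reflect (F : Plane → Space n) (c : Space n) (x : Plane) (w : CSpace n) : CSpace n :=
  w - (2 * ((cxF F x - cx c) ⬝ᵥ w) / distSq F c x) • (cxF F x - cx c)

theorem distSq_eq (F : Plane → Space n) (c : Space n) (x : Plane) :
    distSq F c x = ((dist (F x) c ^ 2 : ℝ) : ℂ) := by
  rw [distSq, cxF, ← map_sub, cx_dot, real_inner_self_eq_norm_sq, dist_eq_norm]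

theorem distSq_ne_zero (hc : F x ≠ c) : distSq F c x ≠ 0 := by
  rw [distSq_eq]
  have := dist_ne_zero.2 hc
  exact_mod_cast pow_ne_zero 2 this

theorem reflect_add_smul (s t : ℂ) (u w : CSpace n) :
    reflect F c x (s • u + t • w) = s • reflect F c x u + t • reflect F c x w := by
  simp only [reflect, dotProduct_add, dotProduct_smul, smul_eq_mul]
  match_scalars <;> ring

/-- The complexified reflection is orthogonal for the bilinear product. It is the conformal part of
the differential of the inversion. -/
theorem reflect_dot_reflect (hc : F x ≠ c) (u w : CSpace n) :
    reflect F c x u ⬝ᵥ reflect F c x w = u ⬝ᵥ w := by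
  have hr := distSq_ne_zero hc
  simp only [reflect, sub_dotProduct, dotProduct_sub, smul_dotProduct, dotProduct_smul, smul_eq_mul]
  have e : (cxF F x - cx c) ⬝ᵥ (cxF F x - cx c) = distSq F c x := rfl
  simp only [sub_dotProduct, dotProduct_sub] at e
  rw [dotProduct_comm u (cxF F x), dotProduct_comm u (cx c)]
  field_simp
  linear_combination 4 * (cxF F x ⬝ᵥ w - cx c ⬝ᵥ w) * (cxF F x ⬝ᵥ u - cx c ⬝ᵥ u) * e

theorem star_reflect (w : CSpace n) : star (reflect F c x w) = reflect F c x (star w) := by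
  have h1 : star (cxF F x - cx c) = cxF F x - cx c := by rw [star_sub, cxF, star_cx, star_cx]
  have h2 : star (distSq F c x) = distSq F c x := by rw [distSq, star_dot, h1]
  rw [reflect, star_sub, star_smul, star_div₀, star_mul, star_dot, h1, h2, reflect, star_ofNat,
    mul_comm]

theorem cx_inversion (x : Plane) :
    cxF (fun y => EuclideanGeometry.inversion c R (F y)) x =
      ((R : ℂ) ^ 2 / distSq F c x) • (cxF F x - cx c) + cx c := by
  rw [cxF, EuclideanGeometry.inversion, vsub_eq_sub, vadd_eq_add, map_add, cx_smul, map_sub,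
    distSq_eq, cxF]
  push_cast
  rw [div_pow]

namespace IsothermalOn

theorem hasWirt_distSq (H : IsothermalOn F D) (hx : x ∈ D) (c : Space n) :
    HasWirt (distSq F c) (2 * ((cxF F x - cx c) ⬝ᵥ dz (cxF F) x))
      (2 * ((cxF F x - cx c) ⬝ᵥ star (dz (cxF F) x))) x := by
  have h1 := (H.hasWirt hx).sub (HasWirt.const (cx c))
  refine HasWirt.congr_left (HasWirt.congr_right (h1.dot h1) ?_) ?_
  · rw [sub_zero, dotProduct_comm (star _)]; ring
  · rw [sub_zero, dotProduct_comm (dz _ _)]; ring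

theorem hasWirt_factor (H : IsothermalOn F D) (hx : x ∈ D) (hc : F x ≠ c) (R : ℝ) :
    HasWirt (fun y => (R : ℂ) ^ 2 / distSq F c y)
      (-((R : ℂ) ^ 2 / distSq F c x) * (2 * ((cxF F x - cx c) ⬝ᵥ dz (cxF F) x) / distSq F c x))
      (-((R : ℂ) ^ 2 / distSq F c x) * (2 * ((cxF F x - cx c) ⬝ᵥ star (dz (cxF F) x)) /
        distSq F c x)) x := by
  have hr := distSq_ne_zero hc
  refine HasWirt.congr_left (HasWirt.congr_right
    ((HasWirt.const ((R : ℂ) ^ 2)).div (H.hasWirt_distSq hx c) hr) ?_) ?_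
  · field_simp; ring
  · field_simp; ring

theorem hasWirt_inversion (H : IsothermalOn F D) (hx : x ∈ D) (hc : F x ≠ c) (R : ℝ) :
    HasWirt (cxF fun y => EuclideanGeometry.inversion c R (F y))
      (((R : ℂ) ^ 2 / distSq F c x) • reflect F c x (dz (cxF F) x))
      (((R : ℂ) ^ 2 / distSq F c x) • reflect F c x (star (dz (cxF F) x))) x := by
  have hr := distSq_ne_zero hc
  have h1 := (H.hasWirt hx).sub (HasWirt.const (cx c))
  have h2 := ((H.hasWirt_factor hx hc R).smul h1).add (HasWirt.const (cx c))
  have h3 : HasWirt (cxF fun y => EuclideanGeometry.inversion c R (F y)) _ _ x :=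
    h2.congr_of_eventuallyEq (Filter.Eventually.of_forall fun y => cx_inversion y)
  refine HasWirt.congr_left (HasWirt.congr_right h3 ?_) ?_
  · simp only [reflect]; module
  · simp only [reflect]; module

theorem inversion (H : IsothermalOn F D) (hc : ∀ x ∈ D, F x ≠ c) (hR : 0 < R) :
    IsothermalOn (fun y => EuclideanGeometry.inversion c R (F y)) D := by
  refine of_dz H.isOpen ?_ fun x hx => ?_
  · exact ContDiffOn.inversion contDiffOn_const contDiffOn_const H.smooth hc
  · have hr := distSq_ne_zero (hc x hx)
    have hm : (R : ℂ) ^ 2 / distSq F c x ≠ 0 :=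
      div_ne_zero (pow_ne_zero 2 (by exact_mod_cast hR.ne')) hr
    rw [(H.hasWirt_inversion hx (hc x hx) R).dz_eq]
    constructor
    · rw [smul_dotProduct, dotProduct_smul, reflect_dot_reflect (hc x hx), H.dot_self hx]; simp
    · refine smul_ne_zero hm fun h0 => H.dot_star_ne_zero hx ?_
      rw [← reflect_dot_reflect (hc x hx), h0, zero_dotProduct]

/-- Under a conformal map of the ambient space the second fundamental form changes, besides the
differential of the map, only by a multiple of the metric. The metric vanishes on (∂,∂), so the Hopf
differential is merely reflected and scaled. -/
theorem hopf_inversion (H : IsothermalOn F D) (hx : x ∈ D) (hc : ∀ x ∈ D, F x ≠ c) (hR : 0 < R) :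
    hopf (fun y => EuclideanGeometry.inversion c R (F y)) x =
      ((R : ℂ) ^ 2 / distSq F c x) • reflect F c x (hopf F x) := by
  have HY := H.inversion hc hR
  have hr := distSq_ne_zero (hc x hx)
  have eY := (H.hasWirt_inversion hx (hc x hx) R).dz_eq
  have hQ : dz (dz (cxF F)) x = hopf F x + coef F x • dz (cxF F) x := by
    rw [H.dot_hopf hx, coef]; abel
  have hP := (H.hasWirt hx).sub (HasWirt.const (cx c))
  have h1 := (H.hasWirt_factor hx (hc x hx) R).smul ((H.hasWirt_dz hx).sub
    ((((hP.dot (H.hasWirt_dz hx)).const_smul 2).div (H.hasWirt_distSq hx c) hr).smul hP))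
  have h2 : HasWirt (dz (cxF fun y => EuclideanGeometry.inversion c R (F y))) _ _ x :=
    h1.congr_of_eventuallyEq (Filter.eventuallyEq_of_mem (H.mem_nhds hx) fun y hy =>
      (H.hasWirt_inversion hy (hc y hy) R).dz_eq)
  have key : dz (dz (cxF fun y => EuclideanGeometry.inversion c R (F y))) x =
      ((R : ℂ) ^ 2 / distSq F c x) • reflect F c x (hopf F x) +
      (coef F x - 2 * (2 * ((cxF F x - cx c) ⬝ᵥ dz (cxF F) x) / distSq F c x)) •
        dz (cxF fun y => EuclideanGeometry.inversion c R (F y)) x := by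
    rw [h2.dz_eq, eY, hQ]
    simp only [reflect, sub_zero, dotProduct_add, dotProduct_smul, smul_eq_mul, H.dot_self hx]
    match_scalars <;> field_simp <;> ring
  rw [hopf, key, nproj_add, nproj_smul _ (coef F x - _),
    nproj_self (HY.dot_self hx) (HY.dz_ne_zero hx), smul_zero, add_zero]
  apply nproj_of_dot_eq_zero
  · rw [eY, smul_dotProduct, dotProduct_smul, reflect_dot_reflect (hc x hx), H.hopf_dot hx]; simp
  · rw [eY, star_smul, star_reflect, smul_dotProduct, dotProduct_smul, reflect_dot_reflect (hc x hx),
      H.hopf_dot_star hx]; simp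

theorem hopfDependent_inversion (H : IsothermalOn F D) (hx : x ∈ D) (hc : ∀ x ∈ D, F x ≠ c)
    (hR : 0 < R) (h : HopfDependent F x) :
    HopfDependent (fun y => EuclideanGeometry.inversion c R (F y)) x := by
  have hr := distSq_ne_zero (hc x hx)
  have hm : (R : ℂ) ^ 2 / distSq F c x ≠ 0 :=
    div_ne_zero (pow_ne_zero 2 (by exact_mod_cast hR.ne')) hr
  have hW := H.hasWirt_inversion hx (hc x hx) R
  obtain ⟨s, t, hst, c', d', h⟩ := h
  have hP := (H.hasWirt hx).sub (HasWirt.const (cx c))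
  have hQ : HasWirt (hopf F) (dz (hopf F) x) (dzbar (hopf F) x) x := by
    have := H.hasWirt_hopf hx
    rwa [← this.dzbar_eq] at this
  have h1 := (H.hasWirt_factor hx (hc x hx) R).smul (hQ.sub
    ((((hP.dot hQ).const_smul 2).div (H.hasWirt_distSq hx c) hr).smul hP))
  have h2 : HasWirt (hopf fun y => EuclideanGeometry.inversion c R (F y)) _ _ x :=
    h1.congr_of_eventuallyEq (Filter.eventuallyEq_of_mem (H.mem_nhds hx) fun y hy =>
      H.hopf_inversion hy hc hR)
  set q := 2 * ((cxF F x - cx c) ⬝ᵥ star (dz (cxF F) x)) / distSq F c x with hq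
  have hstar : star (dz (cxF F) x) ⬝ᵥ hopf F x = 0 := by
    rw [dotProduct_comm, H.hopf_dot_star hx]
  -- The corrections are a multiple of the new Hopf differential, which shifts t by sq, and a
  -- multiple of the conjugate of ∂Y (Y the inverted surface), which is tangent. The dependence
  -- therefore survives with s unchanged.
  have key : dzbar (hopf fun y => EuclideanGeometry.inversion c R (F y)) x =
      ((R : ℂ) ^ 2 / distSq F c x) • reflect F c x (dzbar (hopf F) x)
      - (((R : ℂ) ^ 2 / distSq F c x) * q) • reflect F c x (hopf F x)
      - (2 * ((cxF F x - cx c) ⬝ᵥ hopf F x) / distSq F c x) •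
        (((R : ℂ) ^ 2 / distSq F c x) • reflect F c x (star (dz (cxF F) x))) := by
    rw [h2.dzbar_eq]
    simp only [reflect, sub_zero, smul_eq_mul, hstar, hq]
    match_scalars <;> field_simp <;> ring
  have hS := congrArg (reflect F c x) h
  rw [reflect_add_smul, reflect_add_smul] at hS
  have eY := hW.dz_eq
  refine ⟨s, t + s * q, ?_, c', d' - s * (2 * ((cxF F x - cx c) ⬝ᵥ hopf F x) / distSq F c x), ?_⟩
  · by_cases hs : s = 0
    · subst hs; simpa using hst
    · exact Or.inl hs
  · have hreal : star ((R : ℂ) ^ 2 / distSq F c x) = (R : ℂ) ^ 2 / distSq F c x := by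
      rw [distSq_eq]; simp
    rw [H.hopf_inversion hx hc hR, key, eY, star_smul, star_reflect, hreal]
    linear_combination (norm := module) ((R : ℂ) ^ 2 / distSq F c x) • hS

theorem not_hopfDependent_inversion (H : IsothermalOn F D) (hx : x ∈ D) (hc : ∀ x ∈ D, F x ≠ c)
    (hR : 0 < R) (h : ¬ HopfDependent F x) :
    ¬ HopfDependent (fun y => EuclideanGeometry.inversion c R (F y)) x := by
  intro h'
  apply h
  -- An inversion is an involution, so the forward implication applied to the inverted surface gives
  -- the converse.
  have h2 := (H.inversion hc hR).hopfDependent_inversion hx (c := c) (fun y hy => by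
    rw [ne_eq, EuclideanGeometry.inversion_eq_center hR.ne']; exact hc y hy) hR h'
  simpa [EuclideanGeometry.inversion_inversion _ hR.ne'] using h2

end IsothermalOn

end Inversion

/-! #### Isometries -/

/-- The complexification of a linear isometry. -/
def cxMap (A : Space n ≃ₗᵢ[ℝ] Space n) : CSpace n →L[ℂ] CSpace n :=
  ∑ j, (ContinuousLinearMap.proj j : CSpace n →L[ℂ] ℂ).smulRight
    (cx (A (EuclideanSpace.single j 1)))

theorem cxMap_cx (A : Space n ≃ₗᵢ[ℝ] Space n) (u : Space n) : cxMap A (cx u) = cx (A u) := by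
  have hu : u = ∑ j, u j • EuclideanSpace.single j (1 : ℝ) := by
    ext i
    simp [Pi.single_apply]
  conv_rhs => rw [hu]
  simp only [cxMap, sum_apply, map_sum, ContinuousLinearMap.smulRight_apply,
    ContinuousLinearMap.proj_apply, cx_apply, map_smul]
  exact Finset.sum_congr rfl fun j _ => by ext i; simp

theorem exists_eq_cx (w : CSpace n) : ∃ u v : Space n, w = cx u + Complex.I • cx v :=
  ⟨WithLp.toLp 2 fun j => (w j).re, WithLp.toLp 2 fun j => (w j).im, by
    ext j; simp [mul_comm Complex.I, Complex.re_add_im]⟩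

theorem cxMap_dot (A : Space n ≃ₗᵢ[ℝ] Space n) (w w' : CSpace n) :
    cxMap A w ⬝ᵥ cxMap A w' = w ⬝ᵥ w' := by
  obtain ⟨u, v, rfl⟩ := exists_eq_cx w
  obtain ⟨u', v', rfl⟩ := exists_eq_cx w'
  simp only [map_add, map_smul, cxMap_cx, add_dotProduct, dotProduct_add, smul_dotProduct,
    dotProduct_smul, cx_dot, LinearIsometryEquiv.inner_map_map]

theorem cxMap_star (A : Space n ≃ₗᵢ[ℝ] Space n) (w : CSpace n) :
    cxMap A (star w) = star (cxMap A w) := by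
  obtain ⟨u, v, rfl⟩ := exists_eq_cx w
  simp only [map_add, map_smul, cxMap_cx, star_add, star_smul, star_cx]

namespace IsothermalOn

variable {F : Plane → Space n} {D : Set Plane} {x : Plane}

theorem hasWirt_isometry (H : IsothermalOn F D) (hx : x ∈ D) (A : Space n ≃ₗᵢ[ℝ] Space n)
    (b : Space n) : HasWirt (cxF fun y => A (F y) + b) (cxMap A (dz (cxF F) x))
      (cxMap A (star (dz (cxF F) x))) x := by
  have := ((H.hasWirt hx).comp_clm (cxMap A)).add (HasWirt.const (cx b))
  rw [add_zero, add_zero] at this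
  refine this.congr_of_eventuallyEq (Filter.Eventually.of_forall fun y => ?_)
  simp only [cxF, map_add, cxMap_cx]

theorem isometry (H : IsothermalOn F D) (A : Space n ≃ₗᵢ[ℝ] Space n) (b : Space n) :
    IsothermalOn (fun y => A (F y) + b) D := by
  refine of_dz H.isOpen ?_ fun x hx => ?_
  · exact (A.contDiff.comp_contDiffOn H.smooth).add contDiffOn_const
  · rw [(H.hasWirt_isometry hx A b).dz_eq]
    refine ⟨by rw [cxMap_dot, H.dot_self hx], fun h0 => H.dot_star_ne_zero hx ?_⟩
    rw [← cxMap_dot A, h0, zero_dotProduct]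

theorem hopf_isometry (H : IsothermalOn F D) (hx : x ∈ D) (A : Space n ≃ₗᵢ[ℝ] Space n)
    (b : Space n) : hopf (fun y => A (F y) + b) x = cxMap A (hopf F x) := by
  have h2 : HasWirt (dz (cxF fun y => A (F y) + b)) _ _ x :=
    ((H.hasWirt_dz hx).comp_clm (cxMap A)).congr_of_eventuallyEq
      (Filter.eventuallyEq_of_mem (H.mem_nhds hx) fun y hy => (H.hasWirt_isometry hy A b).dz_eq)
  rw [hopf, h2.dz_eq, (H.hasWirt_isometry hx A b).dz_eq, hopf, nproj, nproj]
  simp only [← cxMap_star, cxMap_dot, map_sub, map_smul]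

theorem hopfDependent_isometry (H : IsothermalOn F D) (hx : x ∈ D) (A : Space n ≃ₗᵢ[ℝ] Space n)
    (b : Space n) (h : HopfDependent F x) : HopfDependent (fun y => A (F y) + b) x := by
  obtain ⟨s, t, hst, c, d, h⟩ := h
  have h2 : HasWirt (hopf fun y => A (F y) + b) _ _ x :=
    ((hasWirt_of_differentiableAt (H.hasWirt_hopf hx).differentiableAt).comp_clm
      (cxMap A)).congr_of_eventuallyEq
      (Filter.eventuallyEq_of_mem (H.mem_nhds hx) fun y hy => H.hopf_isometry hy A b)
  refine ⟨s, t, hst, c, d, ?_⟩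
  rw [h2.dzbar_eq, H.hopf_isometry hx, (H.hasWirt_isometry hx A b).dz_eq, ← cxMap_star, ← map_smul,
    ← map_smul, ← map_add, h]
  simp

theorem not_hopfDependent_isometry (H : IsothermalOn F D) (hx : x ∈ D) (A : Space n ≃ₗᵢ[ℝ] Space n)
    (b : Space n) (h : ¬ HopfDependent F x) : ¬ HopfDependent (fun y => A (F y) + b) x := by
  intro h'
  apply h
  have h2 := (H.isometry A b).hopfDependent_isometry hx A.symm (-A.symm b) h'
  simpa using h2

/-! #### The Möbius group -/

theorem exists_of_inversion (H : IsothermalOn F D) (hD : D.Nonempty)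
    (h : ∀ x ∈ D, ¬ HopfDependent F x) (c : Space n) {R : ℝ} (hR : 0 < R) :
    ∃ D' ⊆ D, D'.Nonempty ∧ (∀ x ∈ D', F x ≠ c) ∧
      IsothermalOn (fun y => EuclideanGeometry.inversion c R (F y)) D' ∧
      ∀ x ∈ D', ¬ HopfDependent (fun y => EuclideanGeometry.inversion c R (F y)) x := by
  have ho : IsOpen (D ∩ F ⁻¹' {c}ᶜ) :=
    H.smooth.continuousOn.isOpen_inter_preimage H.isOpen isOpen_compl_singleton
  have HD' := H.mono ho Set.inter_subset_left
  refine ⟨D ∩ F ⁻¹' {c}ᶜ, Set.inter_subset_left, ?_, fun x hx => hx.2,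
    HD'.inversion (fun x hx => hx.2) hR, fun x hx =>
      HD'.not_hopfDependent_inversion hx (fun x hx => hx.2) hR (h x hx.1)⟩
  -- Removing the preimage of the centre cannot empty the domain: F would be constant there, against
  -- ∂F ≠ 0.
  by_contra hne
  rw [Set.not_nonempty_iff_eq_empty] at hne
  obtain ⟨x, hx⟩ := hD
  have hF : ∀ y ∈ D, F y = c := by
    intro y hy
    by_contra hyc
    have : y ∈ D ∩ F ⁻¹' {c}ᶜ := ⟨hy, hyc⟩
    rw [hne] at this
    exact this
  have e : cxF F =ᶠ[𝓝 x] fun _ => cx c :=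
    Filter.eventuallyEq_of_mem (H.mem_nhds hx) fun y hy => by rw [cxF, hF y hy]
  exact H.dz_ne_zero hx ((HasWirt.const (cx c)).congr_of_eventuallyEq e).dz_eq

theorem exists_of_isometry (H : IsothermalOn F D) (h : ∀ x ∈ D, ¬ HopfDependent F x)
    (φ : Space n ≃ᵢ Space n) : IsothermalOn (fun y => φ (F y)) D ∧
      ∀ x ∈ D, ¬ HopfDependent (fun y => φ (F y)) x := by
  have e : (fun y => φ (F y)) = fun y => φ.toRealAffineIsometryEquiv.linearIsometryEquiv (F y) + φ 0 := by
    funext y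
    have := φ.toRealAffineIsometryEquiv.map_vadd 0 (F y)
    simpa using this
  rw [e]
  exact ⟨H.isometry _ _, fun x hx => H.not_hopfDependent_isometry hx _ _ (h x hx)⟩

/-- Generators are split off on the right because that factor acts first on the surface. Each
inversion may shrink the domain to avoid points sent to infinity, hence only a nonempty smaller D'
is claimed. -/
theorem exists_of_moebius {T : Equiv.Perm (OnePoint (Space n))} (hT : T ∈ moebiusGroup n) :
    ∀ {F h : Plane → Space n} {D : Set Plane}, IsothermalOn F D → D.Nonempty →
      (∀ x ∈ D, ¬ HopfDependent F x) →
      (∀ x ∈ D, T (F x : OnePoint (Space n)) = (h x : OnePoint (Space n))) →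
      ∃ D' ⊆ D, D'.Nonempty ∧ IsothermalOn h D' ∧ ∀ x ∈ D', ¬ HopfDependent h x := by
  induction hT using Subgroup.closure_induction_right with
  | one =>
    intro F h D H hD hF hT
    have e : Set.EqOn F h D := fun x hx => by simpa using hT x hx
    refine ⟨D, subset_rfl, hD, H.congr e, fun x hx hh => hF x hx (hh.congr ?_)⟩
    exact (Filter.eventuallyEq_of_mem (H.mem_nhds hx) e).symm
  | mul_right S hS σ hσ ih =>
    intro F h D H hD hF hT
    rcases hσ with ⟨c, R, hR, hσ⟩ | ⟨φ, hφ⟩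
    · obtain ⟨D', hD', hne, hc, HY, hY⟩ := H.exists_of_inversion hD hF c hR
      obtain ⟨D'', h1, h2, h3⟩ := ih (h := h) HY hne hY fun x hx => by
        rw [← hT x (hD' hx), Equiv.Perm.mul_apply, hσ]
        simp [sphereInversion, hc x hx]
      exact ⟨D'', h1.trans hD', h2, h3⟩
    · obtain ⟨HY, hY⟩ := H.exists_of_isometry hF φ
      exact ih HY hD hY fun x hx => by
        rw [← hT x hx, Equiv.Perm.mul_apply, hφ]; rfl
  | mul_inv_cancel S hS σ hσ ih =>
    intro F h D H hD hF hT
    rcases hσ with ⟨c, R, hR, hσ⟩ | ⟨φ, hφ⟩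
    · obtain ⟨D', hD', hne, hc, HY, hY⟩ := H.exists_of_inversion hD hF c hR
      obtain ⟨D'', h1, h2, h3⟩ := ih (h := h) HY hne hY fun x hx => by
        rw [← hT x (hD' hx), Equiv.Perm.mul_apply]
        congr 1
        rw [Equiv.Perm.eq_inv_iff_eq, hσ]
        have : EuclideanGeometry.inversion c R (F x) ≠ c := by
          rw [ne_eq, EuclideanGeometry.inversion_eq_center hR.ne']; exact hc x hx
        simp [sphereInversion, this, EuclideanGeometry.inversion_inversion _ hR.ne']
      exact ⟨D'', h1.trans hD', h2, h3⟩
    · obtain ⟨HY, hY⟩ := H.exists_of_isometry hF φ.symm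
      exact ih HY hD hY fun x hx => by
        rw [← hT x hx, Equiv.Perm.mul_apply]
        congr 1
        rw [Equiv.Perm.eq_inv_iff_eq, hφ, OnePoint.map_some, φ.apply_symm_apply]

end IsothermalOn

end Moebius

/-! ### Surfaces whose cubic form vanishes -/

section Cubic

variable {n : ℕ}

namespace IsotropicOn

variable {F : Plane → Space n} {D : Set Plane} {x q : Plane} {ν : Space n}

theorem hasWirt_dot_left {h : Plane → CSpace n} {a b : CSpace n} (H : HasWirt h a b x)
    (u : CSpace n) : HasWirt (fun y => u ⬝ᵥ h y) (u ⬝ᵥ a) (u ⬝ᵥ b) x := by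
  simpa using (HasWirt.const u).dot H

/-- With χ = 0 the frame equations close up: along the segment from `q` to `x` the pair (ν·φ, ν·ψ)
solves a homogeneous linear differential equation with zero initial value, and Grönwall's inequality
makes it vanish. -/
theorem eq_zero_of_cubic_eq_zero (H : IsotropicOn F D) (hD : Convex ℝ D)
    (hc : ∀ x ∈ D, cubic F x = 0) (hq : q ∈ D) (h1 : cx ν ⬝ᵥ dz (cxF F) q = 0)
    (h2 : cx ν ⬝ᵥ hopf F q = 0) (hx : x ∈ D) : cx ν ⬝ᵥ dz (cxF F) x = 0 := by
  set γ : ℝ → Plane := fun t => q + t • (x - q) with hγ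
  have hγD : ∀ t ∈ Set.Icc (0 : ℝ) 1, γ t ∈ D := fun t ht =>
    hD.add_smul_sub_mem hq hx ht
  have hγc : Continuous γ := by fun_prop
  have hγd : ∀ t, HasDerivAt γ (x - q) t := fun t => by
    have := ((hasDerivAt_id t).smul_const (x - q)).const_add q
    simpa [hγ] using this
  have hv : ∀ {g : Plane → ℂ} {a b : ℂ} {t : ℝ}, HasWirt g a b (γ t) →
      HasDerivAt (fun t => g (γ t)) (zeta (x - q) * a + conj (zeta (x - q)) * b) t := by
    intro g a b t hg
    have := HasFDerivAt.comp_hasDerivAt t hg (hγd t)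
    rwa [wirt_apply] at this
  -- A common bound for both rows of the system in the sup norm of ℂ × ℂ; compactness of the segment
  -- turns it into a constant `K`.
  set B : Plane → ℝ := fun y => ‖zeta (x - q)‖ * (1 + ‖coef F y‖ + ‖hopfCoef F y‖ +
    ‖hopfNormSq F y / confFactor F y‖) with hB
  have cB : ContinuousOn B D := by
    have c1 : ContinuousOn (coef F) D := fun y hy =>
      (H.hasWirt_coef hy).differentiableAt.continuousAt.continuousWithinAt
    have c2 : ContinuousOn (hopfNormSq F) D := fun y hy =>
      (H.hasWirt_hopfNormSq hy).differentiableAt.continuousAt.continuousWithinAt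
    have c3 : ContinuousOn (confFactor F) D := fun y hy =>
      (H.hasWirt_confFactor hy).differentiableAt.continuousAt.continuousWithinAt
    have c4 : ContinuousOn (hopfCoef F) D := by
      have k1 := continuousOn_pi.1 (contDiffOn_dz H.isOpen H.smooth_hopf).continuousOn
      have k2 := continuousOn_pi.1 H.smooth_hopf.continuousOn
      refine ContinuousOn.div ?_ c2 fun y hy => H.hopfNormSq_ne_zero hy
      exact continuousOn_finsetSum _ fun j _ => (k1 j).mul (k2 j).star
    exact continuousOn_const.mul (((continuousOn_const.add c1.norm).add c4.norm).add
      (c2.div c3 fun y hy => H.confFactor_ne_zero hy).norm)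
  obtain ⟨K, hK⟩ := isCompact_Icc.exists_bound_of_continuousOn
    (cB.comp hγc.continuousOn (fun t ht => hγD t ht))
  set y : ℝ → ℂ × ℂ := fun t => (cx ν ⬝ᵥ dz (cxF F) (γ t), cx ν ⬝ᵥ hopf F (γ t)) with hy
  have hyd : ∀ t ∈ Set.Icc (0 : ℝ) 1, HasDerivAt y
      (zeta (x - q) * (cx ν ⬝ᵥ hopf F (γ t) + coef F (γ t) * cx ν ⬝ᵥ dz (cxF F) (γ t)),
        zeta (x - q) * (hopfCoef F (γ t) * cx ν ⬝ᵥ hopf F (γ t)) - conj (zeta (x - q)) *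
          (hopfNormSq F (γ t) / confFactor F (γ t) * cx ν ⬝ᵥ dz (cxF F) (γ t))) t := by
    intro t ht
    have d1 := hv (hasWirt_dot_left (H.hasWirt_phi (hγD t ht)) (cx ν))
    have d2 := hv (hasWirt_dot_left (H.hasWirt_psi (hγD t ht)) (cx ν))
    convert d1.prodMk d2 using 1
    simp only [dotProduct_add, dotProduct_smul, hc _ (hγD t ht), dotProduct_zero, smul_eq_mul]
    ext <;> simp <;> ring
  have hbound : ∀ t ∈ Set.Ico (0 : ℝ) 1,
      ‖(zeta (x - q) * (cx ν ⬝ᵥ hopf F (γ t) + coef F (γ t) * cx ν ⬝ᵥ dz (cxF F) (γ t)),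
        zeta (x - q) * (hopfCoef F (γ t) * cx ν ⬝ᵥ hopf F (γ t)) - conj (zeta (x - q)) *
          (hopfNormSq F (γ t) / confFactor F (γ t) * cx ν ⬝ᵥ dz (cxF F) (γ t)))‖ ≤
        K * ‖y t‖ + 0 := by
    intro t ht
    have hk := hK t (Set.Ico_subset_Icc_self ht)
    have n1 : ‖cx ν ⬝ᵥ dz (cxF F) (γ t)‖ ≤ ‖y t‖ := norm_fst_le (y t)
    have n2 : ‖cx ν ⬝ᵥ hopf F (γ t)‖ ≤ ‖y t‖ := norm_snd_le (y t)
    have hBK : B (γ t) ≤ K := (le_abs_self _).trans hk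
    refine le_trans (b := B (γ t) * ‖y t‖) ?_ (by rw [add_zero]; exact mul_le_mul_of_nonneg_right hBK (norm_nonneg _))
    generalize cx ν ⬝ᵥ dz (cxF F) (γ t) = p at n1 ⊢
    generalize cx ν ⬝ᵥ hopf F (γ t) = r at n2 ⊢
    change _ ≤ ‖zeta (x - q)‖ * (1 + ‖coef F (γ t)‖ + ‖hopfCoef F (γ t)‖ +
      ‖hopfNormSq F (γ t) / confFactor F (γ t)‖) * ‖y t‖
    clear hBK hk
    generalize coef F (γ t) = k
    generalize hopfCoef F (γ t) = m
    generalize hopfNormSq F (γ t) / confFactor F (γ t) = s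
    rw [norm_prod_le_iff]
    constructor
    · calc ‖zeta (x - q) * (r + k * p)‖ ≤ ‖zeta (x - q)‖ * (‖r‖ + ‖k‖ * ‖p‖) := by
            rw [norm_mul]; gcongr; exact (norm_add_le _ _).trans (by rw [norm_mul])
        _ ≤ ‖zeta (x - q)‖ * (‖y t‖ + ‖k‖ * ‖y t‖) := by gcongr
        _ ≤ ‖zeta (x - q)‖ * ((1 + ‖k‖ + ‖m‖ + ‖s‖) * ‖y t‖) := by
            gcongr
            nlinarith [norm_nonneg k, norm_nonneg m, norm_nonneg s, norm_nonneg (y t),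
              mul_nonneg (norm_nonneg m) (norm_nonneg (y t)),
              mul_nonneg (norm_nonneg s) (norm_nonneg (y t))]
        _ = _ := by ring
    · calc ‖zeta (x - q) * (m * r) - conj (zeta (x - q)) * (s * p)‖
          ≤ ‖zeta (x - q)‖ * (‖m‖ * ‖r‖) + ‖zeta (x - q)‖ * (‖s‖ * ‖p‖) := by
            refine (norm_sub_le _ _).trans (le_of_eq ?_)
            simp only [norm_mul, RCLike.norm_conj]
        _ ≤ ‖zeta (x - q)‖ * (‖m‖ * ‖y t‖) + ‖zeta (x - q)‖ * (‖s‖ * ‖y t‖) := by gcongr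
        _ ≤ ‖zeta (x - q)‖ * ((1 + ‖k‖ + ‖m‖ + ‖s‖) * ‖y t‖) := by
            rw [← mul_add]
            gcongr
            nlinarith [norm_nonneg k, norm_nonneg m, norm_nonneg s, norm_nonneg (y t),
              mul_nonneg (norm_nonneg k) (norm_nonneg (y t))]
        _ = _ := by ring
  have hγ0 : γ 0 = q := by simp [hγ]
  have hγ1 : γ 1 = x := by simp [hγ]
  have := norm_le_gronwallBound_of_norm_deriv_right_le (f := y) (δ := 0) (ε := 0) (K := K)
    (fun t ht => (hyd t ht).continuousAt.continuousWithinAt)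
    (fun t ht => (hyd t (Set.Ico_subset_Icc_self ht)).hasDerivWithinAt)
    (by simp [hy, hγ0, h1, h2]) hbound 1 (by simp)
  rw [gronwallBound_ε0_δ0] at this
  have h0 : y 1 = 0 := norm_le_zero_iff.1 this
  have := congrArg Prod.fst h0
  simpa [hy, hγ1] using this

/-- If the cubic form vanishes, a vector orthogonal to the first osculating space at one point is
orthogonal to the surface. -/
theorem inner_const_of_cubic_eq_zero (H : IsotropicOn F D) (hD : Convex ℝ D)
    (hc : ∀ x ∈ D, cubic F x = 0) (hq : q ∈ D) (h1 : cx ν ⬝ᵥ dz (cxF F) q = 0)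
    (h2 : cx ν ⬝ᵥ hopf F q = 0) (hx : x ∈ D) : ⟪ν, F x⟫_ℝ = ⟪ν, F q⟫_ℝ := by
  refine H.isOpen.is_const_of_fderiv_eq_zero (𝕜 := ℝ) (f := fun y => ⟪ν, F y⟫_ℝ)
    hD.isPreconnected ?_ ?_ hx hq
  · intro y hy
    exact ((differentiableAt_const ν).inner ℝ (H.differentiableAt hy)).differentiableWithinAt
  · intro y hy
    ext v
    rw [fderiv_inner_apply ℝ (differentiableAt_const ν) (H.differentiableAt hy)]
    have h0 := H.eq_zero_of_cubic_eq_zero hD hc hq h1 h2 hy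
    have : ((⟪ν, fderiv ℝ F y v⟫_ℝ : ℝ) : ℂ) = 0 := by
      rw [← cx_dot, cx_fderiv (H.differentiableAt hy), dotProduct_add, ← star_cx, ← star_dot,
        star_cx, dotProduct_smul, h0, smul_zero, star_zero, add_zero]
    have h3 : ⟪ν, fderiv ℝ F y v⟫_ℝ = 0 := by exact_mod_cast this
    simp [h3]

/-- A converse to `inner_const_of_cubic_eq_zero`, got by differentiating twice. It recovers the
initial conditions at a new base point during continuation. -/
theorem dot_eq_zero_of_inner_const (H : IsotropicOn F D) (hq : q ∈ D) {r : ℝ}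
    (h : ∀ᶠ y in 𝓝 q, ⟪ν, F y⟫_ℝ = r) :
    cx ν ⬝ᵥ dz (cxF F) q = 0 ∧ cx ν ⬝ᵥ hopf F q = 0 := by
  have e0 : ∀ᶠ y in 𝓝 q, cx ν ⬝ᵥ dz (cxF F) y = 0 := by
    filter_upwards [h.eventually_nhds, H.mem_nhds hq] with y hy hyD
    have e : (fun z => cx ν ⬝ᵥ cxF F z) =ᶠ[𝓝 y] fun _ => (r : ℂ) := by
      filter_upwards [hy] with z hz
      rw [cxF, cx_dot, hz]
    exact (hasWirt_dot_left (H.hasWirt hyD) (cx ν)).unique_left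
      ((HasWirt.const _).congr_of_eventuallyEq e)
  refine ⟨e0.self_of_nhds, ?_⟩
  have := (hasWirt_dot_left (H.hasWirt_phi hq) (cx ν)).unique_left
    ((HasWirt.const (0 : ℂ)).congr_of_eventuallyEq e0)
  rwa [dotProduct_add, dotProduct_smul, e0.self_of_nhds, smul_zero, add_zero] at this

end IsotropicOn

/-- Two complex equations are four real ones. The ambient dimension enters the whole argument only
here. -/
theorem exists_orthogonal (hn : 5 ≤ n) (u w : CSpace n) :
    ∃ ν : Space n, ν ≠ 0 ∧ cx ν ⬝ᵥ u = 0 ∧ cx ν ⬝ᵥ w = 0 := by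
  let L : Space n →ₗ[ℝ] ℂ × ℂ :=
    { toFun := fun ν => (cx ν ⬝ᵥ u, cx ν ⬝ᵥ w)
      map_add' := fun a b => by simp [add_dotProduct]
      map_smul' := fun r a => by simp [smul_dotProduct] }
  have : LinearMap.ker L ≠ ⊥ := LinearMap.ker_ne_bot_of_finrank_lt (by
    rw [Module.finrank_prod, Complex.finrank_real_complex, finrank_euclideanSpace_fin]; omega)
  obtain ⟨ν, hν, h0⟩ := (Submodule.ne_bot_iff _).1 this
  exact ⟨ν, h0, congrArg Prod.fst hν, congrArg Prod.snd hν⟩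

end Cubic

/-! ### Existence of isothermal coordinates on minimal surfaces -/

section Existence

variable {n : ℕ} {F : Plane → Space n} {D : Set Plane} {x : Plane}

/-- The first coefficient `|∂₁F|²` of the metric. -/
def metE (F : Plane → Space n) (x : Plane) : ℝ := ⟪fderiv ℝ F x e₁, fderiv ℝ F x e₁⟫_ℝ

/-- The mixed coefficient `⟨∂₁F, ∂₂F⟩` of the metric. -/
def metF (F : Plane → Space n) (x : Plane) : ℝ := ⟪fderiv ℝ F x e₁, fderiv ℝ F x e₂⟫_ℝ

/-- The last coefficient `|∂₂F|²` of the metric. -/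
def metG (F : Plane → Space n) (x : Plane) : ℝ := ⟪fderiv ℝ F x e₂, fderiv ℝ F x e₂⟫_ℝ

/-- The determinant of the metric. -/
def metDet (F : Plane → Space n) (x : Plane) : ℝ := metE F x * metG F x - metF F x ^ 2

/-- The derivative in the direction `v` of the coordinate function `⟨F, c⟩`. -/
def coordDeriv (F : Plane → Space n) (c : Space n) (v : Plane) (x : Plane) : ℝ :=
  ⟪fderiv ℝ F x v, c⟫_ℝ

theorem metE_pos (h : Function.Injective (fderiv ℝ F x)) : 0 < metE F x := by
  rw [metE, real_inner_self_pos]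
  intro h0
  have := congrArg (fun v : Plane => v 0) (h (h0.trans (map_zero _).symm))
  simp [e₁] at this

theorem metDet_pos (h : Function.Injective (fderiv ℝ F x)) : 0 < metDet F x := by
  have hE := metE_pos h
  have hv : metE F x • e₂ - metF F x • e₁ ≠ 0 := by
    intro h0
    have := congrArg (fun v : Plane => v 1) h0
    simp [e₁, e₂, hE.ne'] at this
  have h1 : fderiv ℝ F x (metE F x • e₂ - metF F x • e₁) ≠ 0 := fun h0 =>
    hv (h (h0.trans (map_zero _).symm))
  have h2 := real_inner_self_pos.2 h1
  have h3 : ⟪fderiv ℝ F x (metE F x • e₂ - metF F x • e₁),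
      fderiv ℝ F x (metE F x • e₂ - metF F x • e₁)⟫_ℝ = metE F x * metDet F x := by
    simp only [map_sub, map_smul, inner_sub_left, inner_sub_right, inner_smul_left,
      inner_smul_right, metDet, real_inner_comm (fderiv ℝ F x e₁) (fderiv ℝ F x e₂)]
    simp only [conj_trivial, metE, metF, metG]
    ring
  rw [h3] at h2
  exact pos_of_mul_pos_right h2 hE.le

theorem inner_fderiv (F : Plane → Space n) (x a b : Plane) :
    ⟪fderiv ℝ F x a, fderiv ℝ F x b⟫_ℝ = a 0 * b 0 * metE F x + (a 0 * b 1 + a 1 * b 0) * metF F x +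
      a 1 * b 1 * metG F x := by
  conv_lhs => rw [plane_eq a, plane_eq b]
  simp only [map_add, map_smul, inner_add_left, inner_add_right, inner_smul_left,
      inner_smul_right, real_inner_comm (fderiv ℝ F x e₁) (fderiv ℝ F x e₂), metE, metF, metG]
  simp
  ring

theorem secondFF_eq_fderiv_fderiv (hD : IsOpen D) (hF : ContDiffOn ℝ ∞ F D) (hx : x ∈ D)
    (v w : Plane) : secondFF F v w x = normalPart F x (fderiv ℝ (fderiv ℝ F) x v w) := by
  rw [secondFF, fderiv_fderiv_apply hD hF hx]

/-- The left side is the trace of the second derivative for the metric, multiplied by EG - F²; its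
normal part is a multiple of the mean curvature vector. -/
theorem exists_tangent_of_minimal (hD : IsOpen D) (hF : ContDiffOn ℝ ∞ F D) (hx : x ∈ D)
    (hi : Function.Injective (fderiv ℝ F x)) (hm : MeanCurvatureVanishes F x) :
    ∃ p q : ℝ, metG F x • fderiv ℝ (fun y => fderiv ℝ F y e₁) x e₁ -
      (2 * metF F x) • fderiv ℝ (fun y => fderiv ℝ F y e₂) x e₁ +
      metE F x • fderiv ℝ (fun y => fderiv ℝ F y e₂) x e₂ =
      p • fderiv ℝ F x e₁ + q • fderiv ℝ F x e₂ := by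
  have hE := metE_pos hi
  have hΔ := metDet_pos hi
  have hd := secondFF_eq_fderiv_fderiv hD hF hx
  have hsymm := fderiv_fderiv_comm hD hF hx e₁ e₂
  rw [fderiv_fderiv_apply hD hF hx, fderiv_fderiv_apply hD hF hx] at hsymm
  simp only [fderiv_fderiv_apply hD hF hx]
  set B := fderiv ℝ (fderiv ℝ F) x with hB
  set a : ℝ := √(metE F x) with ha
  set d : ℝ := √(metE F x * metDet F x) with hdd
  have ha2 : a ^ 2 = metE F x := Real.sq_sqrt hE.le
  have hd2 : d ^ 2 = metE F x * metDet F x := Real.sq_sqrt (by positivity)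
  have ha0 : a ≠ 0 := (Real.sqrt_pos.2 hE).ne'
  have hd0 : d ≠ 0 := (Real.sqrt_pos.2 (mul_pos hE hΔ)).ne'
  have unit : ∀ v : Plane, ‖fderiv ℝ F x v‖ = 1 ↔ v 0 * v 0 * metE F x +
      (v 0 * v 1 + v 1 * v 0) * metF F x + v 1 * v 1 * metG F x = 1 := by
    intro v
    rw [← inner_fderiv, real_inner_self_eq_norm_sq, ← sq_eq_sq₀ (norm_nonneg _) zero_le_one, one_pow]
  -- The Gram–Schmidt frame of the coordinate fields: the second vector has squared length E(EG -
  -- F²) before normalization.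
  have h1 := hm (a⁻¹ • e₁) (d⁻¹ • (metE F x • e₂ - metF F x • e₁))
    ((unit _).2 (by simp [e₁]; field_simp; rw [ha2]))
    ((unit _).2 (by
      simp [e₁, e₂]; field_simp; rw [hd2, metDet]; ring))
    (by rw [inner_fderiv]; simp [e₁, e₂]; field_simp; ring)
  rw [hd, hd] at h1
  simp only [map_smul, map_sub, sub_apply, smul_apply,
    hsymm] at h1
  have h2 : normalPart F x (metG F x • B e₁ e₁ - (2 * metF F x) • B e₁ e₂ +
      metE F x • B e₂ e₂) = 0 := by
    have e1 : a⁻¹ * a⁻¹ = (metE F x)⁻¹ := by rw [← ha2]; field_simp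
    have e2 : d⁻¹ * d⁻¹ = (metE F x * metDet F x)⁻¹ := by rw [← hd2]; field_simp
    have hΔ' := hΔ.ne'
    have hdet : metDet F x = metE F x * metG F x - metF F x ^ 2 := rfl
    simp only [normalPart, map_add, map_sub, map_smul] at h1 ⊢
    generalize (tangentPlane F x)ᗮ.starProjection (B e₁ e₁) = u₁ at h1 ⊢
    generalize (tangentPlane F x)ᗮ.starProjection (B e₁ e₂) = u₂ at h1 ⊢
    generalize (tangentPlane F x)ᗮ.starProjection (B e₂ e₂) = u₃ at h1 ⊢
    have h3 : metG F x • u₁ - (2 * metF F x) • u₂ + metE F x • u₃ =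
        metDet F x • ((a⁻¹ * a⁻¹) • u₁ + (d⁻¹ * d⁻¹) • (metE F x • (metE F x • u₃ - metF F x • u₂) -
          metF F x • (metE F x • u₂ - metF F x • u₁))) := by
      rw [e1, e2]
      match_scalars <;> field_simp
      · linear_combination -hdet
      · ring
    rw [h3]
    have h5 : (a⁻¹ * a⁻¹) • u₁ + (d⁻¹ * d⁻¹) • (metE F x • (metE F x • u₃ - metF F x • u₂) -
          metF F x • (metE F x • u₂ - metF F x • u₁)) = 0 := by
      rw [← h1]; module
    rw [h5, smul_zero]
  have h4 : metG F x • B e₁ e₁ - (2 * metF F x) • B e₁ e₂ + metE F x • B e₂ e₂ ∈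
      tangentPlane F x := by
    rw [normalPart, Submodule.starProjection_apply_eq_zero_iff] at h2
    simpa using h2
  obtain ⟨v, hv⟩ := h4
  refine ⟨v 0, v 1, ?_⟩
  rw [← hv]
  conv_lhs => rw [plane_eq v]
  simp

theorem contDiffOn_met (hD : IsOpen D) (hF : ContDiffOn ℝ ∞ F D) :
    ContDiffOn ℝ ∞ (metE F) D ∧ ContDiffOn ℝ ∞ (metF F) D ∧ ContDiffOn ℝ ∞ (metG F) D ∧
      ContDiffOn ℝ ∞ (metDet F) D ∧ ∀ c v, ContDiffOn ℝ ∞ (coordDeriv F c v) D := by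
  have h1 := contDiffOn_fderiv_apply hD hF e₁
  have h2 := contDiffOn_fderiv_apply hD hF e₂
  have hE : ContDiffOn ℝ ∞ (metE F) D := h1.inner ℝ h1
  have hFm : ContDiffOn ℝ ∞ (metF F) D := h1.inner ℝ h2
  have hG : ContDiffOn ℝ ∞ (metG F) D := h2.inner ℝ h2
  exact ⟨hE, hFm, hG, (hE.mul hG).sub (hFm.pow 2), fun c v =>
    (contDiffOn_fderiv_apply hD hF v).inner ℝ contDiffOn_const⟩

/-- The first coefficient of the differential of `⟨F, c⟩`, composed with the rotation by a right
angle. -/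
def conjFst (F : Plane → Space n) (c : Space n) (x : Plane) : ℝ :=
  (metE F x * coordDeriv F c e₂ x - metF F x * coordDeriv F c e₁ x) / √(metDet F x)

/-- The second coefficient of the differential of `⟨F, c⟩`, composed with the rotation by a right
angle. -/
def conjSnd (F : Plane → Space n) (c : Space n) (x : Plane) : ℝ :=
  (metF F x * coordDeriv F c e₂ x - metG F x * coordDeriv F c e₁ x) / √(metDet F x)

theorem contDiffOn_conj (hD : IsOpen D) (hF : ContDiffOn ℝ ∞ F D)
    (hi : ∀ x ∈ D, Function.Injective (fderiv ℝ F x)) (c : Space n) :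
    ContDiffOn ℝ ∞ (conjFst F c) D ∧ ContDiffOn ℝ ∞ (conjSnd F c) D := by
  obtain ⟨hE, hFm, hG, hΔ, hu⟩ := contDiffOn_met hD hF
  have hs : ContDiffOn ℝ ∞ (fun x => √(metDet F x)) D := hΔ.sqrt fun x hx => (metDet_pos (hi x hx)).ne'
  have hs0 : ∀ x ∈ D, √(metDet F x) ≠ 0 := fun x hx => (Real.sqrt_pos.2 (metDet_pos (hi x hx))).ne'
  exact ⟨((hE.mul (hu c e₂)).sub (hFm.mul (hu c e₁))).div hs hs0,
    ((hFm.mul (hu c e₂)).sub (hG.mul (hu c e₁))).div hs hs0⟩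

theorem hasLineDerivAt_conj (hD : IsOpen D) (hF : ContDiffOn ℝ ∞ F D) (hx : x ∈ D)
    (hi : Function.Injective (fderiv ℝ F x)) (c : Space n) (v : Plane) :
    let a := fderiv ℝ (fun y => fderiv ℝ F y e₁) x v
    let b := fderiv ℝ (fun y => fderiv ℝ F y e₂) x v
    let dE := 2 * ⟪a, fderiv ℝ F x e₁⟫_ℝ
    let dF := ⟪a, fderiv ℝ F x e₂⟫_ℝ + ⟪b, fderiv ℝ F x e₁⟫_ℝ
    let dG := 2 * ⟪b, fderiv ℝ F x e₂⟫_ℝ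
    let dΔ := dE * metG F x + metE F x * dG - 2 * metF F x * dF
    HasLineDerivAt ℝ (conjFst F c) (((dE * coordDeriv F c e₂ x + metE F x * ⟪b, c⟫_ℝ -
      (dF * coordDeriv F c e₁ x + metF F x * ⟪a, c⟫_ℝ)) * √(metDet F x) -
      (metE F x * coordDeriv F c e₂ x - metF F x * coordDeriv F c e₁ x) *
        (dΔ / (2 * √(metDet F x)))) / √(metDet F x) ^ 2) x v ∧
    HasLineDerivAt ℝ (conjSnd F c) (((dF * coordDeriv F c e₂ x + metF F x * ⟪b, c⟫_ℝ -
      (dG * coordDeriv F c e₁ x + metG F x * ⟪a, c⟫_ℝ)) * √(metDet F x) -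
      (metF F x * coordDeriv F c e₂ x - metG F x * coordDeriv F c e₁ x) *
        (dΔ / (2 * √(metDet F x)))) / √(metDet F x) ^ 2) x v := by
  intro a b dE dF dG dΔ
  have hd (w : Plane) : HasDerivAt (fun t : ℝ => fderiv ℝ F (x + t • v) w)
      (fderiv ℝ (fun y => fderiv ℝ F y w) x v) 0 :=
    (((contDiffOn_fderiv_apply hD hF w).contDiffAt (hD.mem_nhds hx)).differentiableAt
      (by simp)).hasFDerivAt.hasLineDerivAt v
  have hx0 : x + (0 : ℝ) • v = x := by simp
  have hE : HasDerivAt (fun t : ℝ => metE F (x + t • v)) dE 0 := by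
    have := (hd e₁).inner ℝ (hd e₁)
    rw [hx0, real_inner_comm, ← two_mul] at this
    exact this
  have hFm : HasDerivAt (fun t : ℝ => metF F (x + t • v)) dF 0 := by
    have := (hd e₁).inner ℝ (hd e₂)
    rw [hx0, real_inner_comm, add_comm] at this
    exact this
  have hG : HasDerivAt (fun t : ℝ => metG F (x + t • v)) dG 0 := by
    have := (hd e₂).inner ℝ (hd e₂)
    rw [hx0, real_inner_comm, ← two_mul] at this
    exact this
  have hu (w : Plane) : HasDerivAt (fun t : ℝ => coordDeriv F c w (x + t • v))
      ⟪fderiv ℝ (fun y => fderiv ℝ F y w) x v, c⟫_ℝ 0 := by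
    have := (hd w).inner ℝ (hasDerivAt_const (0 : ℝ) c)
    rw [inner_zero_right, zero_add] at this
    exact this
  have hΔ : HasDerivAt (fun t : ℝ => metDet F (x + t • v)) dΔ 0 := by
    have := (hE.mul hG).sub (hFm.pow 2)
    refine this.congr_deriv ?_
    simp only [hx0, dΔ]
    ring
  have hpos := metDet_pos hi
  have hs := hΔ.sqrt (by rw [hx0]; exact hpos.ne')
  have hs0 : √(metDet F (x + (0 : ℝ) • v)) ≠ 0 := by
    rw [hx0]; exact (Real.sqrt_pos.2 hpos).ne'
  have k1 := ((hE.mul (hu e₂)).sub (hFm.mul (hu e₁))).div hs hs0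
  have k2 := ((hFm.mul (hu e₂)).sub (hG.mul (hu e₁))).div hs hs0
  constructor
  · refine HasDerivAt.congr_deriv k1 ?_
    simp only [hx0, Pi.mul_apply, Pi.sub_apply]; rfl
  · refine HasDerivAt.congr_deriv k2 ?_
    simp only [hx0, Pi.mul_apply, Pi.sub_apply]; rfl

/-- Coordinate functions of a minimal surface are harmonic, which is the closedness of the rotated
differential of ⟨F, c⟩. -/
theorem conj_closed (hD : IsOpen D) (hF : ContDiffOn ℝ ∞ F D)
    (hi : ∀ x ∈ D, Function.Injective (fderiv ℝ F x))
    (hx : x ∈ D) (hm : MeanCurvatureVanishes F x) (c : Space n) :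
    fderiv ℝ (conjFst F c) x e₂ = fderiv ℝ (conjSnd F c) x e₁ := by
  obtain ⟨s1, s2⟩ := contDiffOn_conj hD hF hi c
  have d1 := ((s1.contDiffAt (hD.mem_nhds hx)).differentiableAt (by simp)).hasFDerivAt.hasLineDerivAt e₂
  have d2 := ((s2.contDiffAt (hD.mem_nhds hx)).differentiableAt (by simp)).hasFDerivAt.hasLineDerivAt e₁
  rw [HasLineDerivAt.unique d1 (hasLineDerivAt_conj hD hF hx (hi x hx) c e₂).1,
    HasLineDerivAt.unique d2 (hasLineDerivAt_conj hD hF hx (hi x hx) c e₁).2,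
    fderiv_fderiv_comm hD hF hx e₁ e₂]
  obtain ⟨p, q, hpq⟩ := exists_tangent_of_minimal hD hF hx (hi x hx) hm
  have k0 := congrArg (fun u => ⟪u, c⟫_ℝ) hpq
  have k1 := congrArg (fun u => ⟪u, fderiv ℝ F x e₁⟫_ℝ) hpq
  have k2 := congrArg (fun u => ⟪u, fderiv ℝ F x e₂⟫_ℝ) hpq
  simp only [inner_add_left, inner_sub_left, inner_smul_left, conj_trivial,
    real_inner_comm (fderiv ℝ F x e₁) (fderiv ℝ F x e₂)] at k0 k1 k2
  have hpos := metDet_pos (hi x hx)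
  have hw : √(metDet F x) ^ 2 = metDet F x := Real.sq_sqrt hpos.le
  have hw0 : √(metDet F x) ≠ 0 := (Real.sqrt_pos.2 hpos).ne'
  have hdet : metDet F x = metE F x * metG F x - metF F x ^ 2 := rfl
  have eE : ⟪fderiv ℝ F x e₁, fderiv ℝ F x e₁⟫_ℝ = metE F x := rfl
  have eF : ⟪fderiv ℝ F x e₁, fderiv ℝ F x e₂⟫_ℝ = metF F x := rfl
  have eG : ⟪fderiv ℝ F x e₂, fderiv ℝ F x e₂⟫_ℝ = metG F x := rfl
  have u1 : ⟪fderiv ℝ F x e₁, c⟫_ℝ = coordDeriv F c e₁ x := rfl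
  have u2 : ⟪fderiv ℝ F x e₂, c⟫_ℝ = coordDeriv F c e₂ x := rfl
  rw [eE, eF] at k1
  rw [eF, eG] at k2
  rw [u1, u2] at k0
  generalize √(metDet F x) = w at *
  generalize metDet F x = Δ at *
  subst hdet
  generalize metE F x = E at *
  generalize metF F x = Fm at *
  generalize metG F x = G at *
  generalize coordDeriv F c e₁ x = u₁ at *
  generalize coordDeriv F c e₂ x = u₂ at *
  generalize fderiv ℝ (fun y => fderiv ℝ F y e₁) x e₁ = f₁₁ at *
  generalize fderiv ℝ (fun y => fderiv ℝ F y e₂) x e₁ = f₁₂ at *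
  generalize fderiv ℝ (fun y => fderiv ℝ F y e₂) x e₂ = f₂₂ at *
  congr 1
  field_simp
  rw [hw]
  -- The multipliers are those of Cramer's rule, chosen so that the unknown tangential coefficients
  -- p and q drop out.
  linear_combination (E * G - Fm ^ 2) * k0 - (u₁ * G - u₂ * Fm) * k1 - (u₂ * E - u₁ * Fm) * k2

theorem exists_conjugate (hD : IsOpen D) (hc : Convex ℝ D) (hF : ContDiffOn ℝ ∞ F D)
    (hi : ∀ x ∈ D, Function.Injective (fderiv ℝ F x)) (hm : ∀ x ∈ D, MeanCurvatureVanishes F x)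
    (c : Space n) : ∃ v : Plane → ℝ, ContDiffOn ℝ ∞ v D ∧
      ∀ x ∈ D, ∀ w : Plane, fderiv ℝ v x w = w 0 * conjFst F c x + w 1 * conjSnd F c x := by
  obtain ⟨s1, s2⟩ := contDiffOn_conj hD hF hi c
  set η : Plane → Plane →L[ℝ] ℝ := fun x =>
    conjFst F c x • (EuclideanSpace.proj (0 : Fin 2) : Plane →L[ℝ] ℝ) +
      conjSnd F c x • (EuclideanSpace.proj (1 : Fin 2) : Plane →L[ℝ] ℝ) with hη
  have sη : ContDiffOn ℝ ∞ η D := (s1.smul contDiffOn_const).add (s2.smul contDiffOn_const)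
  have dη : ∀ x ∈ D, ∀ a b, fderiv ℝ η x a b =
      fderiv ℝ (conjFst F c) x a * b 0 + fderiv ℝ (conjSnd F c) x a * b 1 := by
    intro x hx a b
    have d1 := ((s1.contDiffAt (hD.mem_nhds hx)).differentiableAt (by simp)).hasFDerivAt
    have d2 := ((s2.contDiffAt (hD.mem_nhds hx)).differentiableAt (by simp)).hasFDerivAt
    have := (d1.smul_const (EuclideanSpace.proj (0 : Fin 2) : Plane →L[ℝ] ℝ)).add
      (d2.smul_const (EuclideanSpace.proj (1 : Fin 2) : Plane →L[ℝ] ℝ))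
    have h2 : fderiv ℝ η x = _ := this.fderiv
    rw [h2]; simp
  obtain ⟨v, hv⟩ := hc.exists_forall_hasFDerivAt_of_fderiv_symmetric hD
    (sη.differentiableOn (by simp)) (fun x hx a b => by
      have := conj_closed hD hF hi hx (hm x hx) c
      rw [dη x hx, dη x hx]
      conv_lhs => rw [plane_eq a]
      conv_rhs => rw [plane_eq b]
      simp only [map_add, map_smul, smul_eq_mul]
      linear_combination (a 1 * b 0 - a 0 * b 1) * this)
  refine ⟨v, ?_, fun x hx w => ?_⟩
  · rw [contDiffOn_infty_iff_fderiv_of_isOpen hD]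
    exact ⟨fun x hx => (hv x hx).differentiableAt.differentiableWithinAt,
      sη.congr fun x hx => (hv x hx).fderiv⟩
  · rw [(hv x hx).fderiv]
    simp [hη]; ring

/-- A harmonic function u = ⟨F, c⟩ and its conjugate v satisfy du² + dv² = |∇u|² times the metric,
so they are isothermal coordinates wherever du ≠ 0. -/
theorem exists_isothermal (hD : IsOpen D) (hF : ContDiffOn ℝ ∞ F D)
    (hi : ∀ x ∈ D, Function.Injective (fderiv ℝ F x)) (hm : ∀ x ∈ D, MeanCurvatureVanishes F x)
    (hx : x ∈ D) : ∃ τ : OpenPartialHomeomorph Plane Plane, x ∈ τ.source ∧ τ.source ⊆ D ∧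
      ContDiffOn ℝ ∞ τ τ.source ∧ ContDiffOn ℝ ∞ τ.symm τ.target ∧
      ∀ y ∈ τ.target, IsIsothermalAt (F ∘ τ.symm) y := by
  obtain ⟨ε, hε, hball⟩ := Metric.isOpen_iff.1 hD x hx
  -- This direction makes the first partial derivative of u at `x` equal to |∂₁F|² > 0.
  set c := fderiv ℝ F x e₁ with hc
  obtain ⟨v, sv, dv⟩ := exists_conjugate Metric.isOpen_ball (convex_ball x ε) (hF.mono hball)
    (fun y hy => hi y (hball hy)) (fun y hy => hm y (hball hy)) c
  set u : Plane → ℝ := fun y => ⟪F y, c⟫_ℝ with hu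
  have su : ContDiffOn ℝ ∞ u D := hF.inner ℝ contDiffOn_const
  have hdF : ∀ y ∈ D, DifferentiableAt ℝ F y := fun y hy =>
    (hF.contDiffAt (hD.mem_nhds hy)).differentiableAt (by simp)
  have du : ∀ y ∈ D, ∀ w : Plane, fderiv ℝ u y w = w 0 * coordDeriv F c e₁ y + w 1 * coordDeriv F c e₂ y := by
    intro y hy w
    rw [fderiv_inner_apply ℝ (hdF y hy) (differentiableAt_const c)]
    conv_lhs => rw [plane_eq w]
    simp [inner_add_left, inner_smul_left, coordDeriv]
  set s : Set Plane := Metric.ball x ε ∩ {y | coordDeriv F c e₁ y ≠ 0} with hs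
  have so : IsOpen s := by
    have : ContinuousOn (coordDeriv F c e₁) (Metric.ball x ε) :=
      (((contDiffOn_met hD hF).2.2.2.2 c e₁).mono hball).continuousOn
    exact this.isOpen_inter_preimage Metric.isOpen_ball isOpen_ne
  have hxs : x ∈ s := ⟨Metric.mem_ball_self hε, (metE_pos (hi x hx)).ne'⟩
  have hsD : s ⊆ D := fun y hy => hball hy.1
  set T : Plane → Plane := fun y => !₂[u y, v y] with hT
  have sT : ContDiffOn ℝ ∞ T s := by
    rw [contDiffOn_euclidean]
    intro i
    fin_cases i
    · exact su.mono hsD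
    · exact sv.mono fun y hy => hy.1
  have dT : ∀ y ∈ s, HasFDerivAt T (fderiv ℝ T y) y := fun y hy =>
    ((sT.contDiffAt (so.mem_nhds hy)).differentiableAt (by simp)).hasFDerivAt
  have cT : ∀ y ∈ s, ∀ w, fderiv ℝ T y w 0 = fderiv ℝ u y w ∧ fderiv ℝ T y w 1 = fderiv ℝ v y w := by
    intro y hy w
    have h0 (i : Fin 2) : HasFDerivAt (fun z => T z i)
        ((EuclideanSpace.proj i : Plane →L[ℝ] ℝ).comp (fderiv ℝ T y)) y :=
      (EuclideanSpace.proj i : Plane →L[ℝ] ℝ).hasFDerivAt.comp y (dT y hy)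
    have e0 : (fun z => T z 0) = u := by funext z; simp [hT]
    have e1 : (fun z => T z 1) = v := by funext z; simp [hT]
    have h1 := (h0 0).fderiv
    have h2 := (h0 1).fderiv
    rw [e0] at h1
    rw [e1] at h2
    rw [h1, h2]
    exact ⟨rfl, rfl⟩
  -- The factor m is |∇u|² for the induced metric; completing the square shows it positive.
  have metric : ∀ y ∈ s, ∃ m : ℝ, 0 < m ∧ ∀ a b, ⟪fderiv ℝ T y a, fderiv ℝ T y b⟫_ℝ =
      m * ⟪fderiv ℝ F y a, fderiv ℝ F y b⟫_ℝ := by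
    intro y hy
    have hE := metE_pos (hi y (hsD hy))
    have hΔ := metDet_pos (hi y (hsD hy))
    have hw0 : √(metDet F y) ≠ 0 := (Real.sqrt_pos.2 hΔ).ne'
    have hw : √(metDet F y) ^ 2 = metDet F y := Real.sq_sqrt hΔ.le
    have hu1 : coordDeriv F c e₁ y ≠ 0 := hy.2
    refine ⟨(metG F y * coordDeriv F c e₁ y ^ 2 - 2 * metF F y * coordDeriv F c e₁ y *
      coordDeriv F c e₂ y + metE F y * coordDeriv F c e₂ y ^ 2) / metDet F y, ?_, fun a b => ?_⟩
    · refine div_pos ?_ hΔ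
      have h1 : 0 < metE F y * (metG F y * coordDeriv F c e₁ y ^ 2 - 2 * metF F y *
          coordDeriv F c e₁ y * coordDeriv F c e₂ y + metE F y * coordDeriv F c e₂ y ^ 2) := by
        have h2 : 0 < metDet F y * coordDeriv F c e₁ y ^ 2 := by positivity
        have h3 := sq_nonneg (metE F y * coordDeriv F c e₂ y - metF F y * coordDeriv F c e₁ y)
        rw [metDet] at h2
        linarith
      exact pos_of_mul_pos_right h1 hE.le
    · have ei : ⟪fderiv ℝ T y a, fderiv ℝ T y b⟫_ℝ = fderiv ℝ u y a * fderiv ℝ u y b +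
          fderiv ℝ v y a * fderiv ℝ v y b := by
        rw [PiLp.inner_apply, Fin.sum_univ_two, (cT y hy a).1, (cT y hy a).2, (cT y hy b).1,
          (cT y hy b).2]
        simp [mul_comm]
      rw [ei, du y (hsD hy), du y (hsD hy), dv y hy.1, dv y hy.1, inner_fderiv F, conjFst, conjSnd]
      have hdet : metDet F y = metE F y * metG F y - metF F y ^ 2 := rfl
      have hΔ' := hΔ.ne'
      generalize √(metDet F y) = w at *
      generalize metDet F y = Δ at *
      field_simp
      rw [hw]
      subst hdet
      ring
  have injT : ∀ y ∈ s, Function.Injective (fderiv ℝ T y) := by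
    intro y hy
    obtain ⟨m, hm0, hm⟩ := metric y hy
    rw [injective_iff_map_eq_zero]
    intro w hw
    have := hm w w
    rw [hw, inner_zero_left, eq_comm, mul_eq_zero, inner_self_eq_zero] at this
    have h0 := this.resolve_left hm0.ne'
    exact hi y (hsD hy) (h0.trans (map_zero _).symm)
  have eqv : ∀ y ∈ s, ∃ L : Plane ≃L[ℝ] Plane, (L : Plane →L[ℝ] Plane) = fderiv ℝ T y := fun y hy =>
    ⟨(LinearEquiv.ofInjectiveEndo (fderiv ℝ T y : Plane →ₗ[ℝ] Plane) (injT y hy)).toContinuousLinearEquiv,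
      by ext1 w; rfl⟩
  obtain ⟨L, hL⟩ := eqv x hxs
  have strict : HasStrictFDerivAt T (L : Plane →L[ℝ] Plane) x := by
    rw [hL]
    exact (sT.contDiffAt (so.mem_nhds hxs)).hasStrictFDerivAt (by simp)
  -- The inverse function theorem gives a local inverse near `x`. Restricting to `s`, where dT is
  -- invertible throughout, makes that inverse smooth on the whole target.
  set τ := (strict.toOpenPartialHomeomorph T).restrOpen s so with hτ
  have hsrc : τ.source ⊆ s := by
    rw [hτ, OpenPartialHomeomorph.restrOpen_source]; exact Set.inter_subset_right
  have hcoe : (τ : Plane → Plane) = T := rfl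
  have hsymm : ∀ y ∈ τ.target, ∃ L : Plane ≃L[ℝ] Plane,
      (L : Plane →L[ℝ] Plane) = fderiv ℝ T (τ.symm y) ∧
      HasFDerivAt τ (L : Plane →L[ℝ] Plane) (τ.symm y) := by
    intro y hy
    have hy' := hsrc (τ.map_target hy)
    obtain ⟨L, hL⟩ := eqv _ hy'
    exact ⟨L, hL, by rw [hL, hcoe]; exact dT _ hy'⟩
  refine ⟨τ, ?_, hsrc.trans hsD, sT.mono hsrc, ?_, ?_⟩
  · rw [hτ, OpenPartialHomeomorph.restrOpen_source]
    exact ⟨strict.mem_toOpenPartialHomeomorph_source, hxs⟩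
  · intro y hy
    obtain ⟨L, -, hL⟩ := hsymm y hy
    exact (τ.contDiffAt_symm hy hL
      (sT.contDiffAt (so.mem_nhds (hsrc (τ.map_target hy))))).contDiffWithinAt
  · intro y hy
    have hy' := hsrc (τ.map_target hy)
    obtain ⟨L, hL1, hL⟩ := hsymm y hy
    obtain ⟨m, hm0, hm⟩ := metric _ hy'
    have h1 := (hdF _ (hsD hy')).hasFDerivAt.comp y (τ.hasFDerivAt_symm hy hL)
    have h2 : ∀ a b : Plane, ⟪fderiv ℝ (F ∘ τ.symm) y a, fderiv ℝ (F ∘ τ.symm) y b⟫_ℝ =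
        m⁻¹ * ⟪a, b⟫_ℝ := by
      intro a b
      have := hm (L.symm a) (L.symm b)
      rw [← hL1] at this
      rw [h1.fderiv]
      simp at this ⊢
      rw [this]
      field_simp
    have n1 : ‖fderiv ℝ (F ∘ τ.symm) y e₁‖ ^ 2 = ‖fderiv ℝ (F ∘ τ.symm) y e₂‖ ^ 2 := by
      rw [← real_inner_self_eq_norm_sq, ← real_inner_self_eq_norm_sq, h2, h2]
      simp [e₁, e₂]
    refine ⟨?_, ?_⟩
    · rwa [sq_eq_sq₀ (norm_nonneg _) (norm_nonneg _)] at n1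
    · rw [h2]; simp [e₁, e₂, PiLp.inner_apply]

end Existence

/-! ### Changes of coordinates -/

section Reparametrization

variable {n : ℕ}

/-- `F` is on `D` the composition of `G` with the local diffeomorphism `τ` to `E`. -/
structure IsReparam (τ : Plane → Plane) (F G : Plane → Space n) (D E : Set Plane) : Prop where
  isOpen : IsOpen D
  smooth : ContDiffOn ℝ ∞ τ D
  mapsTo : ∀ x ∈ D, τ x ∈ E
  surjective : ∀ x ∈ D, Function.Surjective (fderiv ℝ τ x)
  eq : ∀ x ∈ D, F x = G (τ x)

theorem differentiable_zeta : Differentiable ℝ zeta := by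
  have : zeta = fun v => ((v 0 : ℝ) : ℂ) + ((v 1 : ℝ) : ℂ) * Complex.I := by
    funext v
    apply Complex.ext <;> simp [zeta]
  rw [this]
  have h (i : Fin 2) : Differentiable ℝ fun v : Plane => ((v i : ℝ) : ℂ) :=
    Complex.ofRealCLM.differentiable.comp (EuclideanSpace.proj i : Plane →L[ℝ] ℝ).differentiable
  exact (h 0).add ((h 1).mul_const _)

/-- `twoRe` as a continuous linear map. -/
def twoReCLM : CSpace n →L[ℝ] Space n :=
  LinearMap.toContinuousLinearMap
    { toFun := twoRe
      map_add' := twoRe_add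
      map_smul' := fun r w => by ext j; simp [twoRe]; ring }

theorem twoReCLM_apply (w : CSpace n) : twoReCLM w = twoRe w := rfl

namespace IsReparam

variable {τ : Plane → Plane} {F G : Plane → Space n} {D E : Set Plane} {x : Plane}

theorem differentiableAt (R : IsReparam τ F G D E) (hx : x ∈ D) : DifferentiableAt ℝ τ x :=
  (R.smooth.contDiffAt (R.isOpen.mem_nhds hx)).differentiableAt (by simp)

theorem refl (hD : IsOpen D) : IsReparam id F F D D where
  isOpen := hD
  smooth := contDiffOn_id
  mapsTo _ hx := hx
  surjective x _ v := ⟨v, by simp⟩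
  eq _ _ := rfl

theorem fderiv_eq (R : IsReparam τ F G D E) (hG : DifferentiableAt ℝ G (τ x)) (hx : x ∈ D)
    (v : Plane) : fderiv ℝ F x v = fderiv ℝ G (τ x) (fderiv ℝ τ x v) := by
  have : F =ᶠ[𝓝 x] G ∘ τ := Filter.eventuallyEq_of_mem (R.isOpen.mem_nhds hx) R.eq
  rw [this.fderiv_eq, fderiv_comp x hG (R.differentiableAt hx)]
  rfl

theorem tangentPlane_eq (R : IsReparam τ F G D E) (hG : DifferentiableAt ℝ G (τ x)) (hx : x ∈ D) :
    tangentPlane F x = tangentPlane G (τ x) := by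
  ext u
  constructor
  · rintro ⟨v, rfl⟩
    exact ⟨fderiv ℝ τ x v, (R.fderiv_eq hG hx v).symm⟩
  · rintro ⟨w, rfl⟩
    obtain ⟨v, rfl⟩ := R.surjective x hx w
    exact ⟨v, R.fderiv_eq hG hx v⟩

theorem normalPart_eq (R : IsReparam τ F G D E) (hG : DifferentiableAt ℝ G (τ x)) (hx : x ∈ D)
    (u : Space n) : normalPart F x u = normalPart G (τ x) u := by
  simp only [normalPart, R.tangentPlane_eq hG hx]

/-- The chain rule adds dG applied to the second derivative of τ, which is tangent and disappears in
the normal part. -/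
theorem secondFF_eq (R : IsReparam τ F G D E) (H : IsothermalOn G E) (hx : x ∈ D) (v w : Plane) :
    secondFF F v w x = secondFF G (fderiv ℝ τ x v) (fderiv ℝ τ x w) (τ x) := by
  have hE := R.mapsTo x hx
  have h2 : ContDiffOn ℝ ∞ (fderiv ℝ G) E := H.smooth.fderiv_of_isOpen H.isOpen (by simp)
  have d2 : DifferentiableAt ℝ (fderiv ℝ G) (τ x) :=
    (h2.contDiffAt (H.mem_nhds hE)).differentiableAt (by simp)
  have dw : DifferentiableAt ℝ (fun y => fderiv ℝ τ y w) x :=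
    ((contDiffOn_fderiv_apply R.isOpen R.smooth w).contDiffAt
      (R.isOpen.mem_nhds hx)).differentiableAt (by simp)
  have e : (fun y => fderiv ℝ F y w) =ᶠ[𝓝 x] fun y => fderiv ℝ G (τ y) (fderiv ℝ τ y w) :=
    Filter.eventuallyEq_of_mem (R.isOpen.mem_nhds hx) fun y hy =>
      R.fderiv_eq (H.differentiableAt (R.mapsTo y hy)) hy w
  have h3 := (d2.hasFDerivAt.comp x (R.differentiableAt hx).hasFDerivAt).clm_apply dw.hasFDerivAt
  have h4 : HasFDerivAt (fun y => fderiv ℝ G y (fderiv ℝ τ x w)) _ (τ x) :=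
    d2.hasFDerivAt.clm_apply (hasFDerivAt_const (fderiv ℝ τ x w) (τ x))
  rw [secondFF, secondFF, R.normalPart_eq (H.differentiableAt hE) hx, e.fderiv_eq, h4.fderiv]
  have h5 := h3.fderiv
  simp only [Function.comp_def] at h5
  rw [h5]
  have hz (u : Plane) : normalPart G (τ x) (fderiv ℝ G (τ x) u) = 0 := by
    rw [normalPart, Submodule.starProjection_orthogonal_val]
    have : fderiv ℝ G (τ x) u ∈ tangentPlane G (τ x) := ⟨u, rfl⟩
    rw [Submodule.starProjection_eq_self_iff.2 this, sub_self]
  simp only [normalPart] at hz ⊢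
  simp only [add_apply, ContinuousLinearMap.comp_apply, ContinuousLinearMap.flip_apply, map_add, hz,
    zero_apply, map_zero]

theorem norm_fderiv_eq_one (R : IsReparam τ F G D E) (H : IsothermalOn G E) (hx : x ∈ D)
    (v : Plane) : ‖fderiv ℝ F x v‖ = 1 ↔ ‖zeta (fderiv ℝ τ x v)‖ = unitRadius G (τ x) := by
  rw [R.fderiv_eq (H.differentiableAt (R.mapsTo x hx)) hx,
    H.norm_fderiv_eq_one (R.mapsTo x hx)]

theorem exists_zeta_eq (R : IsReparam τ F G D E) (hx : x ∈ D) (z : ℂ) :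
    ∃ v, zeta (fderiv ℝ τ x v) = z := by
  obtain ⟨w, hw⟩ := zeta_surjective z
  obtain ⟨v, hv⟩ := R.surjective x hx w
  exact ⟨v, by rw [hv, hw]⟩

/-- With z = ζ(dτ v), the value α(v,v) is a |z|²-multiple of the mean curvature part plus 2 Re(z²
ψ). Unit vectors correspond to |z| constant, so the first term is the fixed centre. -/
theorem isCircle_curvatureEllipse_iff (R : IsReparam τ F G D E) (H : IsothermalOn G E)
    (hx : x ∈ D) : IsCircle (curvatureEllipse F x) ↔
      hopf G (τ x) ⬝ᵥ hopf G (τ x) = 0 ∧ hopf G (τ x) ≠ 0 := by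
  have hE := R.mapsTo x hx
  rw [← isCircle_pow_iff two_ne_zero (H.unitRadius_pos hE)
    (c := unitRadius G (τ x) ^ 2 • twoRe (dzbar (dz (cxF G)) (τ x)))]
  have key (v : Plane) (hv : ‖zeta (fderiv ℝ τ x v)‖ = unitRadius G (τ x)) :
      secondFF F v v x = unitRadius G (τ x) ^ 2 • twoRe (dzbar (dz (cxF G)) (τ x)) +
        twoRe (zeta (fderiv ℝ τ x v) ^ 2 • hopf G (τ x)) := by
    apply cx_injective
    rw [R.secondFF_eq H hx, H.cx_secondFF hE, map_add, cx_smul, cx_twoRe, cx_twoRe,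
      H.star_dzbar_dz hE, mul_comm (conj _), Complex.mul_conj, Complex.normSq_eq_norm_sq, hv, ← sq]
    push_cast
    module
  refine iff_of_eq (congrArg _ ?_)
  ext y
  constructor
  · rintro ⟨v, hv, rfl⟩
    rw [R.norm_fderiv_eq_one H hx] at hv
    exact ⟨_, hv, key v hv⟩
  · rintro ⟨z, hz, rfl⟩
    obtain ⟨v, rfl⟩ := R.exists_zeta_eq hx z
    exact ⟨v, (R.norm_fderiv_eq_one H hx v).2 hz, (key v hz).symm⟩

end IsReparam

theorem fundamentalForm_zero (F : Plane → Space n) (X : Fin 2 → Plane) (x : Plane) :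
    fundamentalForm F 0 X x = secondFF F (X 1) (X 0) x := by
  simp only [fundamentalForm, normalSum, iteratedNormalDeriv, Submodule.bot_orthogonal_eq_top]
  exact Submodule.starProjection_eq_self_iff.2 Submodule.mem_top

theorem higherEllipse_zero (F : Plane → Space n) (x : Plane) :
    higherEllipse F 0 x = curvatureEllipse F x := by
  simp only [higherEllipse, curvatureEllipse, fundamentalForm_zero]

theorem normalPart_twoRe {F : Plane → Space n} {D : Set Plane} {x : Plane} (H : IsothermalOn F D)
    (hx : x ∈ D) {w : CSpace n} (h : w ⬝ᵥ dz (cxF F) x = 0) (h' : w ⬝ᵥ star (dz (cxF F) x) = 0)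
    (b : ℂ) : normalPart F x (twoRe (w + b • dz (cxF F) x)) = twoRe w := by
  have hw : nproj (dz (cxF F) x) w = w := by rw [nproj, h, h']; simp
  have h0 := nproj_self (H.dot_self hx) (H.dz_ne_zero hx)
  apply cx_injective
  rw [H.cx_normalPart hx, cx_twoRe, cx_twoRe, nproj_add, nproj_star, nproj_add, nproj_smul, h0, hw,
    smul_zero, add_zero]

namespace IsReparam

variable {τ : Plane → Plane} {F G : Plane → Space n} {D E : Set Plane} {x : Plane}

theorem secondFF_eq_twoRe (R : IsReparam τ F G D E) (H : IsotropicOn G E) (hx : x ∈ D)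
    (v w : Plane) : secondFF F v w x =
      twoRe ((zeta (fderiv ℝ τ x v) * zeta (fderiv ℝ τ x w)) • hopf G (τ x)) := by
  apply cx_injective
  rw [R.secondFF_eq H.toIsothermalOn hx, H.cx_secondFF (R.mapsTo x hx), cx_twoRe,
    H.harmonic _ (R.mapsTo x hx), smul_zero, add_zero]

/-- The first normal space consists of the real parts of multiples of ψ, so projecting away from it
deletes exactly the ψ-component. -/
theorem starProjection_normalSum_one (R : IsReparam τ F G D E) (H : IsotropicOn G E) (hx : x ∈ D)
    {w : CSpace n} (h : w ⬝ᵥ hopf G (τ x) = 0) (h' : w ⬝ᵥ star (hopf G (τ x)) = 0) (a : ℂ) :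
    (normalSum F 1 x)ᗮ.starProjection (twoRe (w + a • hopf G (τ x))) = twoRe w := by
  have hN : normalSum F 1 x = Submodule.span ℝ (Set.range fun X : Fin 2 → Plane =>
      twoRe ((zeta (fderiv ℝ τ x (X 1)) * zeta (fderiv ℝ τ x (X 0))) • hopf G (τ x))) := by
    simp only [normalSum, bot_sup_eq]
    congr 2
    funext X
    have := fundamentalForm_zero F X x
    rw [R.secondFF_eq_twoRe H hx] at this
    exact this
  refine Submodule.eq_starProjection_of_mem_orthogonal ?_ ?_
  · rw [Submodule.mem_orthogonal, hN]
    intro u hu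
    induction hu using Submodule.span_induction with
    | mem u hu =>
      obtain ⟨X, rfl⟩ := hu
      have s1 : star (hopf G (τ x)) ⬝ᵥ star w = 0 := by
        rw [← star_dot, dotProduct_comm, h, star_zero]
      have s2 : hopf G (τ x) ⬝ᵥ star w = 0 := by
        rw [dot_star_comm, h', star_zero]
      have : ((⟪twoRe ((zeta (fderiv ℝ τ x (X 1)) * zeta (fderiv ℝ τ x (X 0))) • hopf G (τ x)),
          twoRe w⟫_ℝ : ℝ) : ℂ) = 0 := by
        rw [inner_twoRe]
        simp only [add_dotProduct, dotProduct_add, star_smul, smul_dotProduct, s1, s2,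
          dotProduct_comm (hopf G (τ x)) w, dotProduct_comm (star (hopf G (τ x))) w, h, h']
        simp
      exact_mod_cast this
    | zero => exact inner_zero_left _
    | add u v _ _ h1 h2 => rw [inner_add_left, h1, h2, add_zero]
    | smul r u _ h1 => rw [inner_smul_left, h1, mul_zero]
  · rw [twoRe_add, add_sub_cancel_left]
    apply Submodule.le_orthogonal_orthogonal
    rw [hN]
    obtain ⟨v, hv⟩ := R.exists_zeta_eq hx a
    obtain ⟨w, hw⟩ := R.exists_zeta_eq hx 1
    exact Submodule.subset_span ⟨![v, w], by simp [hv, hw]⟩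

/-- Differentiating 2 Re(gψ) by the frame equations yields terms in χ, ψ and φ. The normal
projection removes φ, and the projection off the first normal space removes ψ together with every
derivative of g. -/
theorem fundamentalForm_one (R : IsReparam τ F G D E) (H : IsotropicOn G E) (hx : x ∈ D)
    (X : Fin 3 → Plane) : fundamentalForm F 1 X x =
      twoRe ((zeta (fderiv ℝ τ x (X 0)) * zeta (fderiv ℝ τ x (X 1)) * zeta (fderiv ℝ τ x (X 2))) •
        cubic G (τ x)) := by
  have hE := R.mapsTo x hx
  set g : Plane → ℂ := fun y => zeta (fderiv ℝ τ y (X 1)) * zeta (fderiv ℝ τ y (X 0)) with hg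
  have dz' (i) : DifferentiableAt ℝ (fun y => zeta (fderiv ℝ τ y (X i))) x := by
    have := ((contDiffOn_fderiv_apply R.isOpen R.smooth (X i)).contDiffAt
      (R.isOpen.mem_nhds hx)).differentiableAt (by simp)
    exact differentiable_zeta.differentiableAt.comp x this
  have dg : DifferentiableAt ℝ g x := (dz' 1).mul (dz' 0)
  have e : iteratedNormalDeriv F 0 (Fin.init X) =ᶠ[𝓝 x] fun y => twoReCLM (g y • hopf G (τ y)) :=
    Filter.eventuallyEq_of_mem (R.isOpen.mem_nhds hx) fun y hy => by
      rw [iteratedNormalDeriv, R.secondFF_eq_twoRe H hy]; rfl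
  have hψ := H.hasWirt_psi hE
  have h1 := dg.hasFDerivAt.smul
    (hψ.differentiableAt.hasFDerivAt.comp x (R.differentiableAt hx).hasFDerivAt)
  have h2 := (twoReCLM (n := n)).hasFDerivAt.comp x h1
  have hX : X (Fin.last 2) = X 2 := rfl
  have h3 : fderiv ℝ (iteratedNormalDeriv F 0 (Fin.init X)) x (X 2) = twoRe
      ((g x * zeta (fderiv ℝ τ x (X 2))) • cubic G (τ x) +
        (g x * zeta (fderiv ℝ τ x (X 2)) * hopfCoef G (τ x) + fderiv ℝ g x (X 2)) • hopf G (τ x) +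
        (g x * conj (zeta (fderiv ℝ τ x (X 2))) * -(hopfNormSq G (τ x) / confFactor G (τ x))) •
          dz (cxF G) (τ x)) := by
    rw [e.fderiv_eq]
    change fderiv ℝ (twoReCLM ∘ (g • hopf G ∘ τ)) x _ = _
    rw [h2.fderiv]
    simp only [ContinuousLinearMap.comp_apply, add_apply, smul_apply,
      ContinuousLinearMap.smulRight_apply, hψ.fderiv, wirt_apply, twoReCLM_apply]
    congr 1
    simp only [Function.comp_apply]
    module
  obtain ⟨-, ⟨b1, b2, b3, b4⟩, ⟨c1, c2, c3, c4⟩, ⟨d1, d2, d3, d4⟩,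
    ⟨q1, q2, q3, q4⟩, ⟨f1, f2, f3, f4⟩, ⟨g1, g2, g3, g4⟩, ⟨l1, l2, l3, l4⟩⟩ := H.dot_table hE
  rw [fundamentalForm, iteratedNormalDeriv, normalDeriv, hX, h3,
    R.normalPart_eq (H.differentiableAt hE) hx,
    normalPart_twoRe H.toIsothermalOn hE (by simp [add_dotProduct, smul_dotProduct, q1, d1])
      (by simp [add_dotProduct, smul_dotProduct, q3, d3]),
    R.starProjection_normalSum_one H hx (by simp [smul_dotProduct, g1])
      (by simp [smul_dotProduct, g3])]
  congr 2
  rw [hg]; ring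

theorem isCircle_higherEllipse_one_iff (R : IsReparam τ F G D E) (H : IsotropicOn G E)
    (hx : x ∈ D) : IsCircle (higherEllipse F 1 x) ↔
      cubic G (τ x) ⬝ᵥ cubic G (τ x) = 0 ∧ cubic G (τ x) ≠ 0 := by
  have hE := R.mapsTo x hx
  rw [← isCircle_pow_iff three_ne_zero (H.unitRadius_pos hE) (c := 0)]
  have key (v : Plane) : fundamentalForm F 1 (fun _ => v) x =
      0 + twoRe (zeta (fderiv ℝ τ x v) ^ 3 • cubic G (τ x)) := by
    rw [R.fundamentalForm_one H hx, zero_add]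
    congr 2
    ring
  refine iff_of_eq (congrArg _ ?_)
  ext y
  constructor
  · rintro ⟨v, hv, rfl⟩
    rw [R.norm_fderiv_eq_one H.toIsothermalOn hx] at hv
    exact ⟨_, hv, key v⟩
  · rintro ⟨z, hz, rfl⟩
    obtain ⟨v, rfl⟩ := R.exists_zeta_eq hx z
    exact ⟨v, (R.norm_fderiv_eq_one H.toIsothermalOn hx v).2 hz, (key v).symm⟩

theorem cubic_eq_zero_iff (R : IsReparam τ F G D E) (H : IsotropicOn G E) (hx : x ∈ D) :
    Module.finrank ℝ (normalSpace F 1 x) = 0 ↔ cubic G (τ x) = 0 := by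
  rw [Submodule.finrank_eq_zero, normalSpace, Submodule.span_eq_bot]
  constructor
  · intro h
    have k (z : ℂ) : twoRe (z • cubic G (τ x)) = 0 := by
      obtain ⟨v, hv⟩ := R.exists_zeta_eq hx z
      obtain ⟨w, hw⟩ := R.exists_zeta_eq hx 1
      rw [← h _ ⟨![v, w, w], rfl⟩]
      have := R.fundamentalForm_one H hx ![v, w, w]
      simp [hv, hw] at this
      exact this.symm
    -- The factors 1 and -i read off the real and imaginary parts of χ.
    have k1 := k 1
    have k2 := k (-Complex.I)
    ext j
    apply Complex.ext
    · simpa [twoRe] using congrArg (fun u : Space n => u j) k1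
    · simpa [twoRe] using congrArg (fun u : Space n => u j) k2
  · rintro h _ ⟨X, rfl⟩
    change fundamentalForm F 1 X x = 0
    rw [R.fundamentalForm_one H hx, h, smul_zero]
    ext j; simp [twoRe]

end IsReparam

end Reparametrization

/-! ### Charts of a surface -/

section Charts

variable {n : ℕ} {M : Type*} [TopologicalSpace M] [ChartedSpace (EuclideanSpace ℝ (Fin 2)) M]
  [IsManifold (𝓡 2) ∞ M] {f g : M → Space n} {o : Space n}
  {e e' : OpenPartialHomeomorph M (EuclideanSpace ℝ (Fin 2))} {x : Plane}

/-- The isomorphism depends on the chart only, not on the map, so one and the same serves for the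
surface and its pedal surface. -/
theorem exists_fderiv_eq_differential (he : e ∈ IsManifold.maximalAtlas (𝓡 2) ∞ M)
    (hx : x ∈ e.target) : ∃ L : Plane ≃L[ℝ] TangentSpace (𝓡 2) (e.symm x),
      ∀ f : M → Space n, MDifferentiableAt (𝓡 2) 𝓘(ℝ, Space n) f (e.symm x) →
        ∀ v, fderiv ℝ (f ∘ e.symm) x v = differential f (e.symm x) (L v) := by
  have hs : e.symm.MDifferentiable (𝓡 2) (𝓡 2) :=
    ⟨(contMDiffOn_symm_of_mem_maximalAtlas he).mdifferentiableOn (by simp),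
      (contMDiffOn_of_mem_maximalAtlas he).mdifferentiableOn (by simp)⟩
  refine ⟨hs.mfderiv hx, fun f hf v => ?_⟩
  have := mfderiv_comp x hf (hs.mdifferentiableAt hx)
  rw [mfderiv_eq_fderiv] at this
  rw [this]
  rfl

theorem contDiffOn_comp_symm (he : e ∈ IsManifold.maximalAtlas (𝓡 2) ∞ M)
    (hf : IsImmersionOn f e.source) : ContDiffOn ℝ ∞ (f ∘ e.symm) e.target := by
  rw [← contMDiffOn_iff_contDiffOn]
  exact hf.1.comp (contMDiffOn_symm_of_mem_maximalAtlas he) fun x hx => e.map_target hx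

theorem IsImmersionOn.mdifferentiableAt {U : Set M} (hf : IsImmersionOn f U) (hU : IsOpen U) {p : M}
    (hp : p ∈ U) : MDifferentiableAt (𝓡 2) 𝓘(ℝ, Space n) f p :=
  (hf.1.contMDiffAt (hU.mem_nhds hp)).mdifferentiableAt (by simp)

theorem IsImmersionOn.mono {U V : Set M} (hf : IsImmersionOn f U) (h : V ⊆ U) : IsImmersionOn f V :=
  ⟨hf.1.mono h, fun p hp => hf.2 p (h hp)⟩

theorem injective_fderiv_comp_symm (he : e ∈ IsManifold.maximalAtlas (𝓡 2) ∞ M)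
    (hf : IsImmersionOn f e.source) (hx : x ∈ e.target) :
    Function.Injective (fderiv ℝ (f ∘ e.symm) x) := by
  obtain ⟨L, hL⟩ := exists_fderiv_eq_differential (n := n) he hx
  have hfd := hf.mdifferentiableAt e.open_source (e.map_target hx)
  have : (fderiv ℝ (f ∘ e.symm) x : Plane → Space n) = differential f (e.symm x) ∘ L := by
    funext v; exact hL f hfd v
  rw [this]
  exact (hf.2 _ (e.map_target hx)).comp L.injective

theorem pedal_comp_symm (he : e ∈ IsManifold.maximalAtlas (𝓡 2) ∞ M)
    (hf : IsImmersionOn f e.source) (hx : x ∈ e.target) :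
    pedal f o (e.symm x) = localPedal (f ∘ e.symm) o x := by
  obtain ⟨L, hL⟩ := exists_fderiv_eq_differential (n := n) he hx
  have hfd := hf.mdifferentiableAt e.open_source (e.map_target hx)
  have : tangentPlane (f ∘ e.symm) x = (differential f (e.symm x)).range := by
    ext u
    constructor
    · rintro ⟨v, rfl⟩
      exact ⟨L v, (hL f hfd v).symm⟩
    · rintro ⟨w, rfl⟩
      exact ⟨L.symm w, (hL f hfd _).trans (by rw [L.apply_symm_apply]; rfl)⟩
  simp only [pedal, localPedal, this, Function.comp_apply]

theorem contDiffOn_transition (he : e ∈ IsManifold.maximalAtlas (𝓡 2) ∞ M)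
    (he' : e' ∈ IsManifold.maximalAtlas (𝓡 2) ∞ M) :
    ContDiffOn ℝ ∞ (e' ∘ e.symm) (e.symm.trans e').source := by
  rw [← contMDiffOn_iff_contDiffOn]
  refine (contMDiffOn_of_mem_maximalAtlas he').comp
    ((contMDiffOn_symm_of_mem_maximalAtlas he).mono fun x hx => ?_) fun x hx => ?_
  · exact hx.1
  · exact hx.2

theorem isReparam_transition (he : e ∈ IsManifold.maximalAtlas (𝓡 2) ∞ M)
    (he' : e' ∈ IsManifold.maximalAtlas (𝓡 2) ∞ M) {G : Plane → Space n}
    (h : ∀ y ∈ e'.target, f (e'.symm y) = G y) :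
    IsReparam (e' ∘ e.symm) (f ∘ e.symm) G (e.symm.trans e').source e'.target where
  isOpen := (e.symm.trans e').open_source
  smooth := contDiffOn_transition he he'
  mapsTo x hx := e'.map_source hx.2
  surjective x hx w := by
    have hx1 : x ∈ e.target := hx.1
    have hx2 : e.symm x ∈ e'.source := hx.2
    set y := e' (e.symm x) with hy
    have hy1 : y ∈ (e'.symm.trans e).source :=
      ⟨e'.map_source hx2, by
        change e'.symm y ∈ e.source
        rw [hy, e'.left_inv hx2]; exact e.map_target hx1⟩
    have hyx : e (e'.symm y) = x := by rw [hy, e'.left_inv hx2, e.right_inv hx1]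
    have d1 : DifferentiableAt ℝ (e ∘ e'.symm) y :=
      ((contDiffOn_transition he' he).contDiffAt
        ((e'.symm.trans e).open_source.mem_nhds hy1)).differentiableAt (by simp)
    have d2 : DifferentiableAt ℝ (e' ∘ e.symm) ((e ∘ e'.symm) y) := by
      rw [Function.comp_apply, hyx]
      exact ((contDiffOn_transition he he').contDiffAt
        ((e.symm.trans e').open_source.mem_nhds hx)).differentiableAt (by simp)
    have hc := d2.hasFDerivAt.comp y d1.hasFDerivAt
    -- The differential of the opposite transition map is a right inverse, which supplies the
    -- preimage of `w`.
    have hid : (e' ∘ e.symm) ∘ (e ∘ e'.symm) =ᶠ[𝓝 y] id :=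
      Filter.eventuallyEq_of_mem ((e'.symm.trans e).open_source.mem_nhds hy1) fun z hz => by
        have hz1 : z ∈ e'.target := hz.1
        have hz2 : e'.symm z ∈ e.source := hz.2
        simp [e.left_inv hz2, e'.right_inv hz1]
    have h2 := (hc.congr_of_eventuallyEq hid.symm).unique (hasFDerivAt_id y)
    refine ⟨fderiv ℝ (e ∘ e'.symm) y w, ?_⟩
    have h3 := congrArg (fun A : Plane →L[ℝ] Plane => A w) h2
    simpa [hyx] using h3
  eq x hx := by
    have hx2 : e.symm x ∈ e'.source := hx.2
    rw [Function.comp_apply, Function.comp_apply, ← h _ (e'.map_source hx2), e'.left_inv hx2]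

theorem mem_transition_source (hx : x ∈ e.target) (h : e.symm x ∈ e'.source) :
    x ∈ (e.symm.trans e').source := ⟨hx, h⟩

theorem IsIsotropic.isImmersionOn {m : ℕ} (hf : IsIsotropic m f) (U : Set M) : IsImmersionOn f U :=
  hf.1.1.mono (Set.subset_univ U)

theorem IsIsotropic.isotropicOn (hf : IsIsotropic 1 f) (he : e ∈ IsManifold.maximalAtlas (𝓡 2) ∞ M)
    (hi : ∀ x ∈ e.target, IsIsothermalAt (f ∘ e.symm) x) :
    IsotropicOn (f ∘ e.symm) e.target := by
  have H : IsothermalOn (f ∘ e.symm) e.target :=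
    ⟨e.open_target, contDiffOn_comp_symm he (hf.isImmersionOn _),
      fun x hx => injective_fderiv_comp_symm he (hf.isImmersionOn _) hx, hi⟩
  have hc : ∀ x ∈ e.target, hopf (f ∘ e.symm) x ⬝ᵥ hopf (f ∘ e.symm) x = 0 ∧
      hopf (f ∘ e.symm) x ≠ 0 := fun x hx => by
    have := hf.2 0 zero_lt_one e he x hx
    rwa [higherEllipse_zero, (IsReparam.refl e.open_target).isCircle_curvatureEllipse_iff H hx]
      at this
  exact
    { toIsothermalOn := H
      harmonic := fun x hx => H.dzbar_dz_eq_zero hx (hf.1.2 e he x hx (Set.mem_univ _))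
      hopf_isotropic := fun x hx => (hc x hx).1
      hopf_ne_zero := fun x hx => (hc x hx).2 }

theorem IsIsotropic.exists_chart (hf : IsIsotropic 1 f) {U : Set M} (hU : IsOpen U) {p : M}
    (hp : p ∈ U) : ∃ e ∈ IsManifold.maximalAtlas (𝓡 2) ∞ M, p ∈ e.source ∧ e.source ⊆ U ∧
      IsotropicOn (f ∘ e.symm) e.target := by
  set e := (chartAt (EuclideanSpace ℝ (Fin 2)) p).restr U with he_def
  have he : e ∈ IsManifold.maximalAtlas (𝓡 2) ∞ M :=
    restr_mem_maximalAtlas _ (IsManifold.chart_mem_maximalAtlas p) hU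
  have hes : e.source = (chartAt (EuclideanSpace ℝ (Fin 2)) p).source ∩ U := by
    rw [he_def, OpenPartialHomeomorph.restr_source, hU.interior_eq]
  have hpe : p ∈ e.source := by rw [hes]; exact ⟨mem_chart_source _ p, hp⟩
  obtain ⟨τ, h1, h2, h3, h4, h5⟩ := exists_isothermal e.open_target
    (contDiffOn_comp_symm he (hf.isImmersionOn _))
    (fun x hx => injective_fderiv_comp_symm he (hf.isImmersionOn _) hx)
    (fun x hx => hf.1.2 e he x hx (Set.mem_univ _)) (e.map_source hpe)
  have hτ : e.trans τ ∈ IsManifold.maximalAtlas (𝓡 2) ∞ M := by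
    refine OpenPartialHomeomorph.mem_maximalAtlas_of_contMDiffOn _ ?_ ?_
    · exact (contMDiffOn_iff_contDiffOn.2 h3).comp
        ((contMDiffOn_of_mem_maximalAtlas he).mono fun q hq => hq.1) fun q hq => hq.2
    · exact (contMDiffOn_symm_of_mem_maximalAtlas he).comp
        ((contMDiffOn_iff_contDiffOn.2 h4).mono fun q hq => hq.1) fun q hq => hq.2
  refine ⟨e.trans τ, hτ, ⟨hpe, h1⟩, fun q hq => ?_, hf.isotropicOn hτ fun x hx => h5 x hx.1⟩
  have : q ∈ e.source := hq.1
  rw [hes] at this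
  exact this.2

theorem IsIsotropic.isothermalOn_pedal (hf : IsIsotropic 1 f)
    (hg : IsImmersionOn (pedal f o) Set.univ) (he : e ∈ IsManifold.maximalAtlas (𝓡 2) ∞ M)
    (H : IsotropicOn (f ∘ e.symm) e.target) :
    IsothermalOn (localPedal (f ∘ e.symm) o) e.target := by
  have hG := hg.mono (Set.subset_univ e.source)
  have eq : Set.EqOn (localPedal (f ∘ e.symm) o) (pedal f o ∘ e.symm) e.target := fun x hx =>
    (pedal_comp_symm he (hf.isImmersionOn _) hx).symm
  refine H.isothermalOn_pedal ((contDiffOn_comp_symm he hG).congr eq) fun x hx => ?_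
  rw [(Filter.eventuallyEq_of_mem (e.open_target.mem_nhds hx) eq).fderiv_eq]
  exact injective_fderiv_comp_symm he hG hx

end Charts

/-! ### Global arguments on the surface. -/

section Global

variable {n : ℕ} {M : Type*} [TopologicalSpace M] [ChartedSpace (EuclideanSpace ℝ (Fin 2)) M]
  [IsManifold (𝓡 2) ∞ M] {f : M → Space n} {o : Space n}
  {e e' : OpenPartialHomeomorph M (EuclideanSpace ℝ (Fin 2))} {x : Plane}

theorem IsotropicOn.exists_nhds_inner_const (H : IsotropicOn (f ∘ e.symm) e.target)
    (hc : ∀ x ∈ e.target, cubic (f ∘ e.symm) x = 0) {p : M} (hp : p ∈ e.source) :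
    ∃ V ∈ 𝓝 p, ∀ q ∈ V, ∀ ν : Space n, cx ν ⬝ᵥ dz (cxF (f ∘ e.symm)) (e q) = 0 →
      cx ν ⬝ᵥ hopf (f ∘ e.symm) (e q) = 0 → ∀ q' ∈ V, ⟪ν, f q'⟫_ℝ = ⟪ν, f q⟫_ℝ := by
  obtain ⟨ε, hε, hball⟩ := Metric.isOpen_iff.1 e.open_target (e p) (e.map_source hp)
  have HB : IsotropicOn (f ∘ e.symm) (Metric.ball (e p) ε) :=
    { toIsothermalOn := H.toIsothermalOn.mono Metric.isOpen_ball hball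
      harmonic := fun x hx => H.harmonic x (hball hx)
      hopf_isotropic := fun x hx => H.hopf_isotropic x (hball hx)
      hopf_ne_zero := fun x hx => H.hopf_ne_zero x (hball hx) }
  refine ⟨e.source ∩ e ⁻¹' Metric.ball (e p) ε,
    (e.isOpen_inter_preimage Metric.isOpen_ball).mem_nhds ⟨hp, Metric.mem_ball_self hε⟩, ?_⟩
  intro q hq ν h1 h2 q' hq'
  have := HB.inner_const_of_cubic_eq_zero (convex_ball _ _) (fun x hx => hc x (hball hx)) hq.2 h1 h2
    hq'.2
  simpa [e.left_inv hq.1, e.left_inv hq'.1] using this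

/-- A zero of χ at one point spreads by regularity, as χ = 0 means that the second normal space is
trivial. A vector ν orthogonal to the osculating space at one point then has ⟨ν, f⟩ constant by
continuation over the connected surface, so f lies in a hyperplane. -/
theorem IsIsotropic.cubic_ne_zero [ConnectedSpace M] (hn : 5 ≤ n) (hf : IsIsotropic 1 f)
    (hreg : IsRegular f) (hsub : IsSubstantial f) (he : e ∈ IsManifold.maximalAtlas (𝓡 2) ∞ M)
    (H : IsotropicOn (f ∘ e.symm) e.target) (hx : x ∈ e.target) : cubic (f ∘ e.symm) x ≠ 0 := by
  intro h0
  obtain ⟨d, hd⟩ := hreg 1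
  have hd0 : d = 0 := by
    rw [← hd e he x hx]
    exact ((IsReparam.refl e.open_target).cubic_eq_zero_iff H hx).2 h0
  have hc : ∀ e ∈ IsManifold.maximalAtlas (𝓡 2) ∞ M, IsotropicOn (f ∘ e.symm) e.target →
      ∀ y ∈ e.target, cubic (f ∘ e.symm) y = 0 := fun e he H y hy =>
    ((IsReparam.refl e.open_target).cubic_eq_zero_iff H hy).1 ((hd e he y hy).trans hd0)
  obtain ⟨ν, hν, h1, h2⟩ := exists_orthogonal hn (dz (cxF (f ∘ e.symm)) x) (hopf (f ∘ e.symm) x)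
  set p := e.symm x with hp
  have hpe : p ∈ e.source := e.map_target hx
  have hpx : e p = x := e.right_inv hx
  set S : Set M := {q | ∀ᶠ q' in 𝓝 q, ⟪ν, f q'⟫_ℝ = ⟪ν, f p⟫_ℝ} with hS
  have hSo : IsOpen S := isOpen_iff_mem_nhds.2 fun q hq => Filter.Eventually.eventually_nhds hq
  have hpS : p ∈ S := by
    obtain ⟨V, hV, hVc⟩ := H.exists_nhds_inner_const (hc e he H) hpe
    exact Filter.mem_of_superset hV (hVc p (mem_of_mem_nhds hV) ν (by rwa [hpx]) (by rwa [hpx]))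
  -- Near a limit point, take a point `r` of `S`. Constancy around `r` makes ν orthogonal to φ and ψ
  -- there, and the differential equation carries constancy from `r` over the whole neighbourhood.
  have hSc : IsClosed S := by
    refine isClosed_of_closure_subset fun q hq => ?_
    obtain ⟨e', he', hqe, -, H'⟩ := hf.exists_chart isOpen_univ (Set.mem_univ q)
    obtain ⟨V, hV, hVc⟩ := H'.exists_nhds_inner_const (hc e' he' H') hqe
    obtain ⟨r, ⟨hrV, hre⟩, hrS⟩ := mem_closure_iff_nhds.1 hq _
      (Filter.inter_mem hV (e'.open_source.mem_nhds hqe))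
    have hr : ∀ᶠ y in 𝓝 (e' r), ⟪ν, (f ∘ e'.symm) y⟫_ℝ = ⟪ν, f p⟫_ℝ := by
      have := e'.continuousAt_symm (e'.map_source hre)
      rw [ContinuousAt, e'.left_inv hre] at this
      exact this.eventually hrS
    obtain ⟨k1, k2⟩ := H'.dot_eq_zero_of_inner_const (e'.map_source hre) hr
    have hrp : ⟪ν, f r⟫_ℝ = ⟪ν, f p⟫_ℝ := hrS.self_of_nhds
    exact Filter.mem_of_superset hV fun q' hq' => (hVc r hrV ν k1 k2 q' hq').trans hrp
  have hSu : S = Set.univ := IsClopen.eq_univ ⟨hSc, hSo⟩ ⟨p, hpS⟩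
  have hle : affineSpan ℝ (Set.range f) ≤ AffineSubspace.mk' (f p) (ℝ ∙ ν)ᗮ := by
    rw [affineSpan_le]
    rintro _ ⟨q, rfl⟩
    have hq : q ∈ S := hSu ▸ Set.mem_univ q
    have := hq.self_of_nhds
    rw [SetLike.mem_coe, AffineSubspace.mem_mk', Submodule.mem_orthogonal_singleton_iff_inner_right,
      vsub_eq_sub, inner_sub_right, sub_eq_zero]
    exact this
  rw [hsub] at hle
  have := hle (AffineSubspace.mem_top ℝ (Space n) (f p + ν))
  rw [AffineSubspace.mem_mk', Submodule.mem_orthogonal_singleton_iff_inner_right, vsub_eq_sub,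
    add_sub_cancel_left, inner_self_eq_zero] at this
  exact hν this

theorem IsotropicOn.hopf_pedal_dot_self {F : Plane → Space n} {D : Set Plane}
    (H : IsotropicOn F D) (HG : IsothermalOn (localPedal F o) D) (hx : x ∈ D) :
    hopf (localPedal F o) x ⬝ᵥ hopf (localPedal F o) x =
      posTangent F o x ^ 2 * (cubic F x ⬝ᵥ cubic F x) := by
  rw [HG.hopf_dot_hopf hx, H.dz_dz_pedal_dot_self hx]

theorem isIsotropic_two_of_isSuperconformal [ConnectedSpace M] (hn : 5 ≤ n) (hf : IsIsotropic 1 f)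
    (hreg : IsRegular f) (hsub : IsSubstantial f) (hg : IsSuperconformal (pedal f o)) :
    IsIsotropic 2 f := by
  refine ⟨hf.1, fun k hk e he x hx => ?_⟩
  obtain rfl | rfl : k = 0 ∨ k = 1 := by omega
  · exact hf.2 0 zero_lt_one e he x hx
  obtain ⟨e', he', hxe, -, H⟩ := hf.exists_chart isOpen_univ (Set.mem_univ (e.symm x))
  have R := isReparam_transition (f := f) (G := f ∘ e'.symm) he he' fun y _ => rfl
  have hxR := mem_transition_source hx hxe
  have HG := hf.isothermalOn_pedal hg.1 he' H
  rw [R.isCircle_higherEllipse_one_iff H hxR]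
  refine ⟨H.cubic_isotropic_of_pedal (o := o) (fun y hy => ?_) (R.mapsTo x hxR),
    hf.cubic_ne_zero hn hreg hsub he' H (R.mapsTo x hxR)⟩
  -- The two maps agree only on the chart's target, so they are linked as a reparametrization by the
  -- identity.
  have R' : IsReparam id (pedal f o ∘ e'.symm) (localPedal (f ∘ e'.symm) o) e'.target e'.target :=
    { IsReparam.refl (F := f ∘ e'.symm) e'.open_target with
      eq := fun z hz => pedal_comp_symm he' (hf.isImmersionOn _) hz }
  rw [← HG.hopf_dot_hopf hy]
  exact ((R'.isCircle_curvatureEllipse_iff HG hy).1 (hg.2 e' he' y hy)).1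

theorem isSuperconformal_of_isIsotropic_two (hf : IsIsotropic 1 f) (hf2 : IsIsotropic 2 f)
    (hg : IsImmersionOn (pedal f o) Set.univ) : IsSuperconformal (pedal f o) := by
  refine ⟨hg, fun e he x hx => ?_⟩
  obtain ⟨e', he', hxe, -, H⟩ := hf.exists_chart isOpen_univ (Set.mem_univ (e.symm x))
  have R := isReparam_transition (f := pedal f o) he he' fun y hy =>
    pedal_comp_symm he' (hf.isImmersionOn _) hy
  have hxR := mem_transition_source hx hxe
  have hy := R.mapsTo x hxR
  have HG := hf.isothermalOn_pedal hg he' H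
  obtain ⟨hc, hc0⟩ := ((IsReparam.refl e'.open_target).isCircle_higherEllipse_one_iff H hy).1
    (hf2.2 1 one_lt_two e' he' _ hy)
  rw [R.isCircle_curvatureEllipse_iff HG hxR]
  exact ⟨by rw [H.hopf_pedal_dot_self HG hy]; exact mul_eq_zero_of_right _ hc,
    H.hopf_pedal_ne_zero HG hy hc0⟩

theorem IsothermalOn.inner_fderiv {F : Plane → Space n} {D : Set Plane} (H : IsothermalOn F D)
    (hx : x ∈ D) (v w : Plane) : ⟪fderiv ℝ F x v, fderiv ℝ F x w⟫_ℝ =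
      2 * (zeta v * conj (zeta w)).re * (dz (cxF F) x ⬝ᵥ star (dz (cxF F) x)).re := by
  have key : ((⟪fderiv ℝ F x v, fderiv ℝ F x w⟫_ℝ : ℝ) : ℂ) =
      ((2 * (zeta v * conj (zeta w)).re : ℝ) : ℂ) * (dz (cxF F) x ⬝ᵥ star (dz (cxF F) x)) := by
    rw [fderiv_eq_twoRe (H.differentiableAt hx), fderiv_eq_twoRe (H.differentiableAt hx),
      inner_twoRe]
    simp only [add_dotProduct, dotProduct_add, star_smul, smul_dotProduct, dotProduct_smul,
      H.dot_self hx, H.star_dot_star hx, dotProduct_comm (star (dz (cxF F) x)) (dz (cxF F) x),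
      smul_eq_mul, RCLike.star_def]
    have := Complex.add_conj (zeta v * conj (zeta w))
    rw [map_mul, Complex.conj_conj] at this
    rw [← this]; ring
  rw [dot_star_self_eq_re] at key
  exact_mod_cast key

/-- Both surfaces are isothermal in the same chart, so both metrics are multiples of the flat one; μ
is the quotient |∂G|²/|∂F|². -/
theorem areConformal_pedal (hf : IsIsotropic 1 f) (hg : IsImmersionOn (pedal f o) Set.univ) :
    AreConformal f (pedal f o) := by
  have key : ∀ p : M, ∃ μ : ℝ, 0 < μ ∧ ∀ X Y : TangentSpace (𝓡 2) p,
      ⟪differential (pedal f o) p X, differential (pedal f o) p Y⟫_ℝ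
        = μ * ⟪differential f p X, differential f p Y⟫_ℝ := by
    intro p
    obtain ⟨e, he, hp, -, H⟩ := hf.exists_chart isOpen_univ (Set.mem_univ p)
    obtain ⟨x, hx, rfl⟩ : ∃ x ∈ e.target, p = e.symm x := ⟨e p, e.map_source hp, (e.left_inv hp).symm⟩
    have HG := hf.isothermalOn_pedal hg he H
    obtain ⟨L, hL⟩ := exists_fderiv_eq_differential (n := n) he hx
    have hF := H.re_dot_star_pos hx
    have hG := HG.re_dot_star_pos hx
    refine ⟨_, div_pos hG hF, fun X Y => ?_⟩
    have eq : localPedal (f ∘ e.symm) o =ᶠ[𝓝 x] pedal f o ∘ e.symm :=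
      Filter.eventuallyEq_of_mem (e.open_target.mem_nhds hx) fun y hy =>
        (pedal_comp_symm he (hf.isImmersionOn _) hy).symm
    have k1 := H.inner_fderiv hx (L.symm X) (L.symm Y)
    have k2 := HG.inner_fderiv hx (L.symm X) (L.symm Y)
    rw [eq.fderiv_eq] at k2
    rw [hL f (hf.1.1.mdifferentiableAt isOpen_univ (Set.mem_univ _)),
      hL f (hf.1.1.mdifferentiableAt isOpen_univ (Set.mem_univ _)), L.apply_symm_apply,
      L.apply_symm_apply] at k1
    rw [hL _ (hg.mdifferentiableAt isOpen_univ (Set.mem_univ _)),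
      hL _ (hg.mdifferentiableAt isOpen_univ (Set.mem_univ _)), L.apply_symm_apply,
      L.apply_symm_apply] at k2
    rw [k1, k2]
    field_simp
  choose μ h1 h2 using key
  exact ⟨μ, h1, h2⟩

/-- Needed because the S-Willmore condition supplies charts isothermal for the pedal surface, while
the frame equations require charts isothermal for f. -/
theorem AreConformal.isIsothermalAt {g : M → Space n} (h : AreConformal f g)
    (he : e ∈ IsManifold.maximalAtlas (𝓡 2) ∞ M) (hf : IsImmersionOn f Set.univ)
    (hg : IsImmersionOn g Set.univ) (hx : x ∈ e.target) (hi : IsIsothermalAt (g ∘ e.symm) x) :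
    IsIsothermalAt (f ∘ e.symm) x := by
  obtain ⟨μ, hμ, h⟩ := h
  obtain ⟨L, hL⟩ := exists_fderiv_eq_differential (n := n) he hx
  have key (v w : Plane) : ⟪fderiv ℝ (g ∘ e.symm) x v, fderiv ℝ (g ∘ e.symm) x w⟫_ℝ =
      μ (e.symm x) * ⟪fderiv ℝ (f ∘ e.symm) x v, fderiv ℝ (f ∘ e.symm) x w⟫_ℝ := by
    rw [hL f (hf.mdifferentiableAt isOpen_univ (Set.mem_univ _)),
      hL f (hf.mdifferentiableAt isOpen_univ (Set.mem_univ _)),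
      hL g (hg.mdifferentiableAt isOpen_univ (Set.mem_univ _)),
      hL g (hg.mdifferentiableAt isOpen_univ (Set.mem_univ _)), h]
  have hμ0 := (hμ (e.symm x)).ne'
  obtain ⟨h1, h2⟩ := hi
  refine ⟨?_, ?_⟩
  · rw [← sq_eq_sq₀ (norm_nonneg _) (norm_nonneg _), ← real_inner_self_eq_norm_sq,
      ← real_inner_self_eq_norm_sq, key, key] at h1
    rw [← sq_eq_sq₀ (norm_nonneg _) (norm_nonneg _), ← real_inner_self_eq_norm_sq,
      ← real_inner_self_eq_norm_sq]
    exact mul_left_cancel₀ hμ0 h1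
  · rw [key] at h2
    exact (mul_eq_zero.1 h2).resolve_left hμ0

theorem DbarHopfParallel.congr {F G : Plane → Space n} {D : Set Plane} (HF : IsothermalOn F D)
    (HG : IsothermalOn G D) (h : Set.EqOn F G D) (hx : x ∈ D) (hp : DbarHopfParallel F x) :
    DbarHopfParallel G x := by
  have e1 : cxF F =ᶠ[𝓝 x] cxF G :=
    Filter.eventuallyEq_of_mem (HF.mem_nhds hx) fun y hy => by rw [cxF, cxF, h hy]
  have e2 := eventuallyEq_dz e1
  have e4 : hopf F =ᶠ[𝓝 x] hopf G := by
    filter_upwards [e2, eventuallyEq_dz e2] with y h1 h2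
    rw [hopf, hopf, h1, h2]
  rw [DbarHopfParallel, HF.complexVector_dbarHopf hx, HF.complexVector_hopf hx, e4.eq_of_nhds,
    (eventuallyEq_dzbar e4).eq_of_nhds, e2.eq_of_nhds] at hp
  rwa [DbarHopfParallel, HG.complexVector_dbarHopf hx, HG.complexVector_hopf hx]

theorem not_isSWillmoreOn_pedal [ConnectedSpace M] (hn : 5 ≤ n) (hf : IsIsotropic 1 f)
    (hreg : IsRegular f) (hsub : IsSubstantial f) (hg : IsImmersionOn (pedal f o) Set.univ)
    {U : Set M} (hU : U.Nonempty) : ¬ IsSWillmoreOn (pedal f o) U := by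
  intro h
  obtain ⟨p, hp⟩ := hU
  obtain ⟨e, he, hpe, -, h⟩ := h p hp
  have H := hf.isotropicOn he fun x hx =>
    (areConformal_pedal hf hg).isIsothermalAt he hf.1.1 hg hx (h x hx).1
  have HG := hf.isothermalOn_pedal hg he H
  have hx := e.map_source hpe
  have eq : Set.EqOn (localPedal (f ∘ e.symm) o) (pedal f o ∘ e.symm) e.target := fun y hy =>
    (pedal_comp_symm he (hf.isImmersionOn _) hy).symm
  exact H.not_dbarHopfParallel_pedal HG hx (hf.cubic_ne_zero hn hreg hsub he H hx)
    ((h _ hx).2.congr (HG.congr eq) HG eq.symm hx)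

theorem not_isMoebiusMinimalOn_pedal [ConnectedSpace M] (hn : 5 ≤ n) (hf : IsIsotropic 1 f)
    (hreg : IsRegular f) (hsub : IsSubstantial f) (hg : IsImmersionOn (pedal f o) Set.univ)
    {U : Set M} (hUo : IsOpen U) (hU : U.Nonempty) : ¬ IsMoebiusMinimalOn (pedal f o) U := by
  rintro ⟨T, hT, h, hTh, hm⟩
  obtain ⟨p, hp⟩ := hU
  obtain ⟨e, he, hpe, heU, H⟩ := hf.exists_chart hUo hp
  have HG := hf.isothermalOn_pedal hg he H
  obtain ⟨D', hD', ⟨y, hy⟩, HD', hD⟩ := IsothermalOn.exists_of_moebius hT (h := h ∘ e.symm) HG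
    ⟨_, e.map_source hpe⟩
    (fun x hx hd => H.not_dbarHopfParallel_pedal HG hx (hf.cubic_ne_zero hn hreg hsub he H hx)
      (HG.dbarHopfParallel_of_hopfDependent hx hd))
    (fun x hx => by
      rw [← pedal_comp_symm he (hf.isImmersionOn _) hx]
      exact hTh _ (heU (e.map_target hx)))
  exact hD y hy (HD'.hopfDependent_of_minimal hy fun z hz =>
    hm.2 e he z (hD' hz) (heU (e.map_target (hD' hz))))

end Global

end PedalSurface

end

theorem theorem1 {n : ℕ} (hn : 6 ≤ n) {M : Type*} [TopologicalSpace M]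
    [ChartedSpace (EuclideanSpace ℝ (Fin 2)) M] [IsManifold (𝓡 2) ∞ M] [ConnectedSpace M]
    (f : M → EuclideanSpace ℝ (Fin n))
    (hreg : PedalSurface.IsRegular f)
    (hsub : PedalSurface.IsSubstantial f)
    (hiso : PedalSurface.IsIsotropic 1 f)
    (o : EuclideanSpace ℝ (Fin n))
    (hped : PedalSurface.IsImmersionOn (PedalSurface.pedal f o) Set.univ) :
    (PedalSurface.IsSuperconformal (PedalSurface.pedal f o) ↔ PedalSurface.IsIsotropic 2 f) ∧
    (PedalSurface.IsIsotropic 2 f →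
      PedalSurface.AreConformal f (PedalSurface.pedal f o) ∧
      (∀ U : Set M, IsOpen U → U.Nonempty →
        ¬ PedalSurface.IsMoebiusMinimalOn (PedalSurface.pedal f o) U) ∧
      (∀ U : Set M, IsOpen U → U.Nonempty →
        ¬ PedalSurface.IsSWillmoreOn (PedalSurface.pedal f o) U)) := by
  have h5 : 5 ≤ n := by omega
  refine ⟨⟨PedalSurface.isIsotropic_two_of_isSuperconformal h5 hiso hreg hsub, fun h =>
    PedalSurface.isSuperconformal_of_isIsotropic_two hiso h hped⟩, fun _ =>
    ⟨PedalSurface.areConformal_pedal hiso hped, fun U hUo hU =>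
      PedalSurface.not_isMoebiusMinimalOn_pedal h5 hiso hreg hsub hped hUo hU, fun U _ hU =>
      PedalSurface.not_isSWillmoreOn_pedal h5 hiso hreg hsub hped hU⟩⟩
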